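/- **Setting.** Let $\Gamma$ be a finite undirected graph (loops and multiple edges allowed) with vertex set $V$, edge set $E$, and weights $\mu:V\to(0,\infty)$ with $\sum_v\mu(v)=1$. Let $\vec E$ be the set of directed edges: an edge with distinct endpoints gives two directed edges $\epsilon,\epsilon^{\mathrm{op}}$, and a loop gives one, with $\epsilon=\epsilon^{\mathrm{op}}$; $s(\epsilon),t(\epsilon)$ denote source and target. The Fock space has orthonormal basis the paths of the directed graph (one path of length $0$ at each vertex $v$, with basis vector $\delta_v$). On it, $p_v$ is the projection onto the paths that start at $v$, $\ell(\epsilon)$ sends $\gamma$ to $\epsilon\gamma$ if $\gamma$ starts at $t(\epsilon)$ and to $0$ otherwise, and $$x_\epsilon=\sqrt[4]{\tfrac{\mu(s(\epsilon))}{\mu(t(\epsilon))}}\;\ell(\epsilon)+\sqrt[4]{\tfrac{\mu(t(\epsilon))}{\mu(s(\epsilon))}}\;\ell(\epsilon^{\mathrm{op}})^*,\qquad \tau(T)=\sum_{v}\mu(v)\langle\delta_v,T\delta_v\rangle .$$ Let $R>0$ satisfy $R>\max_\epsilon\|x_\epsilon\|$. For $0<S\le R$ let $A_S$ be the $*$-algebra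 of power series $\sum_\gamma c(\gamma)x_\gamma$ over paths with $\sum_\gamma|c(\gamma)|S^{|\gamma|}<\infty$, where $x_\gamma=x_{\epsilon_1}\cdots x_{\epsilon_n}$ for $\gamma=\epsilon_1\cdots\epsilon_n$, $x_\gamma=p_v$ for the path of length $0$ at $v$, and $x_\epsilon^*=x_{\epsilon^{\mathrm{op}}}$. The elements of $A_S$ are regarded as power series, and equalities are equalities of power series; for $S>\max_\epsilon\|x_\epsilon\|$ they are identified with the operators they represent, and $\tau$ is applied to these operators. Let $A\subset A_S$ be the polynomials, and $A_S\hat\otimes A_S^{\mathrm{op}}$ the projective tensor product, with product $(a\otimes b)(c\otimes d)=ac\otimes db$, adjoint $(a\otimes b)^*=a^*\otimes b^*$ and action $(a\otimes b)\#c=acb$. Let $A_S^{\vec E}$ be the tuples with $f_\epsilon=p_{s(\epsilon)}f_\epsilon p_{t(\epsilon)}$, and $A^{\vec E}$ those with polynomial entries; $\langle f,h\rangle=\sum_\epsilon\tau(f_\epsilon^*h_\epsilon)$. Let $P=\mathrm{diag}(p_{s(\epsilon)}\otimes p_{t(\epsilon)})$ and let $\mathbb M(A_S)$ be the matrices $Q=PQP$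 indexed by $\vec E\times\vec E$ over $A_S\hat\otimes A_S^{\mathrm{op}}$, with unit $Q^0=P$, adjoint $[Q^*]_{\epsilon\phi}=[Q]_{\phi\epsilon}^*$, action $(Q\#f)_\epsilon=\sum_\phi[Q]_{\epsilon\phi}\#f_\phi$, and $\langle Q_1,Q_2\rangle=(\tau\otimes\tau)\mathrm{Tr}(Q_1^*Q_2)$. The free difference quotient is $\partial_\epsilon x_\gamma=\sum_{\gamma=\alpha\epsilon\beta}x_\alpha\otimes x_\beta$, the cyclic derivative is $\mathscr D_\epsilon=m\circ\sigma\circ\partial_{\epsilon^{\mathrm{op}}}$ with $m(a\otimes b)=ab$ and $\sigma(a\otimes b)=b\otimes a$, the cyclic gradient is $\mathscr Dg=(\mathscr D_\epsilon g)_\epsilon$, the Jacobian is $[\mathscr Jf]_{\epsilon\phi}=\partial_\phi f_\epsilon$, and $\mathscr J^*$ is the adjoint of $\mathscr J$, densely defined on $A^{\vec E}$: $h=\mathscr J^*(Q)$ means $\langle h,q\rangle=\langle Q,\mathscr Jq\rangle$ for all $q\in A^{\vec E}$. **Theorem 2.3.** Let $g=g^*\in A_R$, let $f=\mathscr Dg$,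 and let $m\ge1$ be an integer. Then for every $0<S<R$ one has $f\in A_S^{\vec E}$, $(\mathscr Jf)^m\in\mathbb M(A_S)$ and $(1\otimes\tau+\tau\otimes1)\circ\mathrm{Tr}((\mathscr Jf)^m)\in A_S$; the matrices $(\mathscr Jf)^{m-1}$ and $(\mathscr Jf)^m$ are in the domain of $\mathscr J^*$, with values in $A_S^{\vec E}$ for every $0<S<R$; and $$\frac1m\,\mathscr D\big[(1\otimes\tau+\tau\otimes1)\circ\mathrm{Tr}\big((\mathscr Jf)^m\big)\big]=(\mathscr Jf)\#\mathscr J^*\big((\mathscr Jf)^{m-1}\big)-\mathscr J^*\big((\mathscr Jf)^m\big).$$ -/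

import Mathlib

noncomputable section

namespace FreeGraph

/-! ### Weighted graphs, directed edges and paths -/

/-- An undirected weighted graph on the finite vertex set `V` with edge set `E`; loops and multiple
edges are allowed. The weights of the vertices are positive and sum to `1`. -/
structure WeightedGraph (V E : Type*) [Fintype V] where
  ends : E → Sym2 V
  weight : V → ℝ
  weight_pos : ∀ v, 0 < weight v
  weight_sum : ∑ v, weight v = 1

namespace WeightedGraph

/-- The directed edges: a directed edge is an edge `e` together with an orientation `(v, w)` of it.
So an edge with two distinct endpoints gives two directed edges, and a loop gives exactly one. -/
def Dart {V E : Type*} [Fintype V] (G : WeightedGraph V E) : Type _ :=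
  {d : E × V × V // G.ends d.1 = s(d.2.1, d.2.2)}

instance {V E : Type*} [Fintype V] [Fintype E] (G : WeightedGraph V E) : Finite G.Dart :=
  inferInstanceAs (Finite {d : E × V × V // G.ends d.1 = s(d.2.1, d.2.2)})

instance {V E : Type*} [Fintype V] [Fintype E] (G : WeightedGraph V E) : Fintype G.Dart :=
  Fintype.ofFinite _

variable {V E : Type*} [Fintype V] {G : WeightedGraph V E}

/-- The source of a directed edge. -/
def Dart.src (ε : G.Dart) : V := ε.1.2.1

/-- The target of a directed edge. -/
def Dart.tgt (ε : G.Dart) : V := ε.1.2.2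

/-- The opposite of a directed edge; the opposite of a loop is the loop itself. -/
def Dart.op (ε : G.Dart) : G.Dart :=
  ⟨(ε.1.1, ε.1.2.2, ε.1.2.1), by rw [Sym2.eq_swap]; exact ε.2⟩

/-- `IsWalk v l`: the word `l` of directed edges is a path that starts at `v`. -/
def IsWalk : V → List G.Dart → Prop
  | _, [] => True
  | v, e :: l => e.src = v ∧ IsWalk e.tgt l

/-- The end point of the word `l` read from `v`. -/
def walkEnd : V → List G.Dart → V
  | v, [] => v
  | _, e :: l => walkEnd e.tgt l

theorem isWalk_append (v : V) (l l' : List G.Dart) :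
    IsWalk v (l ++ l') ↔ IsWalk v l ∧ IsWalk (walkEnd v l) l' := by
  induction l generalizing v with
  | nil => simp [IsWalk, walkEnd]
  | cons e l ih => simp [IsWalk, walkEnd, ih, and_assoc]

theorem walkEnd_append (v : V) (l l' : List G.Dart) :
    walkEnd v (l ++ l') = walkEnd (walkEnd v l) l' := by
  induction l generalizing v with
  | nil => rfl
  | cons e l ih => exact ih _

theorem isWalk_reverse (v : V) (l : List G.Dart) (h : IsWalk v l) :
    IsWalk (walkEnd v l) (l.map Dart.op).reverse ∧
      walkEnd (walkEnd v l) (l.map Dart.op).reverse = v := by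
  induction l generalizing v with
  | nil => exact ⟨trivial, rfl⟩
  | cons e l ih =>
    obtain ⟨h1, h2⟩ := h
    obtain ⟨h3, h4⟩ := ih _ h2
    simp only [List.map_cons, List.reverse_cons, isWalk_append, walkEnd_append]
    exact ⟨⟨h3, h4.symm, trivial⟩, h1⟩

variable (G) in
/-- The paths of the directed graph, including a path of length zero at every vertex. -/
@[ext]
structure Walk where
  src : V
  word : List G.Dart
  valid : IsWalk src word

namespace Walk

/-- The end point of a path. -/
def tgt (γ : G.Walk) : V := walkEnd γ.src γ.word

/-- The number of edges of a path. -/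
def length (γ : G.Walk) : ℕ := γ.word.length

variable (G) in
/-- The path of length zero at `v`. -/
def nil (v : V) : G.Walk := ⟨v, [], trivial⟩

/-- The initial piece of length `i` of a path. -/
def take (γ : G.Walk) (i : ℕ) : G.Walk :=
  ⟨γ.src, γ.word.take i, by
    have h := γ.valid
    rw [← List.take_append_drop i γ.word, isWalk_append] at h
    exact h.1⟩

/-- What remains of a path after its first `i` edges. -/
def drop (γ : G.Walk) (i : ℕ) : G.Walk :=
  ⟨walkEnd γ.src (γ.word.take i), γ.word.drop i, by
    have h := γ.valid
    rw [← List.take_append_drop i γ.word, isWalk_append] at h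
    exact h.2⟩

/-- The opposite path `εₙᵒᵖ ⋯ ε₁ᵒᵖ` of `ε₁ ⋯ εₙ`. -/
def rev (γ : G.Walk) : G.Walk :=
  ⟨γ.tgt, (γ.word.map Dart.op).reverse, (isWalk_reverse _ _ γ.valid).1⟩

/-- The path `α ε β`, when these pieces are composable. -/
def join (α : G.Walk) (ε : G.Dart) (β : G.Walk) (h : α.tgt = ε.src ∧ ε.tgt = β.src) : G.Walk :=
  ⟨α.src, α.word ++ ε :: β.word,
    (isWalk_append _ _ _).2 ⟨α.valid, h.1.symm, h.2 ▸ β.valid⟩⟩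

end Walk

/-! ### The free graph algebra on the Fock space -/

variable (G) in
/-- The Hilbert space with orthonormal basis the paths. It is the Fock space of the graph (a right
`ℓ^∞(V)`-module, the path `γ` lying over its end point) with the `ℓ^∞(V)`-valued inner product
integrated against the counting measure of the finite set `V`; this gives a faithful representation
of the adjointable operators of the Fock module. -/
abbrev Fock : Type _ := lp (fun _ : G.Walk => ℂ) 2

/-- For a partially defined injective map `f` on the index set, the contraction
`(T ξ)(a) = ξ (f a)` (and `0` where `f` is not defined) of `ℓ²`. -/
def partialComp {ι : Type*} (f : ι → Option ι)
    (hf : ∀ a b c, f a = some c → f b = some c → a = b) :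
    lp (fun _ : ι => ℂ) 2 →L[ℂ] lp (fun _ : ι => ℂ) 2 :=
  have key : ∀ (ξ : lp (fun _ : ι => ℂ) 2) (s : Finset ι),
      ∑ a ∈ s, ‖(f a).elim (0 : ℂ) ξ‖ ^ (2 : ENNReal).toReal ≤ ‖ξ‖ ^ (2 : ENNReal).toReal := by
    intro ξ s
    classical
    have h2 : ∀ a ∈ s, a ∉ s.filter (fun a => (f a).isSome) →
        ‖(f a).elim (0 : ℂ) ξ‖ ^ (2 : ENNReal).toReal = 0 := by
      intro a ha hna
      have : f a = none := by simpa [ha] using hna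
      simp [this]
    rw [← Finset.sum_subset (Finset.filter_subset _ s) h2]
    have h3 : ∑ a ∈ s.filter (fun a => (f a).isSome),
        ‖(f a).elim (0 : ℂ) ξ‖ ^ (2 : ENNReal).toReal
        = ∑ c ∈ (s.filter (fun a => (f a).isSome)).image (fun a => (f a).getD a),
          ‖ξ c‖ ^ (2 : ENNReal).toReal := by
      rw [Finset.sum_image]
      · refine Finset.sum_congr rfl fun a ha => ?_
        obtain ⟨c, hc⟩ := Option.isSome_iff_exists.1 (Finset.mem_filter.1 ha).2
        simp [hc]
      · intro a ha b hb hab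
        obtain ⟨c, hc⟩ := Option.isSome_iff_exists.1 (Finset.mem_filter.1 ha).2
        obtain ⟨d, hd⟩ := Option.isSome_iff_exists.1 (Finset.mem_filter.1 hb).2
        have hcd : c = d := by simpa [hc, hd] using hab
        exact hf a b c hc (hcd ▸ hd)
    rw [h3]
    exact lp.sum_rpow_le_norm_rpow (by norm_num) ξ _
  LinearMap.mkContinuous
    { toFun := fun ξ => ⟨fun a => (f a).elim (0 : ℂ) ξ, memℓp_gen' (key ξ)⟩
      map_add' := by
        intro ξ η
        ext a
        change (f a).elim (0 : ℂ) (⇑ξ + ⇑η) = (f a).elim (0 : ℂ) ξ + (f a).elim (0 : ℂ) η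
        rcases f a with _ | c <;> simp
      map_smul' := by
        intro r ξ
        ext a
        change (f a).elim (0 : ℂ) (r • ⇑ξ) = r • (f a).elim (0 : ℂ) ξ
        rcases f a with _ | c <;> simp }
    1 (by
      intro ξ
      rw [one_mul]
      exact lp.norm_le_of_forall_sum_le (by norm_num) (norm_nonneg _) (key ξ))

open Classical in
/-- The action of the projection `p_v` from the left: it keeps the paths that start at `v`. -/
def proj (v : V) : G.Fock →L[ℂ] G.Fock :=
  partialComp (fun γ : G.Walk => if γ.src = v then some γ else none) (by
    intro a b c ha hb
    split_ifs at ha hb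
    simp_all)

open Classical in
/-- `creationIndex ε` sends a path `ε γ` to `γ`, and is undefined on the other paths. -/
def creationIndex (ε : G.Dart) : G.Walk → Option G.Walk
  | ⟨_, [], _⟩ => none
  | ⟨_, e :: l, h⟩ => if e = ε then some ⟨e.tgt, l, h.2⟩ else none

/-- The creation operator `ℓ(ε)`: it sends the basis vector of a path `γ` to that of `ε γ` if `γ`
starts at `t(ε)`, and to `0` otherwise. -/
def creation (ε : G.Dart) : G.Fock →L[ℂ] G.Fock :=
  partialComp (creationIndex ε) (by
    rintro ⟨v, l, hv⟩ ⟨w, l', hw⟩ c ha hb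
    rcases l with _ | ⟨e, l⟩ <;> rcases l' with _ | ⟨e', l'⟩ <;>
      simp only [creationIndex, reduceCtorEq] at ha hb
    split_ifs at ha hb with h1 h2
    subst h1 h2
    rw [← hb] at ha
    have h3 : l = l' := by simpa using ha
    subst h3
    obtain rfl : e'.src = v := hv.1
    obtain rfl : e'.src = w := hw.1
    rfl)

/-- The generator `x_ε = (μ(s(ε))/μ(t(ε)))^{1/4} ℓ(ε) + (μ(t(ε))/μ(s(ε)))^{1/4} ℓ(ε^{op})^*`. -/
def x (ε : G.Dart) : G.Fock →L[ℂ] G.Fock :=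
  (((G.weight ε.src / G.weight ε.tgt) ^ (1 / 4 : ℝ) : ℝ) : ℂ) • creation ε +
    (((G.weight ε.tgt / G.weight ε.src) ^ (1 / 4 : ℝ) : ℝ) : ℂ) •
      ContinuousLinearMap.adjoint (creation ε.op)

/-- The product `x_γ = p_{s(γ)} x_{ε₁} ⋯ x_{εₙ}` along a path `γ = ε₁ ⋯ εₙ`. -/
def xWalk (γ : G.Walk) : G.Fock →L[ℂ] G.Fock := proj γ.src * (γ.word.map x).prod

open Classical in
/-- The free graph law `τ(T) = ∑_v μ(v) ⟨p_v | T p_v⟩`. -/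
def tauOp (T : G.Fock →L[ℂ] G.Fock) : ℂ :=
  ∑ v, (G.weight v : ℂ) *
    inner ℂ (lp.single 2 (Walk.nil G v) (1 : ℂ) : G.Fock) (T (lp.single 2 (Walk.nil G v) (1 : ℂ)))

/-! ### Power series in the generators, and the algebra `B_R ≅ A_R` -/

variable (G) in
/-- Formal power series `∑ c(γ) z_γ` over the paths; the paths of length zero carry the `ℓ^∞(V)`
part. -/
abbrev Series : Type _ := G.Walk → ℂ

variable (G) in
/-- Formal power series `∑ c(α, β) z_α ⊗ z_β` for the tensor product with the opposite algebra. -/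
abbrev Series₂ : Type _ := G.Walk × G.Walk → ℂ

/-- Membership in `B_R`: `∑ |c(γ)| R^{|γ|} < ∞`. -/
def MemB (R : ℝ) (c : G.Series) : Prop := Summable fun γ : G.Walk => ‖c γ‖ * R ^ γ.length

/-- Membership in the projective tensor product of `B_R` and its opposite: as `B_R` is a weighted
`ℓ¹` space (up to an equivalent norm), this is the weighted `ℓ¹` space over the pairs of paths. -/
def MemB₂ (R : ℝ) (Q : G.Series₂) : Prop :=
  Summable fun p : G.Walk × G.Walk => ‖Q p‖ * R ^ (p.1.length + p.2.length)

/-- The element of the C*-algebra `S(Γ, μ)` that a power series represents, `z_ε ↦ x_ε`. -/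
def eval (c : G.Series) : G.Fock →L[ℂ] G.Fock := ∑' γ, c γ • xWalk γ

/-- The free graph law on power series. -/
def tau (c : G.Series) : ℂ := tauOp (eval c)

/-- The product of power series. -/
def mul (c d : G.Series) : G.Series := fun γ =>
  ∑ i ∈ Finset.range (γ.length + 1), c (γ.take i) * d (γ.drop i)

/-- The involution of power series, `z_ε^* = z_{ε^{op}}`. -/
def adj (c : G.Series) : G.Series := fun γ => star (c γ.rev)

/-- The product `(a ⊗ b)(c ⊗ d) = ac ⊗ db`. -/
def mul₂ (Q Q' : G.Series₂) : G.Series₂ := fun p =>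
  ∑ i ∈ Finset.range (p.1.length + 1), ∑ j ∈ Finset.range (p.2.length + 1),
    Q (p.1.take i, p.2.drop j) * Q' (p.1.drop i, p.2.take j)

/-- The adjoint `(a ⊗ b)^* = a^* ⊗ b^*`. -/
def adj₂ (Q : G.Series₂) : G.Series₂ := fun p => star (Q (p.1.rev, p.2.rev))

/-- The flip `σ(a ⊗ b) = b ⊗ a`. -/
def flip (Q : G.Series₂) : G.Series₂ := fun p => Q (p.2, p.1)

/-- The multiplication map `m(a ⊗ b) = ab`. -/
def multiply (Q : G.Series₂) : G.Series := fun γ =>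
  ∑ i ∈ Finset.range (γ.length + 1), Q (γ.take i, γ.drop i)

/-- The action `(a ⊗ b) # c = a c b`. -/
def act (Q : G.Series₂) (c : G.Series) : G.Series := fun γ =>
  ∑ i ∈ Finset.range (γ.length + 1), ∑ j ∈ Finset.range ((γ.drop i).length + 1),
    Q (γ.take i, (γ.drop i).drop j) * c ((γ.drop i).take j)

/-- `(1 ⊗ τ)(a ⊗ b) = τ(b) a`. -/
def oneTau (Q : G.Series₂) : G.Series := fun α => tau fun β => Q (α, β)

/-- `(τ ⊗ 1)(a ⊗ b) = τ(a) b`. -/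
def tauOne (Q : G.Series₂) : G.Series := fun β => tau fun α => Q (α, β)

/-- `(τ ⊗ τ)(a ⊗ b) = τ(a) τ(b)`. -/
def tauTau (Q : G.Series₂) : ℂ := tau (oneTau Q)

/-! ### Tuples and matrices indexed by the directed edges -/

variable (G) in
/-- Tuples of power series indexed by the directed edges. -/
abbrev Tuple : Type _ := G.Dart → G.Series

variable (G) in
/-- Matrices over the tensor product indexed by the directed edges. -/
abbrev Mat : Type _ := G.Dart → G.Dart → G.Series₂

/-- The condition `f_ε = p_{s(ε)} f_ε p_{t(ε)}`: only paths from `s(ε)` to `t(ε)` occur in `f_ε`. -/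
def IsCompressed (f : G.Tuple) : Prop :=
  ∀ ε γ, f ε γ ≠ 0 → γ.src = ε.src ∧ γ.tgt = ε.tgt

/-- Membership in `B_R^{\vec E}`. -/
def MemTuple (R : ℝ) (f : G.Tuple) : Prop := IsCompressed f ∧ ∀ ε, MemB R (f ε)

/-- Membership in `A^{\vec E}`, the tuples of polynomials. -/
def IsPolyTuple (q : G.Tuple) : Prop := IsCompressed q ∧ ∀ ε, (Function.support (q ε)).Finite

/-- Membership in the compression by `P` of the matrices over the projective tensor product, that
is, `Q_{εφ} = (p_{s(ε)} ⊗ p_{t(ε)}) Q_{εφ} (p_{s(φ)} ⊗ p_{t(φ)})`. -/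
def MemMat (R : ℝ) (Q : G.Mat) : Prop :=
  (∀ ε φ p, Q ε φ p ≠ 0 →
    p.1.src = ε.src ∧ p.1.tgt = φ.src ∧ p.2.src = φ.tgt ∧ p.2.tgt = ε.tgt) ∧
  ∀ ε φ, MemB₂ R (Q ε φ)

variable (G) in
open Classical in
/-- The diagonal matrix `P` with entries `p_{s(ε)} ⊗ p_{t(ε)}`, the unit of the compression. -/
def P : G.Mat := fun ε φ p =>
  if ε = φ ∧ p = (Walk.nil G ε.src, Walk.nil G ε.tgt) then 1 else 0

/-- The product of matrices. -/
def matMul [Fintype E] (Q Q' : G.Mat) : G.Mat := fun ε φ => ∑ ω, mul₂ (Q ε ω) (Q' ω φ)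

/-- The powers of a matrix in the compression, `Q⁰ = P`. -/
def matPow [Fintype E] (Q : G.Mat) : ℕ → G.Mat
  | 0 => P G
  | n + 1 => matMul (matPow Q n) Q

/-- The adjoint of a matrix. -/
def matAdj (Q : G.Mat) : G.Mat := fun ε φ => adj₂ (Q φ ε)

/-- The trace of a matrix. -/
def matTr [Fintype E] (Q : G.Mat) : G.Series₂ := ∑ ε, Q ε ε

/-- The action of matrices on tuples, `(Q # f)_ε = ∑_φ Q_{εφ} # f_φ`. -/
def matAct [Fintype E] (Q : G.Mat) (f : G.Tuple) : G.Tuple := fun ε => ∑ φ, act (Q ε φ) (f φ)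

/-- `⟨Q, Q'⟩ = (τ ⊗ τ) ∘ Tr (Q^* Q')`. -/
def matInner [Fintype E] (Q Q' : G.Mat) : ℂ := tauTau (matTr (matMul (matAdj Q) Q'))

/-- The adjoint of a tuple, `(f^*)_ε = (f_{ε^{op}})^*`. -/
def tupleAdj (f : G.Tuple) : G.Tuple := fun ε => adj (f ε.op)

/-- The dot product `f # f' = ∑_ε f_ε f'_{ε^{op}}`. -/
def dot [Fintype E] (f f' : G.Tuple) : G.Series := ∑ ε, mul (f ε) (f' ε.op)

/-- `⟨f, f'⟩ = τ(f^* # f')`. -/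
def tupleInner [Fintype E] (f f' : G.Tuple) : ℂ := tau (dot (tupleAdj f) f')

/-! ### Differential operators -/

open Classical in
/-- The free difference quotient `∂_ε`, that is, `∂_ε z_γ = ∑_{γ = α ε β} z_α ⊗ z_β`. This is the
derivation with `∂_ε z_φ = δ_{ε,φ} p_{s(ε)} ⊗ p_{t(ε)}`, extended to power series. -/
def diffQuot (ε : G.Dart) (c : G.Series) : G.Series₂ := fun p =>
  if h : p.1.tgt = ε.src ∧ ε.tgt = p.2.src then c (p.1.join ε p.2 h) else 0

/-- The cyclic derivative `𝒟_ε = m ∘ σ ∘ ∂_{ε^{op}}`. -/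
def cyclicDeriv (ε : G.Dart) (c : G.Series) : G.Series := multiply (flip (diffQuot ε.op c))

/-- The cyclic gradient `𝒟`. -/
def cyclicGrad (c : G.Series) : G.Tuple := fun ε => cyclicDeriv ε c

/-- The noncommutative Jacobian `[𝒥 f]_{εφ} = ∂_φ f_ε`. -/
def jac (f : G.Tuple) : G.Mat := fun ε φ => diffQuot φ (f ε)

/-- `h = 𝒥^*(Q)`: the matrix `Q` is in the domain of the Hilbert space adjoint of the unbounded
operator `𝒥`, which is densely defined on the polynomial tuples, with value `h`. As the polynomial
tuples are dense and `τ` is faithful, `Q` determines `h`. -/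
def IsJacAdjoint [Fintype E] (Q : G.Mat) (h : G.Tuple) : Prop :=
  ∀ q : G.Tuple, IsPolyTuple q → tupleInner h q = matInner Q (jac q)

end WeightedGraph
end FreeGraph

end

/-! ### Paths as a semigroup with zero, and sums over their factorizations. -/

noncomputable section
namespace FreeGraph
namespace WeightedGraph

variable {V E : Type*} [Fintype V] {G : WeightedGraph V E}

/-! ### Paths with a zero: partial concatenation -/

/-! An identity of power series can be tested against functions `k` on paths; point masses recover
the coefficients. Every operation in the theorem is given by a kernel on paths, so it can be moved
onto the test function (`pair_push`). The theorem then becomes an identity between finite sums over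
factorizations of paths. The estimates serve only to make the series converge absolutely, so that
they may be rearranged.

The probabilistic input is the Schwinger-Dyson equation √(μ(s(ε))μ(t(ε))) τ(x_{ε^op} w) = ∑_{w =
αεβ} τ(α)τ(β) (`schwinger_dyson`). It is read off on the Fock space by matching the annihilation of
an edge with the letter that created it. Combined with reversal of paths it shows that τ is a trace
(`t0_mul_comm`). It also gives the explicit formula ∂_ε^*(a ⊗ b) = κ aεb − ∑_{a = αε^opβ} τ(β) αb −
∑_{b = αε^opβ} τ(α) aβ, with κ the square root above (`isJacAdjoint_jacAdj`).

Write A = 𝒥f. In A # 𝒥^*(B) − 𝒥^*(AB) the κ-terms cancel, and by the Leibniz rule so do the cuts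
inside B. What is left is the sum over the cuts inside A (`defectKer`, `pair_matAct_jacAdj`).

On the other side, 𝒟 of (1 ⊗ τ + τ ⊗ 1)Tr(BA) is `trPair B A` + `trPair A B`, where `trPair`
differentiates only its second matrix. Traciality makes `trPair` a derivation in that matrix
(`trPair_matMul_right`). Hence the trace of A^m contributes m times `trPair` of A^{m-1} and A, which
cancels the factor 1/m.

It remains to identify this `trPair` with the defect of A and A^{m-1} (`trPair_jac_cyclicGrad`).
Here f must be a cyclic gradient: the coefficient of 𝒟_φ g at a ω^op w is the coefficient of 𝒟_ω g
at w φ^op a (`ext0_cyclicDeriv_cyclic`). So cutting row φ at ω^op amounts to cutting row ω at φ^op.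
-/

@[simp] theorem Dart.op_op (ε : G.Dart) : ε.op.op = ε := rfl
@[simp] theorem Dart.op_src (ε : G.Dart) : ε.op.src = ε.tgt := rfl
@[simp] theorem Dart.op_tgt (ε : G.Dart) : ε.op.tgt = ε.src := rfl

/-- The concatenation of two composable paths. -/
def Walk.append (a b : G.Walk) (h : a.tgt = b.src) : G.Walk :=
  ⟨a.src, a.word ++ b.word, (isWalk_append _ _ _).2 ⟨a.valid, by
    have := b.valid
    rw [← h] at this
    exact this⟩⟩

theorem Walk.append_tgt (a b : G.Walk) (h : a.tgt = b.src) : (a.append b h).tgt = b.tgt := by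
  have : (a.append b h).tgt = walkEnd a.tgt b.word := walkEnd_append _ _ _
  rw [this, h]
  rfl

variable (G) in
/-- The paths together with a zero, the value of a product that is not composable. -/
def PWalk : Type _ := Option G.Walk

/-- A path as an element of the semigroup with zero. -/
def up (a : G.Walk) : G.PWalk := some a

-- A total product removes all composability conditions: functions on paths are extended by zero,
-- and the Leibniz rules and the reversal rule become identities in a semigroup.
open Classical in
instance : SemigroupWithZero G.PWalk where
  zero := none
  mul u v := u.elim none fun a => v.elim none fun b =>
    if h : a.tgt = b.src then some (a.append b h) else none
  zero_mul _ := rfl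
  mul_zero u := by cases u <;> rfl
  mul_assoc u v w := by
    rcases u with _ | a
    · rfl
    rcases v with _ | b
    · rfl
    rcases w with _ | c
    · change (if h : a.tgt = b.src then some (a.append b h) else none).elim _ _ = none
      split_ifs <;> rfl
    change (if h : a.tgt = b.src then some (a.append b h) else none).elim none
        (fun a => if h : a.tgt = c.src then some (a.append c h) else none) =
      (if h : b.tgt = c.src then some (b.append c h) else none).elim none
        (fun b => if h : a.tgt = b.src then some (a.append b h) else none)
    by_cases h : a.tgt = b.src <;> by_cases h' : b.tgt = c.src
    · have h1 : (a.append b h).tgt = c.src := by rw [Walk.append_tgt, h']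
      have h2 : a.tgt = (b.append c h').src := h
      simp only [h, h', dif_pos, Option.elim_some, h1]
      rw [dif_pos (show b.src = (b.append c h').src from rfl)]
      refine congrArg some (Walk.ext rfl ?_)
      simp [Walk.append]
    · have h1 : ¬ (a.append b h).tgt = c.src := by rw [Walk.append_tgt]; exact h'
      simp [h, h', h1]
    · have h2 : ¬ a.tgt = (b.append c h').src := h
      simp [h, h', h2]
    · simp [h, h']

theorem PWalk.cases (w : G.PWalk) : w = 0 ∨ ∃ a, w = up a := by
  rcases w with _ | a
  · exact Or.inl rfl
  · exact Or.inr ⟨a, rfl⟩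

theorem up_injective : Function.Injective (up : G.Walk → G.PWalk) := Option.some_injective _

@[simp] theorem up_inj {a b : G.Walk} : up a = up b ↔ a = b := up_injective.eq_iff

@[simp] theorem up_ne_zero (a : G.Walk) : up a ≠ 0 := Option.some_ne_none a

theorem up_mul_up (a b : G.Walk) (h : a.tgt = b.src) : up a * up b = up (a.append b h) :=
  dif_pos h

theorem up_mul_up_of_ne (a b : G.Walk) (h : a.tgt ≠ b.src) : up a * up b = 0 :=
  dif_neg h

theorem up_mul_up_eq_iff (a b c : G.Walk) :
    up a * up b = up c ↔ a.tgt = b.src ∧ c.src = a.src ∧ c.word = a.word ++ b.word := by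
  by_cases h : a.tgt = b.src
  · rw [up_mul_up a b h, up_inj]
    constructor
    · rintro rfl
      exact ⟨h, rfl, rfl⟩
    · rintro ⟨-, h1, h2⟩
      exact (show c = a.append b h from Walk.ext h1 h2).symm
  · rw [up_mul_up_of_ne a b h]
    exact ⟨fun h' => absurd h'.symm (up_ne_zero c), fun h' => absurd h'.1 h⟩

theorem src_tgt_length_of_mul {a b c : G.Walk} (h : up a * up b = up c) :
    c.src = a.src ∧ c.tgt = b.tgt ∧ c.length = a.length + b.length ∧ a.tgt = b.src := by
  have h0 := (up_mul_up_eq_iff a b c).1 h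
  have hab := h0.1
  rw [up_mul_up a b hab, up_inj] at h
  clear h0
  subst h
  refine ⟨rfl, Walk.append_tgt _ _ _, ?_, hab⟩
  simp [Walk.length, Walk.append]

/-- The path of length one. -/
def edgeWalk (ε : G.Dart) : G.Walk := ⟨ε.src, [ε], rfl, trivial⟩

/-- The path of length one, in the semigroup with zero. -/
def edge (ε : G.Dart) : G.PWalk := up (edgeWalk ε)

@[simp] theorem edgeWalk_src (ε : G.Dart) : (edgeWalk ε).src = ε.src := rfl
@[simp] theorem edgeWalk_tgt (ε : G.Dart) : (edgeWalk ε).tgt = ε.tgt := rfl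
@[simp] theorem edgeWalk_length (ε : G.Dart) : (edgeWalk ε).length = 1 := rfl

theorem up_join (α : G.Walk) (ε : G.Dart) (β : G.Walk) (h : α.tgt = ε.src ∧ ε.tgt = β.src) :
    up (α.join ε β h) = up α * edge ε * up β := by
  rw [edge, up_mul_up α (edgeWalk ε) h.1]
  symm
  rw [up_mul_up_eq_iff]
  refine ⟨?_, rfl, ?_⟩
  · exact (Walk.append_tgt α (edgeWalk ε) h.1).trans h.2
  · simp [Walk.join, Walk.append, edgeWalk]

theorem up_mul_edge_mul_up_of_not (α : G.Walk) (ε : G.Dart) (β : G.Walk)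
    (h : ¬ (α.tgt = ε.src ∧ ε.tgt = β.src)) : up α * edge ε * up β = 0 := by
  by_cases h1 : α.tgt = ε.src
  · have h2 : ¬ ε.tgt = β.src := fun h2 => h ⟨h1, h2⟩
    rw [mul_assoc, edge, up_mul_up_of_ne (edgeWalk ε) β h2, mul_zero]
  · rw [edge, up_mul_up_of_ne α (edgeWalk ε) h1, zero_mul]

theorem src_tgt_length_of_cut {α β c : G.Walk} {ε : G.Dart} (h : up α * edge ε * up β = up c) :
    c.src = α.src ∧ c.tgt = β.tgt ∧ c.length = α.length + β.length + 1 ∧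
      α.tgt = ε.src ∧ ε.tgt = β.src := by
  rcases PWalk.cases (up α * edge ε) with h0 | ⟨d, hd⟩
  · rw [h0, zero_mul] at h
    exact absurd h.symm (up_ne_zero c)
  · rw [hd] at h
    obtain ⟨h1, h2, h3, h4⟩ := src_tgt_length_of_mul h
    obtain ⟨h1', h2', h3', h4'⟩ := src_tgt_length_of_mul hd
    refine ⟨h1.trans h1', h2, ?_, h4', h2'.symm.trans h4⟩
    rw [h3, h3', edgeWalk_length]; omega

/-! ### Cutting paths -/

theorem drop_tgt (γ : G.Walk) (i : ℕ) : (γ.drop i).tgt = γ.tgt := by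
  have := walkEnd_append γ.src (γ.word.take i) (γ.word.drop i)
  rw [List.take_append_drop] at this
  exact this.symm

theorem up_take_mul_up_drop (γ : G.Walk) (i : ℕ) : up (γ.take i) * up (γ.drop i) = up γ := by
  rw [up_mul_up_eq_iff]
  exact ⟨rfl, rfl, (List.take_append_drop _ _).symm⟩

theorem take_length (γ : G.Walk) {i : ℕ} (h : i ≤ γ.length) : (γ.take i).length = i := by
  simpa [Walk.take, Walk.length] using h

theorem drop_length (γ : G.Walk) (i : ℕ) : (γ.drop i).length = γ.length - i := by
  simp [Walk.drop, Walk.length]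

/-- The length of the first factor determines a factorization, so factorizations correspond to cut
positions. -/
theorem eq_take_drop_of_mul {a b c : G.Walk} (h : up a * up b = up c) :
    a = c.take a.length ∧ b = c.drop a.length := by
  obtain ⟨h1, h2, h3⟩ := (up_mul_up_eq_iff a b c).1 h
  constructor
  · refine Walk.ext h2.symm ?_
    simp [Walk.take, Walk.length, h3]
  · refine Walk.ext ?_ ?_
    · simp only [Walk.drop, Walk.length, h3, List.take_left', h2]
      exact h1.symm
    · simp [Walk.drop, Walk.length, h3]

theorem take_of_mul {a b c : G.Walk} (h : up a * up b = up c) {i : ℕ} (hi : i ≤ a.length) :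
    c.take i = a.take i ∧ up (c.drop i) = up (a.drop i) * up b := by
  obtain ⟨h1, h2, h3⟩ := (up_mul_up_eq_iff a b c).1 h
  have hi' : i ≤ a.word.length := hi
  have e1 : c.word.take i = a.word.take i := by
    rw [h3, List.take_append_of_le_length hi']
  refine ⟨Walk.ext h2 e1, ?_⟩
  symm
  rw [up_mul_up_eq_iff, drop_tgt]
  refine ⟨h1, ?_, ?_⟩
  · simp only [Walk.drop, e1, h2]
  · simp only [Walk.drop, h3, List.drop_append_of_le_length hi']

theorem drop_of_mul {a b c : G.Walk} (h : up a * up b = up c) (i : ℕ) :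
    c.drop (a.length + i) = b.drop i ∧ up (c.take (a.length + i)) = up a * up (b.take i) := by
  obtain ⟨h1, h2, h3⟩ := (up_mul_up_eq_iff a b c).1 h
  have e1 : c.word.take (a.length + i) = a.word ++ b.word.take i := by
    rw [h3, Walk.length, List.take_length_add_append]
  constructor
  · refine Walk.ext ?_ ?_
    · simp only [Walk.drop, e1, h2, walkEnd_append]
      congr 1
    · simp only [Walk.drop, h3, Walk.length, List.drop_length_add_append]
  · symm
    rw [up_mul_up_eq_iff]
    exact ⟨h1, h2, e1⟩

theorem cut_eq (γ : G.Walk) (ε : G.Dart) (i : ℕ) (h : γ.word[i]? = some ε) :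
    up (γ.take i) * edge ε * up (γ.drop (i + 1)) = up γ := by
  obtain ⟨hi, he⟩ := List.getElem?_eq_some_iff.1 h
  have h1 : γ.word.drop i = ε :: γ.word.drop (i + 1) := by
    rw [← he]; exact List.drop_eq_getElem_cons hi
  have h2 : (γ.take i).tgt = ε.src := by
    have := (γ.drop i).valid
    simp only [Walk.drop, h1] at this
    exact this.1.symm
  have h3 : ε.tgt = (γ.drop (i + 1)).src := by
    have e : γ.word.take (i + 1) = γ.word.take i ++ [ε] := by
      rw [List.take_add_one, h]; rfl
    simp only [Walk.drop, e, walkEnd_append]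
    rfl
  rw [← up_join _ _ _ ⟨h2, h3⟩, up_inj]
  refine Walk.ext rfl ?_
  simp only [Walk.join, Walk.take, Walk.drop]
  rw [← h1, List.take_append_drop]

section Sums
variable {A : Type*} [AddCommMonoid A]

/-- The sum of `k α β` over the factorizations `w = α ε β`. -/
def dsum (ε : G.Dart) (k : G.PWalk → G.PWalk → A) (w : G.PWalk) : A :=
  w.elim 0 fun γ => by
    classical
    exact ∑ i ∈ Finset.range γ.length,
      if γ.word[i]? = some ε then k (up (γ.take i)) (up (γ.drop (i + 1))) else 0

/-- The sum of `k u v` over the factorizations `w = u v`. -/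
def ssum (k : G.PWalk → G.PWalk → A) (w : G.PWalk) : A :=
  w.elim 0 fun γ => ∑ i ∈ Finset.range (γ.length + 1), k (up (γ.take i)) (up (γ.drop i))

open Classical in
theorem dsum_up (ε : G.Dart) (k : G.PWalk → G.PWalk → A) (γ : G.Walk) :
    dsum ε k (up γ) = ∑ i ∈ Finset.range γ.length,
      if γ.word[i]? = some ε then k (up (γ.take i)) (up (γ.drop (i + 1))) else 0 := by
  change (∑ i ∈ Finset.range γ.length, _) = _
  refine Finset.sum_congr rfl fun i _ => ?_
  congr

theorem ssum_up (k : G.PWalk → G.PWalk → A) (γ : G.Walk) :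
    ssum k (up γ) = ∑ i ∈ Finset.range (γ.length + 1), k (up (γ.take i)) (up (γ.drop i)) := rfl

@[simp] theorem dsum_zero (ε : G.Dart) (k : G.PWalk → G.PWalk → A) : dsum ε k 0 = 0 := rfl
@[simp] theorem ssum_zero (k : G.PWalk → G.PWalk → A) : ssum k 0 = 0 := rfl

open Classical in
/-- The factorizations of a path as a product of two paths. -/
def splits (γ : G.Walk) : Finset (G.Walk × G.Walk) :=
  (Finset.range (γ.length + 1)).image fun i => (γ.take i, γ.drop i)

theorem mem_splits {γ : G.Walk} {p : G.Walk × G.Walk} :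
    p ∈ splits γ ↔ up p.1 * up p.2 = up γ := by
  classical
  rw [splits, Finset.mem_image]
  constructor
  · rintro ⟨i, -, rfl⟩
    exact up_take_mul_up_drop γ i
  · intro h
    obtain ⟨h1, h2⟩ := eq_take_drop_of_mul h
    refine ⟨p.1.length, ?_, Prod.ext h1.symm h2.symm⟩
    have := (src_tgt_length_of_mul h).2.2.1
    simp only [Finset.mem_range]; omega

theorem sum_splits (γ : G.Walk) (F : G.Walk × G.Walk → A) :
    ∑ i ∈ Finset.range (γ.length + 1), F (γ.take i, γ.drop i) = ∑ p ∈ splits γ, F p := by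
  classical
  rw [splits, Finset.sum_image]
  intro i hi j hj hij
  have hi' : i ≤ γ.length := by simpa [Nat.lt_succ_iff] using hi
  have hj' : j ≤ γ.length := by simpa [Nat.lt_succ_iff] using hj
  have := congrArg (fun p : G.Walk × G.Walk => p.1.length) hij
  simpa [take_length _ hi', take_length _ hj'] using this

open Classical in
/-- The factorizations `γ = α ε β` of a path. -/
def cuts (ε : G.Dart) (γ : G.Walk) : Finset (G.Walk × G.Walk) :=
  ((Finset.range γ.length).filter fun i => γ.word[i]? = some ε).image
    fun i => (γ.take i, γ.drop (i + 1))

theorem mem_cuts {ε : G.Dart} {γ : G.Walk} {p : G.Walk × G.Walk} :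
    p ∈ cuts ε γ ↔ up p.1 * edge ε * up p.2 = up γ := by
  classical
  rw [cuts, Finset.mem_image]
  constructor
  · rintro ⟨i, hi, rfl⟩
    exact cut_eq γ ε i (Finset.mem_filter.1 hi).2
  · intro h
    obtain ⟨h1, h2, h3, h4, h5⟩ := src_tgt_length_of_cut h
    rw [← up_join _ _ _ ⟨h4, h5⟩, up_inj] at h
    subst h
    refine ⟨p.1.length, ?_, ?_⟩
    · simp [Walk.join, Walk.length]
    · refine Prod.ext (Walk.ext rfl ?_) (Walk.ext ?_ ?_)
      · simp [Walk.take, Walk.join, Walk.length]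
      · have e : List.take (p.1.word.length + 1) (p.1.word ++ ε :: p.2.word) =
            p.1.word ++ [ε] := by
          rw [List.take_length_add_append]; simp
        simp only [Walk.drop, Walk.join, Walk.length, e, walkEnd_append]
        exact h5
      · simp only [Walk.drop, Walk.join, Walk.length, List.drop_length_add_append]
        simp

theorem dsum_eq_sum_cuts (ε : G.Dart) (k : G.PWalk → G.PWalk → A) (γ : G.Walk) :
    dsum ε k (up γ) = ∑ p ∈ cuts ε γ, k (up p.1) (up p.2) := by
  classical
  rw [cuts, Finset.sum_image, Finset.sum_filter, dsum_up]
  intro i hi j hj hij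
  have hi' : i < γ.length := by simpa using (Finset.mem_filter.1 hi).1
  have hj' : j < γ.length := by simpa using (Finset.mem_filter.1 hj).1
  have := congrArg (fun p : G.Walk × G.Walk => p.1.length) hij
  simpa [take_length _ hi'.le, take_length _ hj'.le] using this

/-- The Leibniz rule: the removed edge lies either in `c` or in `d`. The vanishing of `k` at zero is
what makes the rule survive non-composable products. -/
theorem dsum_mul (ε : G.Dart) (k : G.PWalk → G.PWalk → A) (h1 : ∀ w, k 0 w = 0)
    (h2 : ∀ w, k w 0 = 0) (c d : G.PWalk) :
    dsum ε k (c * d) = dsum ε (fun α β => k α (β * d)) c + dsum ε (fun α β => k (c * α) β) d := by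
  classical
  rcases PWalk.cases c with rfl | ⟨c, rfl⟩
  · rcases PWalk.cases d with rfl | ⟨d, rfl⟩ <;> simp [h1, dsum_up]
  rcases PWalk.cases d with rfl | ⟨d, rfl⟩
  · simp [h2, dsum_up]
  rcases PWalk.cases (up c * up d) with h0 | ⟨e, he⟩
  -- Cutting keeps the outer endpoints, so each summand on the right still contains a non-composable
  -- product.
  · have hne : c.tgt ≠ d.src := fun h => by rw [up_mul_up c d h] at h0; exact up_ne_zero _ h0
    rw [h0, dsum_zero, dsum_eq_sum_cuts, dsum_eq_sum_cuts, Finset.sum_eq_zero, Finset.sum_eq_zero,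
      add_zero]
    · intro p hp
      have := (src_tgt_length_of_cut (mem_cuts.1 hp)).1
      rw [up_mul_up_of_ne _ _ (this ▸ hne), h1]
    · intro p hp
      have := (src_tgt_length_of_cut (mem_cuts.1 hp)).2.1
      rw [up_mul_up_of_ne _ _ (this ▸ hne), h2]
  · have hl := (src_tgt_length_of_mul he).2.2.1
    have hw := ((up_mul_up_eq_iff _ _ _).1 he).2.2
    rw [he, dsum_up, dsum_up, dsum_up, hl, Finset.sum_range_add]
    congr 1
    · refine Finset.sum_congr rfl fun i hi => ?_
      have hi' : i < c.length := by simpa using hi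
      rw [hw, List.getElem?_append_left hi', (take_of_mul he hi'.le).1, (take_of_mul he hi').2]
    · refine Finset.sum_congr rfl fun i _ => ?_
      rw [hw, Walk.length, List.getElem?_append_right (Nat.le_add_right _ _), Nat.add_sub_cancel_left,
        add_assoc, ← Walk.length, (drop_of_mul he (i + 1)).1, (drop_of_mul he i).2]

/-- A cut of `x e y` into two factors falls before or after the edge `e`. The edge separates the two
families of positions, so none is counted twice, unlike for a bare product of two paths. -/
theorem ssum_mul_edge_mul (e : G.Dart) (k : G.PWalk → G.PWalk → A) (h1 : ∀ w, k 0 w = 0)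
    (h2 : ∀ w, k w 0 = 0) (x y : G.PWalk) :
    ssum k (x * edge e * y) =
      ssum (fun u v => k u (v * edge e * y)) x + ssum (fun u v => k (x * edge e * u) v) y := by
  rcases PWalk.cases x with rfl | ⟨x, rfl⟩
  · rcases PWalk.cases y with rfl | ⟨y, rfl⟩ <;> simp [h1, ssum_up]
  rcases PWalk.cases y with rfl | ⟨y, rfl⟩
  · simp [h2, ssum_up]
  rcases PWalk.cases (up x * edge e * up y) with h0 | ⟨z, hz⟩
  · have hne : ¬ (x.tgt = e.src ∧ e.tgt = y.src) := fun h => by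
      rw [← up_join _ _ _ h] at h0; exact up_ne_zero _ h0
    rw [h0, ssum_zero, ssum_up, ssum_up, Finset.sum_eq_zero, Finset.sum_eq_zero, add_zero]
    · intro i _
      rw [up_mul_edge_mul_up_of_not _ _ _ (show ¬ (x.tgt = e.src ∧ e.tgt = (y.take i).src) from hne),
        h1]
    · intro i _
      rw [up_mul_edge_mul_up_of_not, h2]
      rwa [drop_tgt]
  · have hxe : ∃ c, up x * edge e = up c := by
      rcases PWalk.cases (up x * edge e) with h0 | h
      · rw [h0, zero_mul] at hz; exact absurd hz.symm (up_ne_zero _)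
      · exact h
    obtain ⟨c, hc⟩ := hxe
    have hey : ∃ d, edge e * up y = up d := by
      rcases PWalk.cases (edge e * up y) with h0 | h
      · rw [mul_assoc, h0, mul_zero] at hz; exact absurd hz.symm (up_ne_zero _)
      · exact h
    obtain ⟨d, hd⟩ := hey
    have hcy : up c * up y = up z := hc ▸ hz
    have hxd : up x * up d = up z := by rw [← hd, ← mul_assoc, hz]
    have hcl : c.length = x.length + 1 := (src_tgt_length_of_mul hc).2.2.1
    -- The cut positions of the whole path are those of `x` together with those of `y`.
    have hzl : z.length + 1 = (x.length + 1) + (y.length + 1) := by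
      rw [(src_tgt_length_of_mul hcy).2.2.1, hcl]; ring
    rw [hz, ssum_up, ssum_up, ssum_up, hzl, Finset.sum_range_add]
    congr 1
    · refine Finset.sum_congr rfl fun i hi => ?_
      have hi' : i ≤ x.length := by simpa [Nat.lt_succ_iff] using hi
      rw [(take_of_mul hxd hi').1, (take_of_mul hxd hi').2, ← hd, mul_assoc]
    · refine Finset.sum_congr rfl fun i _ => ?_
      rw [← hcl, (drop_of_mul hcy i).1, (drop_of_mul hcy i).2, hc]

theorem map_dsum {B F : Type*} [AddCommMonoid B] [FunLike F A B] [AddMonoidHomClass F A B]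
    (φ : F) (ε : G.Dart) (k : G.PWalk → G.PWalk → A) (w : G.PWalk) :
    φ (dsum ε k w) = dsum ε (fun α β => φ (k α β)) w := by
  rcases PWalk.cases w with rfl | ⟨γ, rfl⟩
  · simp
  · simp only [dsum_eq_sum_cuts, map_sum]

theorem mul_dsum (c : ℂ) (ε : G.Dart) (k : G.PWalk → G.PWalk → ℂ) (w : G.PWalk) :
    c * dsum ε k w = dsum ε (fun α β => c * k α β) w :=
  map_dsum (AddMonoidHom.mulLeft c) ε k w

theorem dsum_congr (ε : G.Dart) {k k' : G.PWalk → G.PWalk → A} (h : ∀ α β, k α β = k' α β)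
    (w : G.PWalk) : dsum ε k w = dsum ε k' w := by
  have : k = k' := by ext; exact h _ _
  rw [this]

end Sums

/-! ### Reversal -/

@[simp] theorem rev_src (a : G.Walk) : a.rev.src = a.tgt := rfl

@[simp] theorem rev_tgt (a : G.Walk) : a.rev.tgt = a.src := (isWalk_reverse _ _ a.valid).2

@[simp] theorem rev_length (a : G.Walk) : a.rev.length = a.length := by
  simp [Walk.rev, Walk.length]

@[simp] theorem rev_rev (a : G.Walk) : a.rev.rev = a := by
  refine Walk.ext (rev_tgt a) ?_
  simp only [Walk.rev, List.map_reverse, List.map_map, List.reverse_reverse]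
  exact List.map_id _

/-- Reversal of paths on the semigroup with zero. -/
def prev (w : G.PWalk) : G.PWalk := w.elim 0 fun a => up a.rev

@[simp] theorem prev_up (a : G.Walk) : prev (up a) = up a.rev := rfl
@[simp] theorem prev_zero : prev (0 : G.PWalk) = 0 := rfl
@[simp] theorem prev_prev (w : G.PWalk) : prev (prev w) = w := by
  rcases PWalk.cases w with rfl | ⟨a, rfl⟩ <;> simp

@[simp] theorem prev_edge (ε : G.Dart) : prev (edge ε) = edge ε.op := rfl

theorem prev_mul (u v : G.PWalk) : prev (u * v) = prev v * prev u := by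
  rcases PWalk.cases u with rfl | ⟨a, rfl⟩
  · simp
  rcases PWalk.cases v with rfl | ⟨b, rfl⟩
  · simp
  by_cases h : a.tgt = b.src
  · rw [up_mul_up a b h]
    simp only [prev_up]
    symm
    rw [up_mul_up_eq_iff]
    refine ⟨?_, ?_, ?_⟩
    · rw [rev_tgt, rev_src, h]
    · rw [rev_src, rev_src, Walk.append_tgt]
    · simp [Walk.rev, Walk.append]
  · rw [up_mul_up_of_ne _ _ h, prev_up, prev_up, up_mul_up_of_ne]
    · rfl
    · rw [rev_tgt, rev_src]; exact fun h' => h h'.symm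

/-- Reversal turns a factorization αεβ into one with edge ε^op and the two outer pieces reversed and
exchanged. -/
theorem dsum_prev {A : Type*} [AddCommMonoid A] (ε : G.Dart) (k : G.PWalk → G.PWalk → A)
    (w : G.PWalk) : dsum ε k (prev w) = dsum ε.op (fun α β => k (prev β) (prev α)) w := by
  rcases PWalk.cases w with rfl | ⟨γ, rfl⟩
  · simp
  rw [prev_up, dsum_eq_sum_cuts, dsum_eq_sum_cuts]
  have key : ∀ (η : G.Dart) (a : G.Walk) (p : G.Walk × G.Walk), p ∈ cuts η a →
      (p.2.rev, p.1.rev) ∈ cuts η.op a.rev := by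
    intro η a p hp
    rw [mem_cuts] at hp ⊢
    have := congrArg prev hp
    simpa [prev_mul, mul_assoc] using this
  refine Finset.sum_bij' (fun p _ => (p.2.rev, p.1.rev)) (fun p _ => (p.2.rev, p.1.rev))
    ?_ ?_ ?_ ?_ ?_
  · intro p hp
    simpa using key _ _ _ hp
  · intro p hp
    simpa using key _ _ _ hp
  · intro p _; simp
  · intro p _; simp
  · intro p _; simp

end WeightedGraph
end FreeGraph
end

/-! ### Weighted summable families, test functions of smaller growth, and duality of kernels. -/

noncomputable section
namespace FreeGraph

/-! ### Weighted `ℓ¹` spaces and their kernels -/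

/-- An index set with a length function. -/
class HasLen (X : Type*) where
  len : X → ℕ

open HasLen (len)

instance {X Y : Type*} [HasLen X] [HasLen Y] : HasLen (X × Y) := ⟨fun p => len p.1 + len p.2⟩

theorem len_prod {X Y : Type*} [HasLen X] [HasLen Y] (p : X × Y) : len p = len p.1 + len p.2 := rfl

section Pairing
variable {X Y : Type*}

/-- The pairing of a summable family with a function of moderate growth. -/
def pair (F k : X → ℂ) : ℂ := ∑' x, F x * k x

/-- The value of a finite combination against a function. -/
def ev (k : Y → ℂ) : (Y →₀ ℂ) →ₗ[ℂ] ℂ := Finsupp.linearCombination ℂ k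

/-- The linear map given by a kernel. -/
def push (K : X → Y →₀ ℂ) (F : X → ℂ) : Y → ℂ := fun y => ∑' x, F x * K x y

theorem ev_single (k : Y → ℂ) (y : Y) (c : ℂ) : ev k (Finsupp.single y c) = c * k y := by
  simp [ev]

theorem ev_apply (k : Y → ℂ) (u : Y →₀ ℂ) : ev k u = u.sum fun y c => c * k y := rfl

open Classical in
theorem ev_pi_single (u : Y →₀ ℂ) (y : Y) : ev (Pi.single y 1) u = u y := by
  simp only [ev_apply, Finsupp.sum, Pi.single_apply, mul_ite, mul_one, mul_zero]
  rw [Finset.sum_ite_eq' u.support y]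
  split_ifs with h
  · rfl
  · exact (Finsupp.notMem_support_iff.1 h).symm

theorem pair_comp_equiv (e : X ≃ Y) (F k : Y → ℂ) :
    pair (fun x => F (e x)) (fun x => k (e x)) = pair F k :=
  e.tsum_eq fun y => F y * k y

theorem pair_congr {F k k' : X → ℂ} (h : ∀ x, k x = k' x) : pair F k = pair F k' := by
  have : k = k' := funext h
  rw [this]

theorem pair_star (F k : X → ℂ) :
    pair (fun x => star (F x)) k = star (pair F fun x => star (k x)) := by
  unfold pair
  rw [tsum_star]
  exact tsum_congr fun x => by simp [mul_comm]

theorem pair_zero_right (F : X → ℂ) : (pair F fun _ => 0) = 0 := by simp [pair]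

-- Point masses are test functions, so two series with equal pairings against all test functions
-- have equal coefficients.
open Classical in
theorem pair_pi_single (F : X → ℂ) (x : X) : pair F (Pi.single x 1) = F x := by
  unfold pair
  rw [tsum_eq_single x]
  · simp
  · intro y hy; simp [hy]

theorem tsum_norm_mul_eq (k : Y → ℂ) (u : Y →₀ ℂ) :
    Summable (fun y => ‖u y * k y‖) ∧ ∑' y, ‖u y * k y‖ = u.sum fun y c => ‖c * k y‖ := by
  have h : ∀ y ∉ u.support, ‖u y * k y‖ = 0 := fun y hy => by
    rw [Finsupp.notMem_support_iff.1 hy]; simp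
  exact ⟨summable_of_ne_finset_zero h, tsum_eq_sum h⟩

end Pairing

section Kernels
variable {X Y Z : Type*} [HasLen X] [HasLen Y] [HasLen Z] {R : ℝ}

/-- The families that are summable against `S ^ len` for all `S < R`. -/
def Adm (R : ℝ) (F : X → ℂ) : Prop :=
  ∀ S, 0 < S → S < R → Summable fun x => ‖F x‖ * S ^ len x

/-- The functions that grow at most like `S ^ len` for some `S < R`. -/
def Tame (R : ℝ) (k : X → ℂ) : Prop :=
  ∃ S, 0 < S ∧ S < R ∧ ∃ C, 0 ≤ C ∧ ∀ x, ‖k x‖ ≤ C * S ^ len x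

/-- The weighted `ℓ¹` norm of a finite combination. -/
def wnorm (S : ℝ) (u : Y →₀ ℂ) : ℝ := u.sum fun y c => ‖c‖ * S ^ len y

/-- The kernels that map the weighted `ℓ¹` spaces into each other, up to a loss in the weight. -/
def Bdd (R : ℝ) (K : X → Y →₀ ℂ) : Prop :=
  ∀ S, 0 < S → S < R → ∃ S', 0 < S' ∧ S' < R ∧ ∃ C, 0 ≤ C ∧ ∀ x, wnorm S (K x) ≤ C * S' ^ len x

theorem wnorm_nonneg {S : ℝ} (hS : 0 ≤ S) (u : Y →₀ ℂ) : 0 ≤ wnorm S u :=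
  Finset.sum_nonneg fun _ _ => by positivity

theorem wnorm_mono {S S' : ℝ} (hS : 0 ≤ S) (h : S ≤ S') (u : Y →₀ ℂ) : wnorm S u ≤ wnorm S' u :=
  Finset.sum_le_sum fun _ _ =>
    mul_le_mul_of_nonneg_left (pow_le_pow_left₀ hS h _) (norm_nonneg _)

@[simp] theorem wnorm_zero (S : ℝ) : wnorm S (0 : Y →₀ ℂ) = 0 := by simp [wnorm]

theorem wnorm_single (S : ℝ) (y : Y) (c : ℂ) :
    wnorm S (Finsupp.single y c) = ‖c‖ * S ^ len y := by
  simp [wnorm]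

theorem wnorm_add {S : ℝ} (hS : 0 ≤ S) (u v : Y →₀ ℂ) :
    wnorm S (u + v) ≤ wnorm S u + wnorm S v := by
  classical
  unfold wnorm
  rw [Finsupp.sum_of_support_subset (u + v) Finsupp.support_add _ (by simp),
    Finsupp.sum_of_support_subset u (Finset.subset_union_left (s₂ := v.support)) _ (by simp),
    Finsupp.sum_of_support_subset v (Finset.subset_union_right (s₁ := u.support)) _ (by simp),
    ← Finset.sum_add_distrib]
  refine Finset.sum_le_sum fun y _ => ?_
  rw [← add_mul, Finsupp.add_apply]
  gcongr
  exact norm_add_le _ _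

theorem wnorm_smul_le (S : ℝ) (c : ℂ) (u : Y →₀ ℂ) :
    wnorm S (c • u) ≤ ‖c‖ * wnorm S u := by
  unfold wnorm
  rw [Finsupp.sum_of_support_subset (c • u) Finsupp.support_smul _ (by simp), Finsupp.sum,
    Finset.mul_sum]
  refine Finset.sum_le_sum fun y _ => ?_
  simp [mul_assoc]

theorem wnorm_sum {ι : Type*} {S : ℝ} (hS : 0 ≤ S) (s : Finset ι) (u : ι → Y →₀ ℂ) :
    wnorm S (∑ i ∈ s, u i) ≤ ∑ i ∈ s, wnorm S (u i) := by
  classical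
  induction s using Finset.induction_on with
  | empty => simp
  | insert a s ha ih =>
    rw [Finset.sum_insert ha, Finset.sum_insert ha]
    exact (wnorm_add hS _ _).trans (by gcongr)

theorem Adm.add {F F' : X → ℂ} (h : Adm R F) (h' : Adm R F') : Adm R (fun x => F x + F' x) := by
  intro S h0 h1
  refine Summable.of_nonneg_of_le (fun x => by positivity) (fun x => ?_)
    ((h S h0 h1).add (h' S h0 h1))
  rw [← add_mul]
  gcongr
  exact norm_add_le _ _

theorem adm_zero : Adm R (fun _ : X => 0) := by
  intro S _ _
  simp

theorem Adm.sum {ι : Type*} (s : Finset ι) {F : ι → X → ℂ} (h : ∀ i, Adm R (F i)) :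
    Adm R (fun x => ∑ i ∈ s, F i x) := by
  classical
  induction s using Finset.induction_on with
  | empty => simpa using adm_zero
  | insert a s ha ih =>
    simp only [Finset.sum_insert ha]
    exact (h a).add ih

theorem Adm.star {F : X → ℂ} (h : Adm R F) : Adm R (fun x => star (F x)) := by
  intro S h0 h1
  simpa using h S h0 h1

theorem Adm.comp_equiv (e : X ≃ Y) (he : ∀ x, len (e x) = len x) {F : Y → ℂ} (h : Adm R F) :
    Adm R (fun x => F (e x)) := by
  intro S h0 h1
  have := (h S h0 h1).comp_injective e.injective
  refine this.congr fun x => ?_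
  simp [he]

theorem adm_of_finite {F : X → ℂ} (h : (Function.support F).Finite) : Adm R F := by
  intro S _ _
  refine summable_of_hasFiniteSupport (h.subset ?_)
  intro x hx hx'
  exact hx (by simp [hx'])

theorem Adm.prod {F : X → ℂ} {F' : Y → ℂ} (h : Adm R F) (h' : Adm R F') :
    Adm R (fun p : X × Y => F p.1 * F' p.2) := by
  intro S h0 h1
  refine ((h S h0 h1).mul_of_nonneg (h' S h0 h1) (fun _ => by positivity)
    (fun _ => by positivity)).congr fun p => ?_
  rw [len_prod, norm_mul, pow_add]
  ring

theorem tame_mul_norm {k : X → ℂ} {F : X → ℂ} (hF : Adm R F) (hk : Tame R k) :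
    Summable fun x => ‖F x * k x‖ := by
  obtain ⟨S, h0, h1, C, hC, hk⟩ := hk
  refine Summable.of_nonneg_of_le (fun x => norm_nonneg _) (fun x => ?_) ((hF S h0 h1).mul_left C)
  rw [norm_mul]
  calc ‖F x‖ * ‖k x‖ ≤ ‖F x‖ * (C * S ^ len x) := by gcongr; exact hk x
    _ = _ := by ring

theorem summable_pair {k : X → ℂ} {F : X → ℂ} (hF : Adm R F) (hk : Tame R k) :
    Summable fun x => F x * k x := (tame_mul_norm hF hk).of_norm

theorem Tame.of_le {k : X → ℂ} {S : ℝ} (h0 : 0 < S) (h1 : S < R) (C : ℝ)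
    (h : ∀ x, ‖k x‖ ≤ C * S ^ len x) : Tame R k :=
  ⟨S, h0, h1, |C|, abs_nonneg _, fun x => (h x).trans (by gcongr; exact le_abs_self C)⟩

theorem Tame.congr {k k' : X → ℂ} (h : Tame R k) (hk : ∀ x, k x = k' x) : Tame R k' :=
  funext hk ▸ h

theorem Tame.add {k k' : X → ℂ} (h : Tame R k) (h' : Tame R k') :
    Tame R (fun x => k x + k' x) := by
  obtain ⟨S, h0, h1, C, hC, hk⟩ := h
  obtain ⟨S', h0', h1', C', hC', hk'⟩ := h'
  refine ⟨max S S', lt_max_of_lt_left h0, max_lt h1 h1', C + C', by positivity, fun x => ?_⟩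
  have e1 : S ^ len x ≤ max S S' ^ len x := by gcongr; exact le_max_left _ _
  have e2 : S' ^ len x ≤ max S S' ^ len x := by gcongr; exact le_max_right _ _
  calc ‖k x + k' x‖ ≤ ‖k x‖ + ‖k' x‖ := norm_add_le _ _
    _ ≤ C * S ^ len x + C' * S' ^ len x := add_le_add (hk x) (hk' x)
    _ ≤ C * max S S' ^ len x + C' * max S S' ^ len x := by gcongr
    _ = _ := by ring

theorem Tame.const_mul {k : X → ℂ} (h : Tame R k) (c : ℂ) : Tame R (fun x => c * k x) := by
  obtain ⟨S, h0, h1, C, hC, hk⟩ := h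
  refine ⟨S, h0, h1, ‖c‖ * C, by positivity, fun x => ?_⟩
  rw [norm_mul, mul_assoc]
  gcongr
  exact hk x

theorem Tame.star {k : X → ℂ} (h : Tame R k) : Tame R (fun x => star (k x)) := by
  obtain ⟨S, h0, h1, C, hC, hk⟩ := h
  exact ⟨S, h0, h1, C, hC, fun x => by simpa using hk x⟩

theorem Tame.prod {k : X → ℂ} {k' : Y → ℂ} (h : Tame R k) (h' : Tame R k') :
    Tame R (fun p : X × Y => k p.1 * k' p.2) := by
  obtain ⟨S, h0, h1, C, hC, hk⟩ := h
  obtain ⟨S', h0', h1', C', hC', hk'⟩ := h'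
  refine ⟨max S S', lt_max_of_lt_left h0, max_lt h1 h1', C * C', by positivity, fun p => ?_⟩
  have e1 : S ^ len p.1 ≤ max S S' ^ len p.1 := by gcongr; exact le_max_left _ _
  have e2 : S' ^ len p.2 ≤ max S S' ^ len p.2 := by gcongr; exact le_max_right _ _
  calc ‖k p.1 * k' p.2‖ = ‖k p.1‖ * ‖k' p.2‖ := norm_mul _ _
    _ ≤ (C * S ^ len p.1) * (C' * S' ^ len p.2) := by gcongr; exacts [hk _, hk' _]
    _ ≤ (C * max S S' ^ len p.1) * (C' * max S S' ^ len p.2) := by gcongr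
    _ = _ := by rw [len_prod, pow_add]; ring

theorem Tame.slice {k : X × Y → ℂ} (h : Tame R k) (x : X) : Tame R (fun y => k (x, y)) := by
  obtain ⟨S, h0, h1, C, hC, hk⟩ := h
  refine ⟨S, h0, h1, C * S ^ len x, by positivity, fun y => (hk _).trans_eq ?_⟩
  rw [len_prod, pow_add]; ring

theorem Tame.comp_equiv (e : X ≃ Y) (he : ∀ x, len (e x) = len x) {k : Y → ℂ} (h : Tame R k) :
    Tame R (fun x => k (e x)) := by
  obtain ⟨S, h0, h1, C, hC, hk⟩ := h
  exact ⟨S, h0, h1, C, hC, fun x => (hk _).trans_eq (by rw [he])⟩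

theorem Tame.slice_left {k : X × Y → ℂ} (h : Tame R k) (y : Y) : Tame R (fun x => k (x, y)) := by
  obtain ⟨S, h0, h1, C, hC, hk⟩ := h
  refine ⟨S, h0, h1, C * S ^ len y, by positivity, fun x => (hk _).trans_eq ?_⟩
  rw [len_prod, pow_add]; ring

theorem norm_pair_le {k F : X → ℂ} {S C : ℝ} (hF : Adm R F) (h0 : 0 < S) (h1 : S < R)
    (hk : ∀ x, ‖k x‖ ≤ C * S ^ len x) : ‖pair F k‖ ≤ C * ∑' x, ‖F x‖ * S ^ len x := by
  have hs := tame_mul_norm hF (Tame.of_le h0 h1 C hk)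
  rw [← tsum_mul_left]
  refine (norm_tsum_le_tsum_norm hs).trans (hs.tsum_le_tsum (fun x => ?_) ((hF S h0 h1).mul_left C))
  rw [norm_mul]
  calc ‖F x‖ * ‖k x‖ ≤ ‖F x‖ * (C * S ^ len x) := by gcongr; exact hk x
    _ = _ := by ring

theorem Tame.pair_right {F : Y → ℂ} {k : X × Y → ℂ} (hF : Adm R F) (h : Tame R k) :
    Tame R (fun x => pair F fun y => k (x, y)) := by
  obtain ⟨S, h0, h1, C, hC, hk⟩ := h
  refine Tame.of_le h0 h1 (C * ∑' y, ‖F y‖ * S ^ len y) fun x => ?_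
  refine (norm_pair_le (C := C * S ^ len x) hF h0 h1 fun y => (hk _).trans_eq ?_).trans_eq ?_
  · rw [len_prod, pow_add]; ring
  · ring

/-- Fubini: the family is summable at the exponent `S < R` that bounds the growth of `k`. -/
theorem pair_prod {F : X → ℂ} {F' : Y → ℂ} {k : X × Y → ℂ} (hF : Adm R F) (hF' : Adm R F')
    (hk : Tame R k) :
    pair (fun p : X × Y => F p.1 * F' p.2) k = pair F fun x => pair F' fun y => k (x, y) := by
  unfold pair
  rw [(summable_pair (hF.prod hF') hk).tsum_prod]
  refine tsum_congr fun x => ?_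
  rw [← tsum_mul_left]
  exact tsum_congr fun y => by ring

theorem pair_comm {F : X → ℂ} {F' : Y → ℂ} {k : X × Y → ℂ} (hF : Adm R F) (hF' : Adm R F')
    (hk : Tame R k) :
    (pair F fun x => pair F' fun y => k (x, y)) = pair F' fun y => pair F fun x => k (x, y) := by
  rw [← pair_prod hF hF' hk]
  have hk' : Tame R (fun p : Y × X => k p.swap) :=
    hk.comp_equiv (Equiv.prodComm Y X) (fun p => by simp [len_prod, add_comm])
  refine Eq.trans ?_ (pair_prod (k := fun p : Y × X => k p.swap) hF' hF hk')
  rw [← pair_comp_equiv (Equiv.prodComm Y X)]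
  congr 1
  ext p
  exact mul_comm _ _

theorem pair_add_right {F k k' : X → ℂ} (hF : Adm R F) (hk : Tame R k) (hk' : Tame R k') :
    pair F (fun x => k x + k' x) = pair F k + pair F k' := by
  unfold pair
  rw [← (summable_pair hF hk).tsum_add (summable_pair hF hk')]
  exact tsum_congr fun x => by ring

theorem pair_add_left {F F' k : X → ℂ} (hF : Adm R F) (hF' : Adm R F') (hk : Tame R k) :
    pair (fun x => F x + F' x) k = pair F k + pair F' k := by
  unfold pair
  rw [← (summable_pair hF hk).tsum_add (summable_pair hF' hk)]
  exact tsum_congr fun x => by ring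

theorem pair_sum_left {ι : Type*} (s : Finset ι) {F : ι → X → ℂ} {k : X → ℂ}
    (hF : ∀ i, Adm R (F i)) (hk : Tame R k) :
    pair (fun x => ∑ i ∈ s, F i x) k = ∑ i ∈ s, pair (F i) k := by
  unfold pair
  rw [← Summable.tsum_finsetSum fun i _ => summable_pair (hF i) hk]
  exact tsum_congr fun x => Finset.sum_mul _ _ _

open Classical in
theorem tame_pi_single (hR : 0 < R) (x : X) : Tame R (Pi.single x (1 : ℂ)) := by
  refine Tame.of_le (S := R / 2) (by positivity) (by linarith) (((R / 2) ^ len x)⁻¹) fun y => ?_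
  by_cases h : y = x
  · subst h
    have : (R / 2) ^ len y ≠ 0 := by positivity
    simp [this]
  · rw [Pi.single_eq_of_ne h, norm_zero]
    positivity

theorem norm_ev_le {k : Y → ℂ} {S C : ℝ} (h : ∀ y, ‖k y‖ ≤ C * S ^ len y) (u : Y →₀ ℂ) :
    ‖ev k u‖ ≤ C * wnorm S u := by
  rw [ev_apply, Finsupp.sum, wnorm, Finsupp.sum, Finset.mul_sum]
  refine (norm_sum_le _ _).trans (Finset.sum_le_sum fun y _ => ?_)
  rw [norm_mul]
  calc ‖u y‖ * ‖k y‖ ≤ ‖u y‖ * (C * S ^ len y) := by gcongr; exact h y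
    _ = _ := by ring

theorem Bdd.tame {K : X → Y →₀ ℂ} (hK : Bdd R K) {k : Y → ℂ} (hk : Tame R k) :
    Tame R (fun x => ev k (K x)) := by
  obtain ⟨S, h0, h1, C, hC, hk⟩ := hk
  obtain ⟨S', h0', h1', C', hC', hK⟩ := hK S h0 h1
  refine ⟨S', h0', h1', C * C', by positivity, fun x => (norm_ev_le hk _).trans ?_⟩
  rw [mul_assoc]
  gcongr
  exact hK x

/-- Absolute convergence of the double sum, the source of every interchange between a series and a
kernel. The growth exponent of `k` fixes the weight in which the kernel is measured, and `F` absorbs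
the resulting larger weight. -/
theorem summable_kernel {K : X → Y →₀ ℂ} (hK : Bdd R K) {F : X → ℂ} (hF : Adm R F) {k : Y → ℂ}
    (hk : Tame R k) : Summable fun p : X × Y => ‖F p.1 * (K p.1 p.2 * k p.2)‖ := by
  obtain ⟨S, h0, h1, C, hC, hk⟩ := hk
  obtain ⟨S', h0', h1', C', hC', hK⟩ := hK S h0 h1
  rw [summable_prod_of_nonneg fun p => norm_nonneg _]
  refine ⟨fun x => ?_, ?_⟩
  · simpa using (tsum_norm_mul_eq k (K x)).1.mul_left ‖F x‖
  · refine Summable.of_nonneg_of_le (fun x => tsum_nonneg fun y => norm_nonneg _) (fun x => ?_)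
      ((hF S' h0' h1').mul_left (C * C'))
    simp only [norm_mul (F x), tsum_mul_left, (tsum_norm_mul_eq k (K x)).2]
    have : ((K x).sum fun y c => ‖c * k y‖) ≤ C * (C' * S' ^ len x) := by
      refine le_trans ?_ (mul_le_mul_of_nonneg_left (hK x) hC)
      rw [wnorm, Finsupp.sum, Finsupp.sum, Finset.mul_sum]
      refine Finset.sum_le_sum fun y _ => ?_
      rw [norm_mul]
      calc ‖K x y‖ * ‖k y‖ ≤ ‖K x y‖ * (C * S ^ len y) := by gcongr; exact hk y
        _ = _ := by ring
    calc _ ≤ ‖F x‖ * (C * (C' * S' ^ len x)) := by gcongr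
      _ = _ := by ring

theorem Adm.push {K : X → Y →₀ ℂ} (hK : Bdd R K) {F : X → ℂ} (hF : Adm R F) :
    Adm R (push K F) := by
  intro S h0 h1
  -- Testing against the weight itself bounds the weighted norm of the image.
  have hk : Tame R (fun y : Y => ((S : ℂ) ^ len y)) :=
    Tame.of_le h0 h1 1 fun y => by simp [abs_of_pos h0]
  have h := (summable_kernel hK hF hk).prod_symm.prod_factor
  have h' := (summable_kernel hK hF hk).prod_symm.prod
  refine Summable.of_nonneg_of_le (fun y => by positivity) (fun y => ?_) h'
  have e : ‖FreeGraph.push K F y‖ * S ^ len y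
      = ‖∑' x, F x * (K x y * (S : ℂ) ^ len y)‖ := by
    have : ∑' x, F x * (K x y * (S : ℂ) ^ len y) = FreeGraph.push K F y * (S : ℂ) ^ len y := by
      unfold FreeGraph.push
      rw [← tsum_mul_right]
      exact tsum_congr fun x => by ring
    rw [this, norm_mul, norm_pow, Complex.norm_real, Real.norm_of_nonneg h0.le]
  rw [e]
  exact norm_tsum_le_tsum_norm (h y)

/-- The basic mechanism: an operation on series is replaced by its transpose on test functions,
which involves finite sums only. -/
theorem pair_push {K : X → Y →₀ ℂ} (hK : Bdd R K) {F : X → ℂ} (hF : Adm R F) {k : Y → ℂ}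
    (hk : Tame R k) : pair (push K F) k = pair F fun x => ev k (K x) := by
  have h := (summable_kernel hK hF hk).of_norm
  have e1 : ∀ x, F x * ev k (K x) = ∑' y, F x * (K x y * k y) := by
    intro x
    rw [tsum_mul_left, ev_apply, Finsupp.sum]
    congr 1
    symm
    refine tsum_eq_sum fun y hy => ?_
    rw [Finsupp.notMem_support_iff.1 hy, zero_mul]
  have e2 : ∀ y, push K F y * k y = ∑' x, F x * (K x y * k y) := by
    intro y
    unfold push
    rw [← tsum_mul_right]
    exact tsum_congr fun x => by ring
  unfold pair
  simp only [e1, e2]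
  exact Summable.tsum_comm (f := fun x y => F x * (K x y * k y)) h

/-- A path of length n has up to n cuts at a given edge. This linear factor is absorbed by enlarging
the weight, which is why `Bdd` allows a loss from `S` to `S'`. -/
theorem exists_nat_mul_pow_le {S S' : ℝ} (h0 : 0 < S) (h : S < S') :
    ∃ C, 0 ≤ C ∧ ∀ n : ℕ, n * S ^ n ≤ C * S' ^ n := by
  have hlt : S / S' < 1 := (div_lt_one (h0.trans h)).2 h
  have ht := tendsto_self_mul_const_pow_of_lt_one (div_nonneg h0.le (h0.trans h).le) hlt
  obtain ⟨C, hC⟩ := ht.bddAbove_range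
  refine ⟨|C|, abs_nonneg _, fun n => ?_⟩
  have h1 : (n : ℝ) * (S / S') ^ n ≤ |C| := (hC ⟨n, rfl⟩).trans (le_abs_self C)
  have h2 : 0 < S' ^ n := pow_pos (h0.trans h) n
  rwa [div_pow, ← mul_div_assoc, div_le_iff₀ h2] at h1

/-- Only weights near `R` matter, as the norms increase with the weight. This is needed because
moments are controlled only by weights above their own growth rate. -/
theorem Bdd.of_le {K : X → Y →₀ ℂ} (S₀ : ℝ) (h₀ : S₀ < R)
    (h : ∀ S, 0 < S → S₀ ≤ S → S < R → ∃ S', 0 < S' ∧ S' < R ∧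
      ∃ C, 0 ≤ C ∧ ∀ x, wnorm S (K x) ≤ C * S' ^ len x) : Bdd R K := by
  intro S h1 h2
  obtain ⟨S', h1', h2', C, hC, hK⟩ := h (max S S₀) (lt_max_of_lt_left h1) (le_max_right _ _)
    (max_lt h2 h₀)
  exact ⟨S', h1', h2', C, hC, fun x => (wnorm_mono h1.le (le_max_left _ _) _).trans (hK x)⟩

theorem Bdd.add {K K' : X → Y →₀ ℂ} (h : Bdd R K) (h' : Bdd R K') :
    Bdd R (fun x => K x + K' x) := by
  intro S h0 h1
  obtain ⟨S₁, a1, b1, C₁, c1, H1⟩ := h S h0 h1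
  obtain ⟨S₂, a2, b2, C₂, c2, H2⟩ := h' S h0 h1
  refine ⟨max S₁ S₂, lt_max_of_lt_left a1, max_lt b1 b2, C₁ + C₂, by positivity, fun x => ?_⟩
  refine (wnorm_add h0.le _ _).trans ((add_le_add (H1 x) (H2 x)).trans ?_)
  rw [add_mul]
  gcongr
  · exact le_max_left _ _
  · exact le_max_right _ _

theorem Bdd.smul {K : X → Y →₀ ℂ} (h : Bdd R K) (c : ℂ) : Bdd R (fun x => c • K x) := by
  intro S h0 h1
  obtain ⟨S₁, a1, b1, C₁, c1, H1⟩ := h S h0 h1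
  refine ⟨S₁, a1, b1, ‖c‖ * C₁, by positivity, fun x => ?_⟩
  refine (wnorm_smul_le _ _ _).trans ?_
  rw [mul_assoc]
  gcongr
  exact H1 x

theorem Bdd.sub {K K' : X → Y →₀ ℂ} (h : Bdd R K) (h' : Bdd R K') :
    Bdd R (fun x => K x - K' x) := by
  have := h.add (h'.smul (-1))
  simpa [sub_eq_add_neg] using this

end Kernels

end FreeGraph
end

/-! ### The law on monomials: Fock space coordinates, Schwinger-Dyson equation, traciality. -/

noncomputable section
namespace FreeGraph
namespace WeightedGraph
open HasLen (len)

variable {V E : Type*} [Fintype V] {G : WeightedGraph V E}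

/-! ### Moments of the generators -/

/-- Extension by zero of a function on paths. -/
def ext0 (c : G.Walk → ℂ) (w : G.PWalk) : ℂ := w.elim 0 c

@[simp] theorem ext0_up (c : G.Walk → ℂ) (a : G.Walk) : ext0 c (up a) = c a := rfl
@[simp] theorem ext0_zero (c : G.Walk → ℂ) : ext0 c 0 = 0 := rfl

open Classical in
/-- The basis vector of a path. -/
def basisVec (γ : G.Walk) : G.Fock := lp.single 2 γ (1 : ℂ)

/-- The vacuum vector at a vertex. -/
def vac (v : V) : G.Fock := basisVec (Walk.nil G v)

open Classical in
theorem basisVec_apply (γ ζ : G.Walk) : (basisVec γ : G.Fock) ζ = if ζ = γ then 1 else 0 := by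
  rw [basisVec, lp.single_apply]
  simp only [Pi.single_apply]

theorem inner_basisVec (γ : G.Walk) (ξ : G.Fock) : inner ℂ (basisVec γ : G.Fock) ξ = ξ γ := by
  classical
  rw [basisVec, lp.inner_single_left]
  simp

theorem vac_apply_self (v : V) : (vac v : G.Fock) (Walk.nil G v) = 1 := by
  classical
  rw [vac, basisVec_apply, if_pos rfl]

theorem vac_apply_of_ne (v : V) (ζ : G.Walk) (h : ζ ≠ Walk.nil G v) : (vac v : G.Fock) ζ = 0 := by
  classical
  rw [vac, basisVec_apply, if_neg h]

/-- Removal of the first edge of a path. -/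
def leftQuot (ε : G.Dart) (ζ : G.Walk) : G.PWalk := creationIndex ε ζ

theorem creation_apply (ε : G.Dart) (ξ : G.Fock) (ζ : G.Walk) :
    creation ε ξ ζ = ext0 ξ (leftQuot ε ζ) := by
  unfold ext0 leftQuot
  change (creationIndex ε ζ).elim (0 : ℂ) ξ = _
  rfl

open Classical in
theorem leftQuot_eq_up_iff (ε : G.Dart) (ζ c : G.Walk) :
    leftQuot ε ζ = up c ↔ edge ε * up c = up ζ := by
  rw [edge, up_mul_up_eq_iff]
  rcases ζ with ⟨v, l, h⟩
  rcases l with _ | ⟨e, l⟩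
  · constructor
    · intro h; exact absurd h (by simp [leftQuot, creationIndex, up])
    · rintro ⟨-, -, h⟩; simp [edgeWalk] at h
  · change ((if e = ε then some (⟨e.tgt, l, h.2⟩ : G.Walk) else none) = some c) ↔ _
    split_ifs with he
    · subst he
      constructor
      · intro hc
        obtain rfl := Option.some_injective _ hc
        exact ⟨rfl, h.1.symm, rfl⟩
      · rintro ⟨h1, h2, h3⟩
        refine congrArg some (Walk.ext h1 ?_)
        simpa [edgeWalk] using h3
    · constructor
      · intro hc; exact absurd hc (by simp)
      · rintro ⟨-, -, h3⟩
        exact absurd (List.cons_eq_cons.1 h3).1 he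

/-- Creation maps a basis vector to a basis vector or to zero, so this inner product reads off one
coordinate. It is what identifies the annihilation operator in coordinates. -/
theorem inner_creation_basisVec (ε : G.Dart) (γ : G.Walk) (ξ : G.Fock) :
    inner ℂ (creation ε (basisVec γ : G.Fock)) ξ = ext0 ξ (edge ε * up γ) := by
  classical
  rcases PWalk.cases (edge ε * up γ) with h0 | ⟨ζ, hζ⟩
  · have : creation ε (basisVec γ : G.Fock) = 0 := by
      ext ζ
      rw [creation_apply]
      rcases PWalk.cases (leftQuot ε ζ) with h | ⟨c, hc⟩
      · rw [h]; rfl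
      · rw [hc, ext0_up, basisVec_apply, if_neg]
        · rfl
        · rintro rfl
          rw [leftQuot_eq_up_iff, h0] at hc
          exact up_ne_zero _ hc.symm
    rw [this, h0, inner_zero_left, ext0_zero]
  · have : creation ε (basisVec γ : G.Fock) = basisVec ζ := by
      ext ζ'
      rw [creation_apply, basisVec_apply]
      rcases PWalk.cases (leftQuot ε ζ') with h | ⟨c, hc⟩
      · rw [h, ext0_zero, if_neg]
        rintro rfl
        rw [(leftQuot_eq_up_iff ε ζ' γ).2 hζ] at h
        exact up_ne_zero _ h
      · rw [hc, ext0_up, basisVec_apply]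
        have hiff : c = γ ↔ ζ' = ζ := by
          constructor
          · rintro rfl
            rw [leftQuot_eq_up_iff, hζ] at hc
            exact (up_injective hc).symm
          · rintro rfl
            rw [(leftQuot_eq_up_iff ε ζ' γ).2 hζ] at hc
            exact (up_injective hc).symm
        simp only [hiff]
    rw [this, hζ, ext0_up, inner_basisVec]

theorem adjoint_creation_apply (ε : G.Dart) (ξ : G.Fock) (γ : G.Walk) :
    (ContinuousLinearMap.adjoint (creation ε) ξ : G.Fock) γ = ext0 ξ (edge ε * up γ) := by
  rw [← inner_creation_basisVec, ← ContinuousLinearMap.adjoint_inner_right, inner_basisVec]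

/-- The coefficient `(μ(s(ε))/μ(t(ε)))^{1/4}`. -/
def qr (ε : G.Dart) : ℝ := (G.weight ε.src / G.weight ε.tgt) ^ (1 / 4 : ℝ)

/-- In coordinates the creation part looks at the path with its first edge removed, and the
annihilation part at the path with an edge prepended. -/
theorem x_apply (ε : G.Dart) (ξ : G.Fock) (ζ : G.Walk) :
    (x ε ξ : G.Fock) ζ = qr ε * ext0 ξ (leftQuot ε ζ) + qr ε.op * ext0 ξ (edge ε.op * up ζ) := by
  rw [← creation_apply, ← adjoint_creation_apply]
  rfl

theorem star_x (ε : G.Dart) : star (x ε) = x ε.op := by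
  unfold x
  rw [star_add, star_smul, star_smul, ContinuousLinearMap.star_eq_adjoint,
    ContinuousLinearMap.star_eq_adjoint, ContinuousLinearMap.adjoint_adjoint, add_comm]
  simp

/-- The product of generators along a word, applied to a vacuum vector. -/
def wordVec (w : List G.Dart) (v : V) : G.Fock := (w.map x).prod (vac v)

theorem wordVec_nil (v : V) : wordVec ([] : List G.Dart) v = vac v := rfl

theorem wordVec_cons (e : G.Dart) (w : List G.Dart) (v : V) :
    wordVec (e :: w) v = x e (wordVec w v) := by
  simp [wordVec]

theorem up_mul_up_nil (a : G.Walk) : up a * up (Walk.nil G a.tgt) = up a := by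
  rw [up_mul_up_eq_iff]
  exact ⟨rfl, rfl, by simp [Walk.nil]⟩

theorem up_nil_mul_up (a : G.Walk) : up (Walk.nil G a.src) * up a = up a := by
  rw [up_mul_up_eq_iff]
  exact ⟨rfl, rfl, by simp [Walk.nil]⟩

theorem leftQuot_nil (ε : G.Dart) (v : V) : leftQuot ε (Walk.nil G v) = 0 := rfl

open Classical in
theorem leftQuot_edgeWalk (ε η : G.Dart) :
    leftQuot ε (edgeWalk η) = if η = ε then up (Walk.nil G η.tgt) else 0 := rfl

theorem exists_edge_mul (ζ : G.Walk) (h : ζ ≠ Walk.nil G ζ.src) :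
    ∃ f ζ', edge f * up ζ' = up ζ := by
  rcases ζ with ⟨v, l, hl⟩
  rcases l with _ | ⟨e, l⟩
  · exact absurd rfl h
  · refine ⟨e, ⟨e.tgt, l, hl.2⟩, ?_⟩
    rw [edge, up_mul_up_eq_iff]
    exact ⟨rfl, hl.1.symm, rfl⟩

/-- Removing the first edge commutes with appending a last edge, except on a path of length zero,
where the appended edge is itself the first one. That exception produces the new summand in the
induction for `wordVec_mul_edge`. -/
theorem leftQuot_mul (ε : G.Dart) {ζ ω : G.Walk} {η : G.Dart} (h : ζ ≠ Walk.nil G ζ.src)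
    (hω : up ζ * edge η = up ω) : leftQuot ε ω = leftQuot ε ζ * edge η := by
  obtain ⟨f, ζ', hζ⟩ := exists_edge_mul ζ h
  have h1 : edge f * (up ζ' * edge η) = up ω := by rw [← mul_assoc, hζ, hω]
  obtain ⟨c, hc⟩ : ∃ c, up ζ' * edge η = up c := by
    rcases PWalk.cases (up ζ' * edge η) with h0 | h0
    · rw [h0, mul_zero] at h1; exact absurd h1.symm (up_ne_zero _)
    · exact h0
  by_cases he : f = ε
  · subst he
    rw [(leftQuot_eq_up_iff f ζ ζ').2 hζ, hc, leftQuot_eq_up_iff, ← hc, h1]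
  · have hne : ∀ (a b : G.Walk), edge f * up a = up b → leftQuot ε b = 0 := by
      intro a b hab
      rcases PWalk.cases (leftQuot ε b) with h0 | ⟨d, hd⟩
      · exact h0
      · rw [leftQuot_eq_up_iff, ← hab, edge, edge] at hd
        obtain ⟨-, -, h3⟩ := (up_mul_up_eq_iff _ _ _).1 (hab)
        obtain ⟨-, -, h4⟩ := (up_mul_up_eq_iff _ _ _).1 (hd.trans hab)
        rw [h3] at h4
        exact absurd (List.cons_eq_cons.1 h4).1 he
    rw [hne c ω (hc ▸ h1), hne ζ' ζ hζ, zero_mul]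

open Classical in
/-- The coordinate of a word vector at a path that ends with `η` is computed from the times at which
the last edge `η` can have been created. -/
theorem wordVec_mul_edge (η : G.Dart) (β : List G.Dart) :
    ∀ z : G.PWalk, (∀ ζ, z = up ζ → ζ.tgt = η.src) →
    ext0 (wordVec β η.tgt) (z * edge η) = ∑ i ∈ Finset.range β.length,
      if β[i]? = some η then (qr η : ℂ) * ext0 (wordVec (β.take i) η.src) z *
        wordVec (β.drop (i + 1)) η.tgt (Walk.nil G η.tgt) else 0 := by
  induction β with
  | nil =>
    intro z _
    rw [wordVec_nil]
    simp only [List.length_nil, Finset.range_zero, Finset.sum_empty]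
    rcases PWalk.cases (z * edge η) with h0 | ⟨ω, hω⟩
    · rw [h0, ext0_zero]
    · rw [hω, ext0_up, vac_apply_of_ne]
      rintro rfl
      rcases PWalk.cases z with rfl | ⟨ζ, rfl⟩
      · rw [zero_mul] at hω; exact up_ne_zero _ hω.symm
      · have := (src_tgt_length_of_mul hω).2.2.1
        simp [Walk.nil, Walk.length, edgeWalk] at this
  | cons e β ih =>
    intro z hz
    rw [List.length_cons, Finset.sum_range_succ']
    simp only [List.getElem?_cons_succ, List.take_succ_cons, List.drop_succ_cons,
      List.getElem?_cons_zero, List.take_zero, List.drop_zero]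
    rcases PWalk.cases z with rfl | ⟨ζ, rfl⟩
    · simp
    have hζ := hz ζ rfl
    have hω : up ζ * edge η = up (ζ.append (edgeWalk η) hζ) := up_mul_up _ _ hζ
    set ω := ζ.append (edgeWalk η) hζ with hωdef
    have tgt_mul : ∀ c ζ', edge e.op * up ζ = up ζ' → c = up ζ → ζ'.tgt = η.src := by
      intro c ζ' h _
      rw [(src_tgt_length_of_mul h).2.1, hζ]
    have ih1 := ih (edge e.op * up ζ) (fun ζ' h => tgt_mul _ ζ' h rfl)
    rw [hω, ext0_up, wordVec_cons, x_apply, ← hω, ← mul_assoc, ih1]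
    simp only [ext0_up, wordVec_cons, x_apply, wordVec_nil]
    -- If `ζ` has length zero, the leftmost letter may itself create `η`, which is the summand at
    -- position zero. The annihilation part gives the later positions.
    by_cases hnil : ζ = Walk.nil G ζ.src
    · have hs : ζ.src = η.src := by rw [← hζ, hnil]; rfl
      have hωe : ω = edgeWalk η := by
        refine Walk.ext hs ?_
        rw [hωdef]
        simp only [Walk.append]
        rw [hnil]; rfl
      have hζ' : ζ = Walk.nil G η.src := by rw [hnil, hs]
      rw [hωe, leftQuot_edgeWalk, hζ', leftQuot_nil, vac_apply_self, Finset.mul_sum]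
      rw [add_comm]
      congr 1
      · refine Finset.sum_congr rfl fun i _ => ?_
        rw [mul_ite, mul_zero]
        refine if_congr Iff.rfl ?_ rfl
        rw [ext0_zero]
        ring
      · by_cases he : e = η
        · subst he
          simp
        · have he' : ¬ η = e := fun h => he h.symm
          simp [he, he']
    -- Otherwise the leftmost letter acts on `ζ` alone, and the summand at position zero vanishes
    -- because the vacuum has no coordinate at `ζ`.
    · rw [leftQuot_mul e hnil hω, ih (leftQuot e ζ), vac_apply_of_ne, Finset.mul_sum,
        Finset.mul_sum, ← Finset.sum_add_distrib]
      · simp only [mul_zero, zero_mul, ite_self, add_zero]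
        refine Finset.sum_congr rfl fun i _ => ?_
        split_ifs
        · ring
        · simp
      · intro h
        apply hnil
        rw [h]; rfl
      · intro ζ' h
        rw [leftQuot_eq_up_iff] at h
        rw [← hζ, (src_tgt_length_of_mul h).2.1]

/-- The moment of the generators along a path. -/
def tw (γ : G.Walk) : ℂ := tauOp (xWalk γ)

theorem tauOp_eq (T : G.Fock →L[ℂ] G.Fock) :
    tauOp T = ∑ v, (G.weight v : ℂ) * inner ℂ (vac v : G.Fock) (T (vac v)) := by
  rfl

theorem inner_vac (v : V) (ξ : G.Fock) : inner ℂ (vac v : G.Fock) ξ = ξ (Walk.nil G v) :=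
  inner_basisVec _ _

theorem proj_apply (v : V) (ξ : G.Fock) (γ : G.Walk) [Decidable (γ.src = v)] :
    (proj v ξ : G.Fock) γ = if γ.src = v then ξ γ else 0 := by
  classical
  have e : (proj v ξ : G.Fock) γ
      = (if γ.src = v then some γ else none : Option G.Walk).elim (0 : ℂ) ξ := by
    rw [show (if γ.src = v then some γ else none : Option G.Walk) =
      @ite _ (γ.src = v) (Classical.propDecidable _) (some γ) none by congr]
    rfl
  rw [e]
  by_cases h : γ.src = v <;> simp [h]

theorem tw_eq (γ : G.Walk) :
    tw γ = G.weight γ.src * wordVec γ.word γ.src (Walk.nil G γ.src) := by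
  classical
  unfold tw
  rw [tauOp_eq, Finset.sum_eq_single γ.src]
  · rw [inner_vac, xWalk, mul_apply_eq_comp, proj_apply]
    exact congrArg _ (if_pos rfl)
  · intro v _ hv
    rw [inner_vac, xWalk, mul_apply_eq_comp, proj_apply, if_neg, mul_zero]
    exact hv
  · intro h; exact absurd (Finset.mem_univ _) h

theorem x_vac_of_ne (e : G.Dart) (v : V) (h : e.tgt ≠ v) : x e (vac v : G.Fock) = 0 := by
  ext ζ
  have aux : ∀ (w : G.PWalk), w ≠ up (Walk.nil G v) → ext0 (vac v : G.Fock) w = 0 := by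
    intro w hw
    rcases PWalk.cases w with rfl | ⟨a, rfl⟩
    · rfl
    · rw [ext0_up, vac_apply_of_ne]
      rintro rfl; exact hw rfl
  rw [x_apply, aux, aux]
  · simp
  · intro h'
    have := (src_tgt_length_of_mul h').2.2.1
    rw [edgeWalk_length] at this
    simp only [Walk.nil, Walk.length, List.length_nil] at this
    omega
  · intro h'
    rw [leftQuot_eq_up_iff] at h'
    exact h (src_tgt_length_of_mul h').2.2.2

/-- On a path that is not closed, the rightmost generator meets the vacuum of a vertex that is not
its target and kills it. -/
theorem tw_eq_zero (γ : G.Walk) (h : γ.src ≠ γ.tgt) : tw γ = 0 := by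
  rw [tw_eq]
  have key : ∀ l : List G.Dart, ∀ v, walkEnd v l ≠ v → wordVec l v = 0 := by
    intro l v hl
    rcases List.eq_nil_or_concat l with rfl | ⟨l', e, rfl⟩
    · exact absurd rfl hl
    · rw [List.concat_eq_append] at hl ⊢
      rw [walkEnd_append] at hl
      simp only [wordVec, List.map_append, List.prod_append, List.map_cons, List.map_nil,
        List.prod_cons, List.prod_nil, mul_one, mul_apply_eq_comp]
      rw [x_vac_of_ne _ _ hl, map_zero]
  rw [key _ _ h.symm]
  simp

theorem star_prod_x (l : List G.Dart) :
    star (l.map x).prod = ((l.map Dart.op).reverse.map x).prod := by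
  induction l with
  | nil => simp
  | cons e l ih => simp [star_mul, ih, star_x]

theorem tw_rev (γ : G.Walk) : tw γ.rev = star (tw γ) := by
  by_cases h : γ.src = γ.tgt
  · have hr : γ.rev.src = γ.src := h.symm
    rw [tw_eq, tw_eq, hr, ← inner_vac, ← inner_vac]
    have : wordVec γ.rev.word γ.src = star (γ.word.map x).prod (vac γ.src) := by
      rw [star_prod_x]; rfl
    rw [this, ContinuousLinearMap.star_eq_adjoint, ContinuousLinearMap.adjoint_inner_right]
    change _ = starRingEnd ℂ (_ * inner ℂ _ ((γ.word.map x).prod (vac γ.src)))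
    rw [map_mul, inner_conj_symm, Complex.conj_ofReal]
  · rw [tw_eq_zero γ h, tw_eq_zero, star_zero]
    rw [rev_src, rev_tgt]
    exact fun h' => h h'.symm

theorem norm_proj_le (v : V) : ‖(proj v : G.Fock →L[ℂ] G.Fock)‖ ≤ 1 := by
  unfold proj partialComp
  exact LinearMap.mkContinuous_norm_le _ zero_le_one _

theorem norm_xWalk_le {M : ℝ} (hM : 0 ≤ M) (h : ∀ ε : G.Dart, ‖x ε‖ ≤ M) (γ : G.Walk) :
    ‖xWalk γ‖ ≤ M ^ γ.length := by
  have key : ∀ l : List G.Dart, ‖(l.map x).prod‖ ≤ M ^ l.length := by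
    intro l
    induction l with
    | nil =>
      rw [List.map_nil, List.prod_nil, List.length_nil, pow_zero]
      exact ContinuousLinearMap.norm_id_le
    | cons e l ih =>
      rw [List.map_cons, List.prod_cons, List.length_cons, pow_succ']
      exact (norm_mul_le _ _).trans (mul_le_mul (h e) ih (norm_nonneg _) hM)
  refine (norm_mul_le _ _).trans ?_
  rw [← one_mul (M ^ γ.length)]
  exact mul_le_mul (norm_proj_le _) (key _) (norm_nonneg _) zero_le_one

/-- The free graph law as a continuous functional. -/
def tauCLM : (G.Fock →L[ℂ] G.Fock) →L[ℂ] ℂ :=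
  ∑ v, (G.weight v : ℂ) • ((innerSL ℂ (vac v : G.Fock)).comp
    (ContinuousLinearMap.apply ℂ G.Fock (vac v : G.Fock)))

theorem tauCLM_apply (T : G.Fock →L[ℂ] G.Fock) : tauCLM T = tauOp T := by
  rw [tauOp_eq]
  simp [tauCLM]

theorem norm_vac (v : V) : ‖(vac v : G.Fock)‖ = 1 := by
  classical
  rw [vac, basisVec, lp.norm_single (by norm_num)]
  simp

theorem norm_tauOp_le (T : G.Fock →L[ℂ] G.Fock) : ‖tauOp T‖ ≤ ‖T‖ := by
  rw [tauOp_eq]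
  refine (norm_sum_le _ _).trans ?_
  calc ∑ v, ‖(G.weight v : ℂ) * inner ℂ (vac v : G.Fock) (T (vac v))‖
      ≤ ∑ v, G.weight v * ‖T‖ := by
        refine Finset.sum_le_sum fun v _ => ?_
        rw [norm_mul, Complex.norm_real, Real.norm_of_nonneg (G.weight_pos v).le]
        refine mul_le_mul_of_nonneg_left ?_ (G.weight_pos v).le
        refine (norm_inner_le_norm _ _).trans ?_
        have := T.le_opNorm (vac v)
        rw [norm_vac, mul_one] at this
        rwa [norm_vac, one_mul]
    _ = ‖T‖ := by rw [← Finset.sum_mul, G.weight_sum, one_mul]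

theorem norm_tw_le {M : ℝ} (hM : 0 ≤ M) (h : ∀ ε : G.Dart, ‖x ε‖ ≤ M) (γ : G.Walk) :
    ‖tw γ‖ ≤ M ^ γ.length :=
  (norm_tauOp_le _).trans (norm_xWalk_le hM h γ)

/-- The moments, extended by zero. -/
def t0 (w : G.PWalk) : ℂ := ext0 tw w

@[simp] theorem t0_up (a : G.Walk) : t0 (up a) = tw a := rfl
@[simp] theorem t0_zero : t0 (0 : G.PWalk) = 0 := rfl

theorem t0_prev (w : G.PWalk) : t0 (prev w) = star (t0 w) := by
  rcases PWalk.cases w with rfl | ⟨a, rfl⟩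
  · simp
  · simp [tw_rev]

/-- The constant `√(μ(s(ε)) μ(t(ε)))` of the conjugate variables. -/
def kap (ε : G.Dart) : ℝ := √(G.weight ε.src * G.weight ε.tgt)

theorem kap_pos (ε : G.Dart) : 0 < kap ε :=
  Real.sqrt_pos.2 (mul_pos (G.weight_pos _) (G.weight_pos _))

theorem kap_op (ε : G.Dart) : kap ε.op = kap ε := by
  simp [kap, mul_comm]

/-- In τ(x_{ε^op} w) the annihilation and the matching creation of ε each contribute `qr ε`, and the
law contributes the weight of the target. The constant `kap` turns this into the product of weights
carried by two separate moments. -/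
theorem kap_mul_qr_sq (ε : G.Dart) :
    kap ε * (G.weight ε.tgt * (qr ε * qr ε)) = G.weight ε.src * G.weight ε.tgt := by
  have hs := G.weight_pos ε.src
  have ht := G.weight_pos ε.tgt
  have h1 : qr ε * qr ε = √(G.weight ε.src / G.weight ε.tgt) := by
    rw [qr, ← Real.rpow_add (div_pos hs ht), Real.sqrt_eq_rpow]
    norm_num
  rw [h1, kap, mul_left_comm, ← Real.sqrt_mul (by positivity)]
  have h2 : G.weight ε.src * G.weight ε.tgt * (G.weight ε.src / G.weight ε.tgt)
      = G.weight ε.src * G.weight ε.src := by field_simp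
  rw [h2, Real.sqrt_mul_self hs.le, mul_comm]

/-- The Schwinger-Dyson equation of the free graph law. -/
theorem schwinger_dyson (ε : G.Dart) (w : G.PWalk) :
    kap ε * t0 (edge ε.op * w) = dsum ε (fun α β => t0 α * t0 β) w := by
  classical
  rcases PWalk.cases w with rfl | ⟨b, rfl⟩
  · simp
  by_cases hb : ε.src = b.src
  · have hw : edge ε.op * up b = up ((edgeWalk ε.op).append b hb) := up_mul_up (edgeWalk ε.op) b hb
    -- Only the annihilation part of the first letter reaches the vacuum coordinate, and it reads
    -- the coordinate of the remaining word at the single edge ε.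
    have h1 : t0 (edge ε.op * up b) = G.weight ε.tgt * (qr ε *
        ext0 (wordVec b.word ε.tgt) (up (Walk.nil G ε.src) * edge ε)) := by
      rw [hw, t0_up, tw_eq]
      change (G.weight ε.tgt : ℂ) * (wordVec (ε.op :: b.word) ε.tgt : G.Fock) (Walk.nil G ε.tgt) = _
      have e1 : edge ε * up (Walk.nil G ε.tgt) = edge ε := up_mul_up_nil (edgeWalk ε)
      have e2 : up (Walk.nil G ε.src) * edge ε = edge ε := up_nil_mul_up (edgeWalk ε)
      rw [wordVec_cons, x_apply, leftQuot_nil, ext0_zero, mul_zero, zero_add, Dart.op_op, e1, e2]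
    rw [h1, wordVec_mul_edge, dsum_up, Finset.mul_sum, Finset.mul_sum, Finset.mul_sum]
    · refine Finset.sum_congr rfl fun i _ => ?_
      by_cases hi : b.word[i]? = some ε
      · have hc := src_tgt_length_of_cut (cut_eq b ε i hi)
        rw [if_pos hi, if_pos hi, t0_up, t0_up, tw_eq, tw_eq, ← hc.2.2.2.2, ← hc.1, ← hb, ext0_up]
        change _ = (G.weight ε.src * wordVec (b.word.take i) ε.src (Walk.nil G ε.src)) *
          (G.weight ε.tgt * wordVec (b.word.drop (i + 1)) ε.tgt (Walk.nil G ε.tgt))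
        have hk : (kap ε : ℂ) * (G.weight ε.tgt * (qr ε * qr ε))
            = G.weight ε.src * G.weight ε.tgt := by exact_mod_cast kap_mul_qr_sq ε
        linear_combination (wordVec (b.word.take i) ε.src (Walk.nil G ε.src) *
          wordVec (b.word.drop (i + 1)) ε.tgt (Walk.nil G ε.tgt)) * hk
      · rw [if_neg hi, if_neg hi]; simp
    · intro ζ hζ
      rw [← up_injective hζ]; rfl
  -- Without composability the left side is zero. On the right, every first piece runs from the
  -- source of `b` to the source of ε, hence is not closed and has zero moment.
  · rw [edge, up_mul_up_of_ne (edgeWalk ε.op) b hb, t0_zero, mul_zero, dsum_eq_sum_cuts, Finset.sum_eq_zero]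
    intro p hp
    have hc := src_tgt_length_of_cut (mem_cuts.1 hp)
    rw [t0_up, tw_eq_zero, zero_mul]
    rw [hc.2.2.2.1, ← hc.1]
    exact fun h => hb h.symm

/-- Both sides are Schwinger-Dyson sums over the same cuts: the left directly, the right after
reversing the path and conjugating. The two moments in each summand commute. -/
theorem t0_edge_mul_comm (ε : G.Dart) (w : G.PWalk) : t0 (edge ε * w) = t0 (w * edge ε) := by
  have hk : (kap ε : ℂ) ≠ 0 := by exact_mod_cast (kap_pos ε).ne'
  refine mul_left_cancel₀ hk ?_
  have h1 := schwinger_dyson ε.op w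
  have h2 := congrArg star (schwinger_dyson ε (prev w))
  rw [kap_op, Dart.op_op] at h1
  rw [h1]
  have e : t0 (w * edge ε) = star (t0 (edge ε.op * prev w)) := by
    rw [← t0_prev, prev_mul, prev_prev, prev_edge, Dart.op_op]
  have hs : ∀ z : ℂ, star z = starAddEquiv z := fun _ => rfl
  rw [e]
  rw [star_mul', RCLike.star_def, Complex.conj_ofReal] at h2
  refine Eq.trans ?_ h2.symm
  change _ = starAddEquiv (dsum ε (fun α β => t0 α * t0 β) (prev w))
  rw [dsum_prev, map_dsum]
  refine dsum_congr _ (fun α β => ?_) _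
  change _ = star (t0 (prev β) * t0 (prev α))
  rw [t0_prev, t0_prev, star_mul', star_star, star_star, mul_comm]

/-- The free graph law is a trace. -/
theorem t0_mul_comm (u w : G.PWalk) : t0 (u * w) = t0 (w * u) := by
  rcases PWalk.cases u with rfl | ⟨⟨v, l, hl⟩, rfl⟩
  · simp
  induction l generalizing v w with
  | nil =>
    change t0 (up (Walk.nil G v) * w) = t0 (w * up (Walk.nil G v))
    rcases PWalk.cases w with rfl | ⟨b, rfl⟩
    · simp
    -- A vertex projection keeps or kills `b` on either side. If only one side survives, `b` is not
    -- closed and its moment is zero.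
    by_cases h1 : v = b.src <;> by_cases h2 : b.tgt = v
    · conv_lhs => rw [h1, up_nil_mul_up]
      rw [← h2, up_mul_up_nil]
    · rw [up_mul_up_of_ne b _ h2, h1, up_nil_mul_up, t0_zero, t0_up, tw_eq_zero]
      rw [← h1]; exact fun h => h2 h.symm
    · rw [up_mul_up_of_ne (Walk.nil G v) b h1, ← h2, up_mul_up_nil, t0_zero, t0_up, tw_eq_zero]
      rw [h2]; exact fun h => h1 h.symm
    · rw [up_mul_up_of_ne (Walk.nil G v) b h1, up_mul_up_of_ne b _ h2]
  | cons e l ih =>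
    have h : up (⟨v, e :: l, hl⟩ : G.Walk) = edge e * up ⟨e.tgt, l, hl.2⟩ := by
      symm
      rw [edge, up_mul_up_eq_iff]
      exact ⟨rfl, hl.1.symm, rfl⟩
    -- The first edge is carried to the far right, and the shorter path is handled by induction with
    -- `w` enlarged by that edge.
    rw [h, mul_assoc, t0_edge_mul_comm, mul_assoc, ih, mul_assoc]

end WeightedGraph
end FreeGraph
end

/-! ### Products, derivatives, traces and the adjoint of the Jacobian as bounded kernels. -/

noncomputable section
namespace FreeGraph
namespace WeightedGraph
open HasLen (len)

variable {V E : Type*} [Fintype V] {G : WeightedGraph V E} {R : ℝ}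

/-! ### The operations on power series as kernels -/

instance : HasLen G.Walk := ⟨Walk.length⟩

theorem len_walk (γ : G.Walk) : len γ = γ.length := rfl

/-- The monomial of a path, or zero. -/
def sg (w : G.PWalk) : G.Walk →₀ ℂ := w.elim 0 fun a => Finsupp.single a 1

/-- The elementary tensor of two monomials, or zero. -/
def sg2 (w w' : G.PWalk) : G.Walk × G.Walk →₀ ℂ :=
  w.elim 0 fun a => w'.elim 0 fun b => Finsupp.single (a, b) 1

/-- Extension by zero of a function of two paths. -/
def ext2 (k : G.Walk × G.Walk → ℂ) (w w' : G.PWalk) : ℂ :=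
  w.elim 0 fun a => w'.elim 0 fun b => k (a, b)

@[simp] theorem sg_zero : sg (0 : G.PWalk) = 0 := rfl
@[simp] theorem sg_up (a : G.Walk) : sg (up a) = Finsupp.single a 1 := rfl
@[simp] theorem sg2_zero_left (w : G.PWalk) : sg2 0 w = 0 := rfl
@[simp] theorem sg2_zero_right (w : G.PWalk) : sg2 w 0 = 0 := by
  rcases PWalk.cases w with rfl | ⟨a, rfl⟩ <;> rfl
@[simp] theorem sg2_up (a b : G.Walk) : sg2 (up a) (up b) = Finsupp.single (a, b) 1 := rfl
@[simp] theorem ext2_zero_left (k : G.Walk × G.Walk → ℂ) (w : G.PWalk) : ext2 k 0 w = 0 := rfl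
@[simp] theorem ext2_zero_right (k : G.Walk × G.Walk → ℂ) (w : G.PWalk) : ext2 k w 0 = 0 := by
  rcases PWalk.cases w with rfl | ⟨a, rfl⟩ <;> rfl
@[simp] theorem ext2_up (k : G.Walk × G.Walk → ℂ) (a b : G.Walk) :
    ext2 k (up a) (up b) = k (a, b) := rfl

theorem ext0_fun_up (f : G.PWalk → ℂ) (h : f 0 = 0) (w : G.PWalk) :
    ext0 (fun a => f (up a)) w = f w := by
  rcases PWalk.cases w with rfl | ⟨a, rfl⟩
  · exact h.symm
  · rfl

theorem ext2_fun_up (f : G.PWalk → G.PWalk → ℂ) (h : ∀ w, f 0 w = 0) (h' : ∀ w, f w 0 = 0)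
    (w w' : G.PWalk) : ext2 (fun p => f (up p.1) (up p.2)) w w' = f w w' := by
  rcases PWalk.cases w with rfl | ⟨a, rfl⟩
  · exact (h _).symm
  rcases PWalk.cases w' with rfl | ⟨b, rfl⟩
  · exact (h' _).symm
  · rfl

@[simp] theorem ev_sg (k : G.Walk → ℂ) (w : G.PWalk) : ev k (sg w) = ext0 k w := by
  rcases PWalk.cases w with rfl | ⟨a, rfl⟩
  · simp
  · simp [ev_single]

@[simp] theorem ev_sg2 (k : G.Walk × G.Walk → ℂ) (w w' : G.PWalk) :
    ev k (sg2 w w') = ext2 k w w' := by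
  rcases PWalk.cases w with rfl | ⟨a, rfl⟩
  · simp
  rcases PWalk.cases w' with rfl | ⟨b, rfl⟩
  · simp
  · simp [ev_single]

open Classical in
theorem sg_apply (w : G.PWalk) (γ : G.Walk) : sg w γ = if w = up γ then 1 else 0 := by
  rcases PWalk.cases w with rfl | ⟨a, rfl⟩
  · rw [if_neg (up_ne_zero γ).symm]; rfl
  · rw [sg_up, Finsupp.single_apply]
    simp only [up_inj]

open Classical in
theorem sg2_apply (w w' : G.PWalk) (r : G.Walk × G.Walk) :
    sg2 w w' r = if w = up r.1 ∧ w' = up r.2 then 1 else 0 := by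
  rcases PWalk.cases w with rfl | ⟨a, rfl⟩
  · rw [if_neg fun h => (up_ne_zero r.1).symm h.1]; rfl
  rcases PWalk.cases w' with rfl | ⟨b, rfl⟩
  · rw [if_neg fun h => (up_ne_zero r.2).symm h.2]; rfl
  · rw [sg2_up, Finsupp.single_apply]
    simp only [up_inj, Prod.ext_iff]

theorem wnorm_sg_le {S : ℝ} (hS : 0 ≤ S) (w : G.PWalk) (n : ℕ)
    (h : ∀ c, w = up c → c.length = n) : wnorm S (sg w) ≤ S ^ n := by
  rcases PWalk.cases w with rfl | ⟨a, rfl⟩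
  · simp only [sg_zero, wnorm_zero]; positivity
  · rw [sg_up, wnorm_single, norm_one, one_mul, len_walk, h a rfl]

theorem wnorm_sg2_le {S : ℝ} (hS : 0 ≤ S) (w w' : G.PWalk) (n : ℕ)
    (h : ∀ c d, w = up c → w' = up d → c.length + d.length = n) : wnorm S (sg2 w w') ≤ S ^ n := by
  rcases PWalk.cases w with rfl | ⟨a, rfl⟩
  · simp only [sg2_zero_left, wnorm_zero]; positivity
  rcases PWalk.cases w' with rfl | ⟨b, rfl⟩
  · simp only [sg2_zero_right, wnorm_zero]; positivity
  · rw [sg2_up, wnorm_single, norm_one, one_mul, len_prod, len_walk, len_walk, h a b rfl rfl]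

theorem wnorm_dsum_le {Y : Type*} [HasLen Y] {S B : ℝ} (hS : 0 ≤ S) (hB : 0 ≤ B) (ε : G.Dart)
    (k : G.PWalk → G.PWalk → Y →₀ ℂ) (a : G.Walk)
    (h : ∀ α β : G.Walk, a.length = α.length + β.length + 1 → wnorm S (k (up α) (up β)) ≤ B) :
    wnorm S (dsum ε k (up a)) ≤ a.length * B := by
  classical
  rw [dsum_eq_sum_cuts]
  refine (wnorm_sum hS _ _).trans ?_
  have hc : ((cuts ε a).card : ℝ) ≤ a.length := by
    have : (cuts ε a).card ≤ (Finset.range a.length).card :=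
      Finset.card_image_le.trans (Finset.card_filter_le _ _)
    rw [Finset.card_range] at this
    exact_mod_cast this
  refine (Finset.sum_le_card_nsmul _ _ B fun p hp => ?_).trans ?_
  · exact h _ _ (src_tgt_length_of_cut (mem_cuts.1 hp)).2.2.1
  · rw [nsmul_eq_mul]
    gcongr

theorem bdd_of_le_pow {X Y : Type*} [HasLen X] [HasLen Y] {K : X → Y →₀ ℂ}
    (h : ∀ S, 0 < S → S < R → ∃ C, 0 ≤ C ∧ ∀ x, wnorm S (K x) ≤ C * S ^ len x) : Bdd R K :=
  fun S h0 h1 => ⟨S, h0, h1, h S h0 h1⟩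

theorem bdd_of_le_len_mul_pow {X Y : Type*} [HasLen X] [HasLen Y] {K : X → Y →₀ ℂ}
    {S₀ : ℝ} (h₀ : S₀ < R) (h : ∀ S, 0 < S → S₀ ≤ S → S < R →
      ∃ C, 0 ≤ C ∧ ∀ x, wnorm S (K x) ≤ C * (len x * S ^ len x)) : Bdd R K := by
  refine Bdd.of_le S₀ h₀ fun S h0 h1 h2 => ?_
  obtain ⟨C, hC, hK⟩ := h S h0 h1 h2
  obtain ⟨C', hC', hp⟩ := exists_nat_mul_pow_le (S := S) (S' := (S + R) / 2) h0 (by linarith)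
  refine ⟨(S + R) / 2, by linarith, by linarith, C * C', by positivity, fun x => (hK x).trans ?_⟩
  rw [mul_assoc]
  exact mul_le_mul_of_nonneg_left (hp _) hC

theorem tsum_mul_indicator {X : Type*} (F : X → ℂ) (p : X → Prop) [DecidablePred p] (s : Finset X)
    (h : ∀ x, x ∈ s ↔ p x) : ∑' x, F x * (if p x then 1 else 0) = ∑ x ∈ s, F x := by
  rw [tsum_eq_sum (s := s)]
  · refine Finset.sum_congr rfl fun x hx => ?_
    rw [if_pos ((h x).1 hx), mul_one]
  · intro x hx
    rw [if_neg fun hp => hx ((h x).2 hp), mul_zero]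

/-! #### Multiplication -/

theorem multiply_eq_push (Q : G.Series₂) : multiply Q = push (fun p => sg (up p.1 * up p.2)) Q := by
  classical
  ext γ
  simp only [push, sg_apply]
  rw [tsum_mul_indicator _ _ (splits γ) fun p => mem_splits]
  exact sum_splits γ Q

theorem bdd_multiply : Bdd R fun p : G.Walk × G.Walk => sg (up p.1 * up p.2) :=
  bdd_of_le_pow fun S h0 _ => ⟨1, zero_le_one, fun p => by
    rw [one_mul]
    exact wnorm_sg_le h0.le _ _ fun c hc => (src_tgt_length_of_mul hc).2.2.1⟩

theorem pair_mul {c d : G.Series} {k : G.Walk → ℂ} (hc : Adm R c) (hd : Adm R d) (hk : Tame R k) :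
    pair (mul c d) k = pair (fun p : G.Walk × G.Walk => c p.1 * d p.2)
      fun p => ext0 k (up p.1 * up p.2) := by
  have : mul c d = multiply fun p => c p.1 * d p.2 := rfl
  rw [this, multiply_eq_push, pair_push bdd_multiply (hc.prod hd) hk]
  simp only [ev_sg]

theorem adm_mul {c d : G.Series} (hc : Adm R c) (hd : Adm R d) : Adm R (mul c d) := by
  have : mul c d = multiply fun p => c p.1 * d p.2 := rfl
  rw [this, multiply_eq_push]
  exact (hc.prod hd).push bdd_multiply

/-- The kernel of the multiplication of the tensor product. -/
def mulKer (z : (G.Walk × G.Walk) × G.Walk × G.Walk) : G.Walk × G.Walk →₀ ℂ :=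
  sg2 (up z.1.1 * up z.2.1) (up z.2.2 * up z.1.2)

theorem mul₂_eq_push (Q Q' : G.Series₂) : mul₂ Q Q' = push mulKer fun z => Q z.1 * Q' z.2 := by
  classical
  ext r
  simp only [push, mulKer, sg2_apply]
  -- Regrouping by tensor leg, so that the pairs become independent factorizations of the two legs.
  -- The second leg multiplies in the opposite order.
  let e : (G.Walk × G.Walk) × G.Walk × G.Walk ≃ (G.Walk × G.Walk) × G.Walk × G.Walk :=
    ⟨fun z => ((z.1.1, z.2.2), (z.1.2, z.2.1)), fun z => ((z.1.1, z.2.1), (z.2.2, z.1.2)),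
      fun _ => rfl, fun _ => rfl⟩
  rw [← e.tsum_eq, tsum_mul_indicator (fun z => Q (e z).1 * Q' (e z).2)
    (fun z => up (e z).1.1 * up (e z).2.1 = up r.1 ∧ up (e z).2.2 * up (e z).1.2 = up r.2)
    (splits r.1 ×ˢ splits r.2), Finset.sum_product]
  · unfold mul₂
    rw [← sum_splits r.1 fun p => ∑ q ∈ splits r.2, Q (e (p, q)).1 * Q' (e (p, q)).2]
    refine Finset.sum_congr rfl fun i _ => ?_
    rw [← sum_splits r.2]
    rfl
  · intro z
    rw [Finset.mem_product, mem_splits, mem_splits]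
    exact Iff.rfl

theorem bdd_mulKer : Bdd R (mulKer (G := G)) :=
  bdd_of_le_pow fun S h0 _ => ⟨1, zero_le_one, fun z => by
    rw [one_mul]
    refine wnorm_sg2_le h0.le _ _ _ fun c d hc hd => ?_
    rw [(src_tgt_length_of_mul hc).2.2.1, (src_tgt_length_of_mul hd).2.2.1]
    simp only [len_prod, len_walk]
    omega⟩

theorem adm_mul₂ {Q Q' : G.Series₂} (h : Adm R Q) (h' : Adm R Q') : Adm R (mul₂ Q Q') := by
  rw [mul₂_eq_push]
  exact (h.prod h').push bdd_mulKer

/-- The test function on pairs that computes a test function on products. -/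
def mulTest (k : G.Walk × G.Walk → ℂ) (z : (G.Walk × G.Walk) × G.Walk × G.Walk) : ℂ :=
  ext2 k (up z.1.1 * up z.2.1) (up z.2.2 * up z.1.2)

theorem tame_mulTest {k : G.Walk × G.Walk → ℂ} (hk : Tame R k) : Tame R (mulTest k) := by
  have := bdd_mulKer.tame hk
  simp only [mulKer, ev_sg2] at this
  exact this

theorem pair_mul₂ {Q Q' : G.Series₂} (h : Adm R Q) (h' : Adm R Q') {k : G.Walk × G.Walk → ℂ}
    (hk : Tame R k) : pair (mul₂ Q Q') k = pair (fun z => Q z.1 * Q' z.2) (mulTest k) := by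
  rw [mul₂_eq_push, pair_push bdd_mulKer (h.prod h') hk]
  simp only [mulKer, ev_sg2]
  rfl

/-! #### The action -/

/-- The kernel of the action of the tensor product. -/
def actKer (z : (G.Walk × G.Walk) × G.Walk) : G.Walk →₀ ℂ := sg (up z.1.1 * up z.2 * up z.1.2)

theorem act_eq_push (Q : G.Series₂) (c : G.Series) :
    act Q c = push actKer fun z => Q z.1 * c z.2 := by
  classical
  ext γ
  simp only [push, actKer, sg_apply]
  -- A factorization into three pieces is encoded as two nested splittings. The intermediate path is
  -- determined by the last two pieces, so the encoding is injective.
  let e : (Σ _ : G.Walk × G.Walk, G.Walk × G.Walk) → (G.Walk × G.Walk) × G.Walk :=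
    fun z => ((z.1.1, z.2.2), z.2.1)
  rw [tsum_mul_indicator _ _ (((splits γ).sigma fun p => splits p.2).image e)]
  · rw [Finset.sum_image, Finset.sum_sigma]
    · unfold act
      rw [← sum_splits γ fun p => ∑ q ∈ splits p.2, Q (e ⟨p, q⟩).1 * c (e ⟨p, q⟩).2]
      refine Finset.sum_congr rfl fun i _ => ?_
      rw [← sum_splits]
    · rintro ⟨⟨a, u⟩, ⟨η, b⟩⟩ h ⟨⟨a', u'⟩, ⟨η', b'⟩⟩ h' hh
      simp only [e, Prod.mk.injEq] at hh
      obtain ⟨⟨rfl, rfl⟩, rfl⟩ := hh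
      have h1 := mem_splits.1 (Finset.mem_sigma.1 h).2
      have h2 := mem_splits.1 (Finset.mem_sigma.1 h').2
      have : u = u' := up_injective (h1.symm.trans h2)
      subst this
      rfl
  · rintro ⟨⟨a, b⟩, η⟩
    rw [Finset.mem_image]
    constructor
    · rintro ⟨⟨⟨a', u'⟩, ⟨η', b'⟩⟩, h, hh⟩
      simp only [e, Prod.mk.injEq] at hh
      obtain ⟨⟨rfl, rfl⟩, rfl⟩ := hh
      have h1 := mem_splits.1 (Finset.mem_sigma.1 h).1
      have h2 := mem_splits.1 (Finset.mem_sigma.1 h).2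
      simp only at h1 h2 ⊢
      rw [mul_assoc, h2, h1]
    · intro h
      simp only at h
      rw [mul_assoc] at h
      rcases PWalk.cases (up η * up b) with h0 | ⟨u, hu⟩
      · rw [h0, mul_zero] at h; exact absurd h.symm (up_ne_zero _)
      · rw [hu] at h
        exact ⟨⟨(a, u), (η, b)⟩, Finset.mem_sigma.2 ⟨mem_splits.2 h, mem_splits.2 hu⟩, rfl⟩

theorem bdd_actKer : Bdd R (actKer (G := G)) :=
  bdd_of_le_pow fun S h0 _ => ⟨1, zero_le_one, fun z => by
    rw [one_mul]
    refine wnorm_sg_le h0.le _ _ fun c hc => ?_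
    rcases PWalk.cases (up z.1.1 * up z.2) with h0 | ⟨u, hu⟩
    · rw [h0, zero_mul] at hc; exact absurd hc.symm (up_ne_zero _)
    · rw [hu] at hc
      rw [(src_tgt_length_of_mul hc).2.2.1, (src_tgt_length_of_mul hu).2.2.1]
      simp only [len_prod, len_walk]
      omega⟩

theorem adm_act {Q : G.Series₂} {c : G.Series} (h : Adm R Q) (h' : Adm R c) : Adm R (act Q c) := by
  rw [act_eq_push]
  exact (h.prod h').push bdd_actKer

theorem tame_act {k : G.Walk → ℂ} (hk : Tame R k) :
    Tame R fun z : (G.Walk × G.Walk) × G.Walk => ext0 k (up z.1.1 * up z.2 * up z.1.2) := by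
  simpa only [actKer, ev_sg] using bdd_actKer.tame hk

theorem pair_act {Q : G.Series₂} {c : G.Series} (h : Adm R Q) (h' : Adm R c) {k : G.Walk → ℂ}
    (hk : Tame R k) : pair (act Q c) k =
      pair Q fun p => pair c fun η => ext0 k (up p.1 * up η * up p.2) := by
  rw [act_eq_push, pair_push bdd_actKer (h.prod h') hk]
  simp only [actKer, ev_sg]
  exact pair_prod h h' (tame_act hk)

/-! #### Difference quotients and cyclic derivatives -/

theorem diffQuot_eq (ε : G.Dart) (c : G.Series) (p : G.Walk × G.Walk) :
    diffQuot ε c p = ext0 c (up p.1 * edge ε * up p.2) := by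
  unfold diffQuot
  split_ifs with h
  · rw [← up_join _ _ _ h, ext0_up]
  · rw [up_mul_edge_mul_up_of_not _ _ _ h, ext0_zero]

theorem diffQuot_eq_push (ε : G.Dart) (c : G.Series) :
    diffQuot ε c = push (fun γ => dsum ε sg2 (up γ)) c := by
  classical
  ext r
  have h : ∀ γ, dsum ε sg2 (up γ) r = if up r.1 * edge ε * up r.2 = up γ then 1 else 0 := by
    intro γ
    rw [dsum_eq_sum_cuts, Finsupp.finsetSum_apply]
    simp only [sg2_up, Finsupp.single_apply, Prod.mk.eta]
    rw [Finset.sum_ite_eq']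
    simp only [mem_cuts]
  simp only [push, h, diffQuot_eq]
  rcases PWalk.cases (up r.1 * edge ε * up r.2) with h0 | ⟨γ, hγ⟩
  · have : ∀ γ : G.Walk, ¬ (0 : G.PWalk) = up γ := fun γ => (up_ne_zero γ).symm
    simp [h0, this]
  · rw [tsum_mul_indicator _ _ {γ}]
    · simp [hγ]
    · intro x
      rw [hγ, up_inj, Finset.mem_singleton]
      exact eq_comm

theorem pow_sub_one_bound {S : ℝ} (hS : 0 < S) {n m : ℕ} (h : m = n + 1) :
    S ^ n = S⁻¹ * S ^ m := by
  rw [h, pow_succ]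
  field_simp

/-- There are at most |γ| cuts, and each loses one edge, hence the constant S⁻¹. -/
theorem bdd_diffQuot (hR : 0 < R) (ε : G.Dart) : Bdd R fun γ : G.Walk => dsum ε sg2 (up γ) :=
  bdd_of_le_len_mul_pow (S₀ := 0) hR fun S h0 _ _ => ⟨S⁻¹, by positivity, fun γ => by
    refine (wnorm_dsum_le h0.le (B := S⁻¹ * S ^ γ.length) (by positivity) ε _ γ
      fun α β h => ?_).trans_eq ?_
    · rw [← pow_sub_one_bound h0 h]
      exact wnorm_sg2_le h0.le _ _ _ fun c d hc hd => by
        rw [up_injective hc, up_injective hd]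
    · rw [len_walk]; ring⟩

theorem adm_diffQuot (hR : 0 < R) (ε : G.Dart) {c : G.Series} (h : Adm R c) :
    Adm R (diffQuot ε c) := by
  rw [diffQuot_eq_push]
  exact h.push (bdd_diffQuot hR ε)

theorem tame_dsum_ext2 (hR : 0 < R) (ε : G.Dart) {k : G.Walk × G.Walk → ℂ} (hk : Tame R k) :
    Tame R fun γ : G.Walk => dsum ε (ext2 k) (up γ) := by
  have := (bdd_diffQuot hR ε).tame hk
  simp only [map_dsum, ev_sg2] at this
  exact this

theorem pair_diffQuot (hR : 0 < R) (ε : G.Dart) {c : G.Series} (h : Adm R c)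
    {k : G.Walk × G.Walk → ℂ} (hk : Tame R k) :
    pair (diffQuot ε c) k = pair c fun γ => dsum ε (ext2 k) (up γ) := by
  rw [diffQuot_eq_push, pair_push (bdd_diffQuot hR ε) h hk]
  simp only [map_dsum, ev_sg2]

theorem len_swap (p : G.Walk × G.Walk) : len (Equiv.prodComm G.Walk G.Walk p) = len p := by
  simp only [len_prod, Equiv.prodComm_apply, Prod.fst_swap, Prod.snd_swap]
  exact add_comm _ _

theorem adm_flip {Q : G.Series₂} (h : Adm R Q) : Adm R (flip Q) :=
  h.comp_equiv (Equiv.prodComm _ _) len_swap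

theorem adm_cyclicDeriv (hR : 0 < R) (ω : G.Dart) {c : G.Series} (h : Adm R c) :
    Adm R (cyclicDeriv ω c) := by
  unfold cyclicDeriv
  rw [multiply_eq_push]
  exact (adm_flip (adm_diffQuot hR ω.op h)).push bdd_multiply

theorem tame_ext0_mul_comm {k : G.Walk → ℂ} (hk : Tame R k) :
    Tame R fun p : G.Walk × G.Walk => ext0 k (up p.2 * up p.1) := by
  have := (bdd_multiply (G := G)).tame hk
  simp only [ev_sg] at this
  exact this.comp_equiv (Equiv.prodComm _ _) len_swap

theorem ext2_mul_comm (k : G.Walk → ℂ) (u w : G.PWalk) :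
    ext2 (fun p => ext0 k (up p.2 * up p.1)) u w = ext0 k (w * u) :=
  ext2_fun_up (fun u w => ext0 k (w * u)) (by simp) (by simp) u w

theorem tame_cyc (hR : 0 < R) (ω : G.Dart) {k : G.Walk → ℂ} (hk : Tame R k) :
    Tame R fun γ : G.Walk => dsum ω.op (fun α β => ext0 k (β * α)) (up γ) := by
  have := tame_dsum_ext2 hR ω.op (tame_ext0_mul_comm hk)
  simpa only [ext2_mul_comm, funext₂ (ext2_mul_comm k)] using this

/-- The transpose of the cyclic derivative removes an edge and rotates the remaining pieces.
Differentiation of power series is thereby reduced to finite sums over cuts. -/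
theorem pair_cyclicDeriv (hR : 0 < R) (ω : G.Dart) {c : G.Series} (h : Adm R c) {k : G.Walk → ℂ}
    (hk : Tame R k) : pair (cyclicDeriv ω c) k =
      pair c fun γ => dsum ω.op (fun α β => ext0 k (β * α)) (up γ) := by
  unfold cyclicDeriv
  rw [multiply_eq_push, pair_push bdd_multiply (adm_flip (adm_diffQuot hR ω.op h)) hk]
  simp only [ev_sg]
  rw [← pair_comp_equiv (Equiv.prodComm G.Walk G.Walk)]
  refine (pair_diffQuot hR ω.op h (tame_ext0_mul_comm hk)).trans (pair_congr fun γ => ?_)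
  exact dsum_congr _ (ext2_mul_comm k) _

/-! #### The trace -/

/-- Since ‖x_γ‖ ≤ M^{|γ|} with `M < R`, the operator series converges in norm and the law may be
applied term by term. After this only the moments of monomials matter. -/
theorem tau_eq_pair {M : ℝ} (hM0 : 0 < M) (hMR : M < R) (hx : ∀ ε : G.Dart, ‖x ε‖ ≤ M)
    {c : G.Series} (h : Adm R c) : tau c = pair c tw := by
  have hs : Summable fun γ : G.Walk => c γ • xWalk γ := by
    refine Summable.of_norm (Summable.of_nonneg_of_le (fun _ => norm_nonneg _) (fun γ => ?_)
      (h M hM0 hMR))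
    rw [norm_smul]
    exact mul_le_mul_of_nonneg_left (norm_xWalk_le hM0.le hx γ) (norm_nonneg _)
  unfold tau eval pair
  rw [← tauCLM_apply, tauCLM.map_tsum hs]
  refine tsum_congr fun γ => ?_
  rw [map_smul, tauCLM_apply]
  rfl

theorem tame_tw {M : ℝ} (hM0 : 0 < M) (hMR : M < R) (hx : ∀ ε : G.Dart, ‖x ε‖ ≤ M) :
    Tame R (tw (G := G)) :=
  Tame.of_le hM0 hMR 1 fun γ => by
    rw [one_mul]; exact norm_tw_le hM0.le hx γ

/-- For weights above the growth rate of the moments, the scalar τ(x_β) is absorbed into S^{|β|}. -/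
theorem bdd_tau_right (ht : Tame R (tw (G := G))) :
    Bdd R fun p : G.Walk × G.Walk => tw p.2 • sg (up p.1) := by
  obtain ⟨S₀, h0, h1, C, hC, ht⟩ := ht
  refine Bdd.of_le S₀ h1 fun S hS hS0 hSR => ⟨S, hS, hSR, C, hC, fun p => ?_⟩
  refine (wnorm_smul_le _ _ _).trans ?_
  rw [sg_up, wnorm_single, norm_one, one_mul, len_prod, pow_add, mul_comm (S ^ _), ← mul_assoc]
  gcongr
  refine (ht _).trans ?_
  gcongr

theorem adm_slice {X Y : Type*} [HasLen X] [HasLen Y] {Q : X × Y → ℂ} (h : Adm R Q)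
    (x : X) : Adm R fun y => Q (x, y) := by
  intro S h0 h1
  have h2 := (h S h0 h1).prod_factor x
  have h3 : S ^ len x ≠ 0 := by positivity
  refine (h2.mul_right (S ^ len x)⁻¹).congr fun y => ?_
  rw [len_prod, pow_add]
  field_simp

theorem oneTau_eq_push {M : ℝ} (hM0 : 0 < M) (hMR : M < R) (hx : ∀ ε : G.Dart, ‖x ε‖ ≤ M)
    {Q : G.Series₂} (h : Adm R Q) : oneTau Q = push (fun p => tw p.2 • sg (up p.1)) Q := by
  classical
  ext α
  have ht := tame_tw hM0 hMR hx
  have hs : Summable fun p : G.Walk × G.Walk => Q p * (tw p.2 • sg (up p.1)) α := by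
    have := summable_pair h ((bdd_tau_right ht).tame (tame_pi_single (hM0.trans hMR) α))
    simpa only [ev_pi_single] using this
  unfold oneTau push
  rw [tau_eq_pair hM0 hMR hx (adm_slice h α), hs.tsum_prod, tsum_eq_single α]
  · unfold pair
    refine tsum_congr fun β => ?_
    simp
  · intro a ha
    simp [ha]

theorem flip_oneTau (Q : G.Series₂) : tauOne Q = oneTau (flip Q) := rfl

theorem pair_oneTau {M : ℝ} (hM0 : 0 < M) (hMR : M < R) (hx : ∀ ε : G.Dart, ‖x ε‖ ≤ M)
    {Q : G.Series₂} (h : Adm R Q) {k : G.Walk → ℂ} (hk : Tame R k) :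
    pair (oneTau Q) k = pair Q fun p => k p.1 * tw p.2 := by
  rw [oneTau_eq_push hM0 hMR hx h, pair_push (bdd_tau_right (tame_tw hM0 hMR hx)) h hk]
  refine pair_congr fun p => ?_
  rw [map_smul, ev_sg, ext0_up, smul_eq_mul, mul_comm]

theorem adm_oneTau {M : ℝ} (hM0 : 0 < M) (hMR : M < R) (hx : ∀ ε : G.Dart, ‖x ε‖ ≤ M)
    {Q : G.Series₂} (h : Adm R Q) : Adm R (oneTau Q) := by
  rw [oneTau_eq_push hM0 hMR hx h]
  exact h.push (bdd_tau_right (tame_tw hM0 hMR hx))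

theorem pair_tauOne {M : ℝ} (hM0 : 0 < M) (hMR : M < R) (hx : ∀ ε : G.Dart, ‖x ε‖ ≤ M)
    {Q : G.Series₂} (h : Adm R Q) {k : G.Walk → ℂ} (hk : Tame R k) :
    pair (tauOne Q) k = pair Q fun p => tw p.1 * k p.2 := by
  rw [flip_oneTau, pair_oneTau hM0 hMR hx (adm_flip h) hk,
    ← pair_comp_equiv (Equiv.prodComm G.Walk G.Walk)]
  exact pair_congr fun p => mul_comm _ _

theorem adm_tauOne {M : ℝ} (hM0 : 0 < M) (hMR : M < R) (hx : ∀ ε : G.Dart, ‖x ε‖ ≤ M)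
    {Q : G.Series₂} (h : Adm R Q) : Adm R (tauOne Q) := by
  rw [flip_oneTau]
  exact adm_oneTau hM0 hMR hx (adm_flip h)

theorem tauTau_eq {M : ℝ} (hM0 : 0 < M) (hMR : M < R) (hx : ∀ ε : G.Dart, ‖x ε‖ ≤ M)
    {Q : G.Series₂} (h : Adm R Q) : tauTau Q = pair Q fun p => tw p.1 * tw p.2 := by
  unfold tauTau
  rw [tau_eq_pair hM0 hMR hx (adm_oneTau hM0 hMR hx h),
    pair_oneTau hM0 hMR hx h (tame_tw hM0 hMR hx)]

/-! #### The adjoint of the Jacobian -/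

/-- The kernel of the adjoint of the free difference quotient. -/
def jacAdjKer (ε : G.Dart) (p : G.Walk × G.Walk) : G.Walk →₀ ℂ :=
  (kap ε : ℂ) • sg (up p.1 * edge ε * up p.2) -
    dsum ε.op (fun α β => t0 β • sg (α * up p.2)) (up p.1) -
    dsum ε.op (fun α β => t0 α • sg (up p.1 * β)) (up p.2)

theorem ev_jacAdjKer (k : G.Walk → ℂ) (ε : G.Dart) (p : G.Walk × G.Walk) :
    ev k (jacAdjKer ε p) = kap ε * ext0 k (up p.1 * edge ε * up p.2) -
      dsum ε.op (fun α β => t0 β * ext0 k (α * up p.2)) (up p.1) -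
      dsum ε.op (fun α β => t0 α * ext0 k (up p.1 * β)) (up p.2) := by
  simp only [jacAdjKer, map_sub, map_smul, ev_sg, map_dsum, smul_eq_mul]

/-- The first term lengthens paths by one edge. In the other two, the detached piece is replaced by
its moment, which is bounded by the weight of that piece once `S` exceeds `S₀`; the number of cuts
is linear in the length. -/
theorem bdd_jacAdjKer (ht : Tame R (tw (G := G))) (ε : G.Dart) : Bdd R (jacAdjKer ε) := by
  obtain ⟨S₀, h0, h1, C, hC, ht⟩ := ht
  refine Bdd.sub (Bdd.sub (Bdd.smul ?_ _) ?_) ?_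
  · refine bdd_of_le_pow fun S hS _ => ⟨S, hS.le, fun p => ?_⟩
    rw [← pow_succ']
    refine wnorm_sg_le hS.le _ _ fun c hc => ?_
    rw [(src_tgt_length_of_cut hc).2.2.1]
    simp only [len_prod, len_walk]
  · refine bdd_of_le_len_mul_pow h1 fun S hS hS0 hSR => ⟨C * S⁻¹, by positivity, fun p => ?_⟩
    refine (wnorm_dsum_le hS.le (B := C * S⁻¹ * S ^ len p) (by positivity) _ _ _
      fun α β h => ?_).trans ?_
    · refine (wnorm_smul_le _ _ _).trans ?_
      have e1 : wnorm S (sg (up α * up p.2)) ≤ S ^ (α.length + p.2.length) :=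
        wnorm_sg_le hS.le _ _ fun c hc => (src_tgt_length_of_mul hc).2.2.1
      have e2 : ‖t0 (up β)‖ ≤ C * S ^ β.length := (ht β).trans (by
        gcongr
        exact pow_le_pow_left₀ h0.le hS0 _)
      refine (mul_le_mul e2 e1 (wnorm_nonneg hS.le _) (by positivity)).trans_eq ?_
      rw [mul_assoc, ← pow_add, mul_assoc, ← pow_sub_one_bound hS]
      simp only [len_prod, len_walk]
      omega
    · have : (p.1.length : ℝ) ≤ (len p : ℕ) := by
        simp [len_prod, len_walk]
      calc (p.1.length : ℝ) * (C * S⁻¹ * S ^ len p) ≤ (len p : ℕ) * (C * S⁻¹ * S ^ len p) := by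
            gcongr
        _ = _ := by ring
  · refine bdd_of_le_len_mul_pow h1 fun S hS hS0 hSR => ⟨C * S⁻¹, by positivity, fun p => ?_⟩
    refine (wnorm_dsum_le hS.le (B := C * S⁻¹ * S ^ len p) (by positivity) _ _ _
      fun α β h => ?_).trans ?_
    · refine (wnorm_smul_le _ _ _).trans ?_
      have e1 : wnorm S (sg (up p.1 * up β)) ≤ S ^ (p.1.length + β.length) :=
        wnorm_sg_le hS.le _ _ fun c hc => (src_tgt_length_of_mul hc).2.2.1
      have e2 : ‖t0 (up α)‖ ≤ C * S ^ α.length := (ht α).trans (by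
        gcongr
        exact pow_le_pow_left₀ h0.le hS0 _)
      refine (mul_le_mul e2 e1 (wnorm_nonneg hS.le _) (by positivity)).trans_eq ?_
      rw [mul_assoc, ← pow_add, mul_assoc, ← pow_sub_one_bound hS]
      simp only [len_prod, len_walk]
      omega
    · have : (p.2.length : ℝ) ≤ (len p : ℕ) := by
        simp [len_prod, len_walk]
      calc (p.2.length : ℝ) * (C * S⁻¹ * S ^ len p) ≤ (len p : ℕ) * (C * S⁻¹ * S ^ len p) := by
            gcongr
        _ = _ := by ring

/-- The value of the adjoint of the Jacobian. -/
def jacAdj [Fintype E] (Q : G.Mat) : G.Tuple := fun ω γ => ∑ ε, push (jacAdjKer ε) (Q ω ε) γ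

theorem adm_jacAdj [Fintype E] (ht : Tame R (tw (G := G))) {Q : G.Mat}
    (h : ∀ ε φ, Adm R (Q ε φ)) (ω : G.Dart) : Adm R (jacAdj Q ω) :=
  Adm.sum _ fun ε => (h ω ε).push (bdd_jacAdjKer ht ε)

theorem pair_jacAdj [Fintype E] (ht : Tame R (tw (G := G))) {Q : G.Mat}
    (h : ∀ ε φ, Adm R (Q ε φ)) (ω : G.Dart) {k : G.Walk → ℂ} (hk : Tame R k) :
    pair (jacAdj Q ω) k = ∑ ε, pair (Q ω ε) fun p => ev k (jacAdjKer ε p) := by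
  unfold jacAdj
  rw [pair_sum_left _ (fun ε => (h ω ε).push (bdd_jacAdjKer ht ε)) hk]
  exact Finset.sum_congr rfl fun ε _ => pair_push (bdd_jacAdjKer ht ε) (h ω ε) hk

end WeightedGraph
end FreeGraph
end

/-! ### Kernels acting on one tensor leg, and the algebra of matrices. -/

noncomputable section
namespace FreeGraph
open HasLen (len)

section Kernels
variable {X Y Z : Type*}

/-- The tensor product of a kernel with the identity. -/
def tensorKer (K : X → Y →₀ ℂ) (z : X × Z) : Y × Z →₀ ℂ :=
  (K z.1).mapDomain fun y => (y, z.2)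

theorem ev_tensorKer (K : X → Y →₀ ℂ) (k : Y × Z → ℂ) (z : X × Z) :
    ev k (tensorKer K z) = ev (fun y => k (y, z.2)) (K z.1) := by
  simp [ev, tensorKer, Finsupp.linearCombination_mapDomain, Function.comp_def]

theorem wnorm_tensorKer [HasLen Y] [HasLen Z] (K : X → Y →₀ ℂ) (S : ℝ) (z : X × Z) :
    wnorm S (tensorKer K z) = wnorm S (K z.1) * S ^ len z.2 := by
  have hinj : Function.Injective fun y : Y => (y, z.2) := fun a b h => (Prod.ext_iff.1 h).1
  unfold wnorm tensorKer
  rw [Finsupp.sum_mapDomain_index_inj hinj, Finsupp.sum, Finsupp.sum, Finset.sum_mul]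
  refine Finset.sum_congr rfl fun y _ => ?_
  rw [len_prod, pow_add]; ring

theorem push_tensorKer (K : X → Y →₀ ℂ) (F : X × Z → ℂ) (p : Y × Z)
    (hs : Summable fun z : X × Z => F z * tensorKer K z p) :
    push (tensorKer K) F p = push K (fun x => F (x, p.2)) p.1 := by
  classical
  have key : ∀ x z, (FreeGraph.tensorKer K (x, z) : Y × Z →₀ ℂ) p = if z = p.2 then K x p.1 else 0 := by
    intro x z
    have hinj : Function.Injective fun y : Y => (y, z) := fun a b h => (Prod.ext_iff.1 h).1
    by_cases h : z = p.2
    · subst h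
      rw [if_pos rfl]
      exact Finsupp.mapDomain_apply hinj (K x) p.1
    · rw [if_neg h]
      refine Finsupp.mapDomain_of_notMem_range _ _ ?_
      rintro ⟨y, hy⟩
      exact h (congrArg Prod.snd hy)
  unfold push
  rw [hs.tsum_prod]
  refine tsum_congr fun x => ?_
  rw [tsum_eq_single p.2]
  · rw [key, if_pos rfl]
  · intro z hz
    rw [key, if_neg hz, mul_zero]

variable [HasLen X] [HasLen Y] [HasLen Z] {R : ℝ}

theorem Tame.sub {k k' : X → ℂ} (h : Tame R k) (h' : Tame R k') :
    Tame R (fun x => k x - k' x) := by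
  have := h.add (h'.const_mul (-1))
  simpa [sub_eq_add_neg] using this

theorem pair_sum_right {ι : Type*} (s : Finset ι) {F : X → ℂ} {k : ι → X → ℂ}
    (hF : Adm R F) (hk : ∀ i, Tame R (k i)) :
    pair F (fun x => ∑ i ∈ s, k i x) = ∑ i ∈ s, pair F (k i) := by
  unfold pair
  rw [← Summable.tsum_finsetSum fun i _ => summable_pair hF (hk i)]
  exact tsum_congr fun x => Finset.mul_sum _ _ _

theorem Bdd.tensorKer {K : X → Y →₀ ℂ} (h : Bdd R K) :
    Bdd R (tensorKer K : X × Z → Y × Z →₀ ℂ) := by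
  intro S h0 h1
  obtain ⟨S', h0', h1', C, hC, hK⟩ := h S h0 h1
  refine ⟨max S S', lt_max_of_lt_left h0, max_lt h1 h1', C, hC, fun z => ?_⟩
  rw [wnorm_tensorKer, len_prod, pow_add, ← mul_assoc]
  refine mul_le_mul ((hK _).trans ?_) ?_ (by positivity) (by positivity)
  · gcongr; exact le_max_right _ _
  · gcongr; exact le_max_left _ _

/-- This lets one leg of a difference quotient be differentiated again while the other leg is a
parameter. -/
theorem pair_tensorKer (hR : 0 < R) {K : X → Y →₀ ℂ} (hK : Bdd R K) {F : X × Z → ℂ}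
    (hF : Adm R F) {k : Y × Z → ℂ} (hk : Tame R k) :
    (pair F fun z => ev (fun y => k (y, z.2)) (K z.1)) =
      pair (fun p : Y × Z => push K (fun x => F (x, p.2)) p.1) k := by
  classical
  have : (fun p : Y × Z => push K (fun x => F (x, p.2)) p.1) = push (tensorKer K) F := by
    ext p
    rw [push_tensorKer]
    have := summable_pair hF ((hK.tensorKer (Z := Z)).tame (tame_pi_single hR p))
    simpa only [ev_pi_single] using this
  rw [this, pair_push hK.tensorKer hF hk]
  exact pair_congr fun z => (ev_tensorKer K k z).symm

theorem Tame.ev_left {K : X → Y →₀ ℂ} (hK : Bdd R K) {k : Y × Z → ℂ} (hk : Tame R k) :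
    Tame R fun z : X × Z => ev (fun y => k (y, z.2)) (K z.1) := by
  simpa only [ev_tensorKer] using (hK.tensorKer (Z := Z)).tame hk

theorem Tame.ev_right {K : X → Y →₀ ℂ} (hK : Bdd R K) {k : Z × Y → ℂ} (hk : Tame R k) :
    Tame R fun z : Z × X => ev (fun y => k (z.1, y)) (K z.2) := by
  have h1 : Tame R fun z : Y × Z => k z.swap :=
    hk.comp_equiv (Equiv.prodComm Y Z) fun p => by simp [len_prod, add_comm]
  exact (Tame.ev_left hK h1).comp_equiv (Equiv.prodComm Z X) fun p => by
    simp [len_prod, add_comm]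

end Kernels

namespace WeightedGraph

variable {V E : Type*} [Fintype V] {G : WeightedGraph V E} {R : ℝ}

/-! ### Matrices -/

theorem matMul_apply [Fintype E] (Q Q' : G.Mat) (ε φ : G.Dart) (p : G.Walk × G.Walk) :
    matMul Q Q' ε φ p = ∑ ω, mul₂ (Q ε ω) (Q' ω φ) p := by
  simp [matMul, Finset.sum_apply]

theorem matMul_eq [Fintype E] (Q Q' : G.Mat) (ε φ : G.Dart) :
    matMul Q Q' ε φ = fun p => ∑ ω, mul₂ (Q ε ω) (Q' ω φ) p := funext fun _ => matMul_apply _ _ _ _ _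

/-- All entries of a matrix are summable families. -/
def AdmMat (R : ℝ) (Q : G.Mat) : Prop := ∀ ε φ, Adm R (Q ε φ)

theorem AdmMat.matMul [Fintype E] {Q Q' : G.Mat} (h : AdmMat R Q) (h' : AdmMat R Q') :
    AdmMat R (matMul Q Q') := by
  intro ε φ
  rw [matMul_eq]
  exact Adm.sum _ fun ω => adm_mul₂ (h _ _) (h' _ _)

/-- The entries of a matrix lie in the compression by the diagonal matrix `P`. -/
def IsCompressedMat (Q : G.Mat) : Prop := ∀ ε φ p, Q ε φ p ≠ 0 →
  p.1.src = ε.src ∧ p.1.tgt = φ.src ∧ p.2.src = φ.tgt ∧ p.2.tgt = ε.tgt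

theorem IsCompressedMat.matMul [Fintype E] {Q Q' : G.Mat} (h : IsCompressedMat Q)
    (h' : IsCompressedMat Q') : IsCompressedMat (matMul Q Q') := by
  intro ε φ p hp
  rw [matMul_apply] at hp
  obtain ⟨ω, -, hω⟩ := Finset.exists_ne_zero_of_sum_ne_zero hp
  obtain ⟨i, -, hi⟩ := Finset.exists_ne_zero_of_sum_ne_zero hω
  obtain ⟨j, -, hj⟩ := Finset.exists_ne_zero_of_sum_ne_zero hi
  have h1 := h _ _ _ (left_ne_zero_of_mul hj)
  have h2 := h' _ _ _ (right_ne_zero_of_mul hj)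
  simp only [drop_tgt] at h1 h2
  exact ⟨h1.1, h2.2.1, h2.2.2.1, h1.2.2.2⟩

theorem admMat_P : AdmMat R (P G) := by
  classical
  intro ε φ
  refine adm_of_finite ((Set.finite_singleton (Walk.nil G ε.src, Walk.nil G ε.tgt)).subset ?_)
  intro p hp
  by_contra h
  exact hp (if_neg fun h' => h h'.2)

theorem isCompressedMat_P : IsCompressedMat (P G) := by
  classical
  intro ε φ p hp
  have : ε = φ ∧ p = (Walk.nil G ε.src, Walk.nil G ε.tgt) := by
    by_contra h
    exact hp (if_neg h)
  obtain ⟨rfl, rfl⟩ := this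
  exact ⟨rfl, rfl, rfl, rfl⟩

theorem P_ne_zero {ε φ : G.Dart} {p : G.Walk × G.Walk} (h : P G ε φ p ≠ 0) :
    ε = φ ∧ p = (Walk.nil G ε.src, Walk.nil G ε.tgt) := by
  by_contra h'
  exact h (if_neg h')

theorem P_self (ε : G.Dart) : P G ε ε (Walk.nil G ε.src, Walk.nil G ε.tgt) = 1 :=
  if_pos ⟨rfl, rfl⟩

theorem take_zero (γ : G.Walk) : γ.take 0 = Walk.nil G γ.src := Walk.ext rfl (by simp [Walk.take, Walk.nil])

theorem drop_zero (γ : G.Walk) : γ.drop 0 = γ := Walk.ext rfl (by simp [Walk.drop])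

theorem take_self_length (γ : G.Walk) : γ.take γ.length = γ :=
  Walk.ext rfl (by simp [Walk.take, Walk.length])

theorem drop_self_length (γ : G.Walk) : γ.drop γ.length = Walk.nil G γ.tgt := by
  refine Walk.ext ?_ (by simp [Walk.drop, Walk.length, Walk.nil])
  simp [Walk.drop, Walk.length, Walk.nil, Walk.tgt]

theorem P_matMul [Fintype E] {Q : G.Mat} (h : IsCompressedMat Q) : matMul (P G) Q = Q := by
  ext ε φ p
  rw [matMul_apply, Finset.sum_eq_single ε]
  · unfold mul₂
    -- The unit consists of paths of length zero. It sits at the start of the first leg and, by the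
    -- opposite product, at the end of the second.
    rw [Finset.sum_eq_single 0, Finset.sum_eq_single p.2.length]
    · rw [take_zero, drop_zero, drop_self_length, take_self_length]
      by_cases hp : Q ε φ p = 0
      · rw [hp, mul_zero]
      · obtain ⟨h1, -, -, h4⟩ := h _ _ _ hp
        rw [h1, h4, P_self, one_mul]
    · intro j hj hne
      have hj' : j ≤ p.2.length := by simpa [Nat.lt_succ_iff] using hj
      by_contra hc
      have h2 := congrArg (fun q : G.Walk × G.Walk => q.2.length) (P_ne_zero (left_ne_zero_of_mul hc)).2
      simp only [drop_length] at h2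
      change p.2.length - j = 0 at h2
      omega
    · intro hj; exact absurd (Finset.mem_range.2 (Nat.lt_succ_self _)) hj
    · intro i hi hne
      have hi' : i ≤ p.1.length := by simpa [Nat.lt_succ_iff] using hi
      refine Finset.sum_eq_zero fun j _ => ?_
      by_contra hc
      have h2 := congrArg (fun q : G.Walk × G.Walk => q.1.length) (P_ne_zero (left_ne_zero_of_mul hc)).2
      simp only [take_length _ hi'] at h2
      exact hne h2
    · intro hj; exact absurd (Finset.mem_range.2 (Nat.succ_pos _)) hj
  · intro ω _ hω
    refine Finset.sum_eq_zero fun i _ => Finset.sum_eq_zero fun j _ => ?_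
    by_contra hc
    exact hω (P_ne_zero (left_ne_zero_of_mul hc)).1.symm
  · intro hε; exact absurd (Finset.mem_univ _) hε

theorem matMul_P [Fintype E] {Q : G.Mat} (h : IsCompressedMat Q) : matMul Q (P G) = Q := by
  ext ε φ p
  rw [matMul_apply, Finset.sum_eq_single φ]
  · unfold mul₂
    rw [Finset.sum_eq_single p.1.length, Finset.sum_eq_single 0]
    · rw [take_zero, drop_zero, drop_self_length, take_self_length]
      by_cases hp : Q ε φ p = 0
      · rw [hp, zero_mul]
      · obtain ⟨-, h2, h3, -⟩ := h _ _ _ hp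
        rw [h2, h3, P_self, mul_one]
    · intro j hj hne
      have hj' : j ≤ p.2.length := by simpa [Nat.lt_succ_iff] using hj
      by_contra hc
      have h2 := congrArg (fun q : G.Walk × G.Walk => q.2.length) (P_ne_zero (right_ne_zero_of_mul hc)).2
      simp only [take_length _ hj'] at h2
      exact hne h2
    · intro hj; exact absurd (Finset.mem_range.2 (Nat.succ_pos _)) hj
    · intro i hi hne
      have hi' : i ≤ p.1.length := by simpa [Nat.lt_succ_iff] using hi
      refine Finset.sum_eq_zero fun j _ => ?_
      by_contra hc
      have h2 := congrArg (fun q : G.Walk × G.Walk => q.1.length) (P_ne_zero (right_ne_zero_of_mul hc)).2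
      simp only [drop_length] at h2
      change p.1.length - i = 0 at h2
      omega
    · intro hj; exact absurd (Finset.mem_range.2 (Nat.lt_succ_self _)) hj
  · intro ω _ hω
    refine Finset.sum_eq_zero fun i _ => Finset.sum_eq_zero fun j _ => ?_
    by_contra hc
    exact hω (P_ne_zero (right_ne_zero_of_mul hc)).1
  · intro hε; exact absurd (Finset.mem_univ _) hε

theorem mul₂_sum_left {ι : Type*} (s : Finset ι) (Q : ι → G.Series₂) (Q' : G.Series₂)
    (p : G.Walk × G.Walk) : mul₂ (fun q => ∑ i ∈ s, Q i q) Q' p = ∑ i ∈ s, mul₂ (Q i) Q' p := by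
  unfold mul₂
  simp only [Finset.sum_mul]
  exact (Finset.sum_congr rfl fun _ _ => Finset.sum_comm).trans Finset.sum_comm

theorem mul₂_sum_right {ι : Type*} (s : Finset ι) (Q' : ι → G.Series₂) (Q : G.Series₂)
    (p : G.Walk × G.Walk) : mul₂ Q (fun q => ∑ i ∈ s, Q' i q) p = ∑ i ∈ s, mul₂ Q (Q' i) p := by
  unfold mul₂
  simp only [Finset.mul_sum]
  exact (Finset.sum_congr rfl fun _ _ => Finset.sum_comm).trans Finset.sum_comm

theorem pair_mul₂_iter {Q Q' : G.Series₂} (h : Adm R Q) (h' : Adm R Q')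
    {k : G.Walk × G.Walk → ℂ} (hk : Tame R k) : pair (mul₂ Q Q') k =
      pair Q fun p => pair Q' fun q => ext2 k (up p.1 * up q.1) (up q.2 * up p.2) := by
  rw [pair_mul₂ h h' hk]
  exact pair_prod h h' (tame_mulTest hk)

theorem mul₂_assoc {Q Q' Q'' : G.Series₂} (hR : 0 < R) (h : Adm R Q) (h' : Adm R Q')
    (h'' : Adm R Q'') : mul₂ (mul₂ Q Q') Q'' = mul₂ Q (mul₂ Q' Q'') := by
  classical
  -- Associativity is checked against test functions, where it reduces to associativity of
  -- concatenation.
  suffices H : ∀ k : G.Walk × G.Walk → ℂ, Tame R k →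
      pair (mul₂ (mul₂ Q Q') Q'') k = pair (mul₂ Q (mul₂ Q' Q'')) k by
    ext r
    have := H _ (tame_pi_single hR r)
    rwa [pair_pi_single, pair_pi_single] at this
  intro k hk
  rw [pair_mul₂_iter (adm_mul₂ h h') h'' hk, pair_mul₂_iter h (adm_mul₂ h' h'') hk]
  refine (pair_mul₂_iter h h' ((tame_mulTest hk).pair_right h'')).trans ?_
  refine pair_congr fun p => ?_
  refine Eq.trans ?_ (pair_mul₂_iter h' h'' ((tame_mulTest hk).slice p)).symm
  refine pair_congr fun q => ?_
  have e1 := ext2_fun_up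
    (fun u w => pair Q'' fun s => ext2 k (u * up s.1) (up s.2 * w))
    (fun w => by simp [pair_zero_right]) (fun w => by simp [pair_zero_right])
    (up p.1 * up q.1) (up q.2 * up p.2)
  refine e1.trans (pair_congr fun s => ?_)
  have e2 := ext2_fun_up (fun u w => ext2 k (up p.1 * u) (w * up p.2))
    (fun w => by simp) (fun w => by simp) (up q.1 * up s.1) (up s.2 * up q.2)
  refine Eq.trans ?_ e2.symm
  simp only [mul_assoc]

theorem matMul_assoc [Fintype E] (hR : 0 < R) {Q Q' Q'' : G.Mat} (h : AdmMat R Q)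
    (h' : AdmMat R Q') (h'' : AdmMat R Q'') :
    matMul (matMul Q Q') Q'' = matMul Q (matMul Q' Q'') := by
  ext ε φ p
  rw [matMul_apply, matMul_apply]
  simp only [matMul_eq, mul₂_sum_left, mul₂_sum_right]
  rw [Finset.sum_comm]
  refine Finset.sum_congr rfl fun ω _ => Finset.sum_congr rfl fun χ _ => ?_
  rw [mul₂_assoc hR (h _ _) (h' _ _) (h'' _ _)]

theorem admMat_matPow [Fintype E] {Q : G.Mat} (h : AdmMat R Q) (n : ℕ) : AdmMat R (matPow Q n) := by
  induction n with
  | zero => exact admMat_P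
  | succ n ih => exact ih.matMul h

theorem isCompressedMat_matPow [Fintype E] {Q : G.Mat} (h : IsCompressedMat Q) (n : ℕ) :
    IsCompressedMat (matPow Q n) := by
  induction n with
  | zero => exact isCompressedMat_P
  | succ n ih => exact ih.matMul h

theorem matPow_add [Fintype E] (hR : 0 < R) {Q : G.Mat} (h : AdmMat R Q) (hc : IsCompressedMat Q)
    (i k : ℕ) : matMul (matPow Q i) (matPow Q k) = matPow Q (i + k) := by
  induction k with
  | zero => exact matMul_P (isCompressedMat_matPow hc i)
  | succ k ih =>
    change matMul (matPow Q i) (matMul (matPow Q k) Q) = matMul (matPow Q (i + k)) Q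
    rw [← matMul_assoc hR (admMat_matPow h i) (admMat_matPow h k) h, ih]

theorem matPow_one [Fintype E] {Q : G.Mat} (hc : IsCompressedMat Q) : matPow Q 1 = Q := P_matMul hc

/-- Powers are built by multiplication on the right, while cyclic rotation and the action on 𝒥^*
place the extra factor on the left. -/
theorem matMul_matPow [Fintype E] (hR : 0 < R) {Q : G.Mat} (h : AdmMat R Q)
    (hc : IsCompressedMat Q) (n : ℕ) : matMul Q (matPow Q n) = matPow Q (n + 1) := by
  have := matPow_add hR h hc 1 n
  rwa [matPow_one hc, add_comm] at this

end WeightedGraph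
end FreeGraph
end

/-! ### The defect of 𝒥^* under the action, and the cyclic derivative of traces of powers. -/

noncomputable section
namespace FreeGraph
open HasLen (len)

section Iterated
variable {X Y Z : Type*} [HasLen X] [HasLen Y] [HasLen Z] {R : ℝ}

theorem pair_pair_add {F : X → ℂ} {F' : Y → ℂ} (hF : Adm R F) (hF' : Adm R F') {k k' : X → Y → ℂ}
    (hk : Tame R fun z : X × Y => k z.1 z.2) (hk' : Tame R fun z : X × Y => k' z.1 z.2) :
    (pair F fun p => pair F' fun q => k p q + k' p q) =
      (pair F fun p => pair F' fun q => k p q) + pair F fun p => pair F' fun q => k' p q := by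
  rw [← pair_add_right hF (hk.pair_right hF') (hk'.pair_right hF')]
  exact pair_congr fun p => pair_add_right hF' (hk.slice p) (hk'.slice p)

theorem pair_pair_pair_add {F : X → ℂ} {F' : Y → ℂ} {F'' : Z → ℂ} (hF : Adm R F) (hF' : Adm R F')
    (hF'' : Adm R F'') {k k' : X → Y → Z → ℂ}
    (hk : Tame R fun z : X × Y × Z => k z.1 z.2.1 z.2.2)
    (hk' : Tame R fun z : X × Y × Z => k' z.1 z.2.1 z.2.2) :
    (pair F fun p => pair F' fun q => pair F'' fun s => k p q s + k' p q s) =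
      (pair F fun p => pair F' fun q => pair F'' fun s => k p q s) +
        pair F fun p => pair F' fun q => pair F'' fun s => k' p q s := by
  have e : ∀ u : X × Y × Z → ℂ, Tame R u → Tame R fun z : X × Y => pair F'' fun s => u (z.1, z.2, s) := by
    intro u hu
    exact Tame.pair_right (k := fun z : (X × Y) × Z => u (z.1.1, z.1.2, z.2)) hF''
      (hu.comp_equiv (Equiv.prodAssoc X Y Z) fun p => by simp [len_prod, add_assoc])
  rw [← pair_pair_add hF hF' (e _ hk) (e _ hk')]
  refine pair_congr fun p => pair_congr fun q => ?_
  exact pair_add_right hF'' ((hk.slice p).slice q) ((hk'.slice p).slice q)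

theorem pair_pair_pair_rotate {F : X → ℂ} {F' : Y → ℂ} {F'' : Z → ℂ} (hF : Adm R F)
    (hF' : Adm R F') (hF'' : Adm R F'') {k : X → Y → Z → ℂ}
    (hk : Tame R fun z : X × Y × Z => k z.1 z.2.1 z.2.2) :
    (pair F'' fun s => pair F fun p => pair F' fun q => k p q s) =
      pair F fun p => pair F' fun q => pair F'' fun s => k p q s := by
  let e : (Z × X) × Y ≃ X × Y × Z :=
    ⟨fun z => (z.1.2, z.2, z.1.1), fun z => ((z.2.2, z.1), z.2.1), fun _ => rfl, fun _ => rfl⟩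
  have he : Tame R fun z : (Z × X) × Y => k z.1.2 z.2 z.1.1 :=
    hk.comp_equiv e fun z => by simp only [e, len_prod, Equiv.coe_fn_mk]; ring
  refine (pair_comm hF'' hF (he.pair_right hF')).trans (pair_congr fun p => ?_)
  have h2 : Tame R fun z : Z × Y => k p z.2 z.1 :=
    (hk.slice p).comp_equiv (Equiv.prodComm Z Y) fun z => by simp [len_prod, add_comm]
  exact pair_comm hF'' hF' h2

end Iterated

namespace WeightedGraph

variable {V E : Type*} [Fintype V] {G : WeightedGraph V E} {R : ℝ}

theorem dsum_const_zero {A : Type*} [AddCommMonoid A] (ε : G.Dart) (w : G.PWalk) :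
    dsum ε (fun _ _ => (0 : A)) w = 0 := by
  rcases PWalk.cases w with rfl | ⟨γ, rfl⟩
  · simp
  · rw [dsum_eq_sum_cuts, Finset.sum_const_zero]

/-! ### The action of a matrix on the adjoint of the Jacobian -/

/-- The defect between `Q # 𝒥^*(Q')` and `𝒥^*(Q Q')` on elementary tensors. -/
def defectKer (k : G.PWalk → ℂ) (ε : G.Dart) (a b c d : G.PWalk) : ℂ :=
  dsum ε.op (fun α β => t0 (β * a) * k (α * (b * d))) c +
    dsum ε.op (fun α β => t0 (b * α) * k (c * (a * β))) d

/-- For the product of `p` and `q`, the Leibniz rule separates cuts inside `q` from cuts inside `p`.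
The former agree with the action of `p` on the adjoint of `q`; the latter, which occur with a minus
sign in the adjoint of the product, form the defect. -/
theorem ev_act_jacAdjKer (k : G.Walk → ℂ) (ε : G.Dart) (p q : G.Walk × G.Walk) :
    ev (fun η => ext0 k (up p.1 * up η * up p.2)) (jacAdjKer ε q) =
      mulTest (fun r => ev k (jacAdjKer ε r)) (p, q) +
        defectKer (ext0 k) ε (up q.1) (up q.2) (up p.1) (up p.2) := by
  have h1 : ∀ w, ext0 (fun η => ext0 k (up p.1 * up η * up p.2)) w
      = ext0 k (up p.1 * w * up p.2) :=
    ext0_fun_up (fun w => ext0 k (up p.1 * w * up p.2)) (by simp)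
  have h2 := ext2_fun_up (fun u w => (kap ε : ℂ) * ext0 k (u * edge ε * w) -
      dsum ε.op (fun α β => t0 β * ext0 k (α * w)) u -
      dsum ε.op (fun α β => t0 α * ext0 k (u * β)) w)
    (by simp [dsum_const_zero]) (by simp [dsum_const_zero])
    (up p.1 * up q.1) (up q.2 * up p.2)
  simp only [mulTest, ev_jacAdjKer, h1]
  rw [h2, dsum_mul _ _ (by simp) (by simp), dsum_mul _ _ (by simp) (by simp), defectKer]
  simp only [mul_assoc]
  ring

/-- The growth bound comes for free: the defect is a difference of two functions already known to be
tame. -/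
theorem tame_defectKer (ht : Tame R (tw (G := G))) {k : G.Walk → ℂ} (hk : Tame R k) (ε : G.Dart) :
    Tame R fun z : (G.Walk × G.Walk) × G.Walk × G.Walk =>
      defectKer (ext0 k) ε (up z.2.1) (up z.2.2) (up z.1.1) (up z.1.2) := by
  have h1 := Tame.ev_right (bdd_jacAdjKer ht ε) (tame_act hk)
  have h2 := tame_mulTest ((bdd_jacAdjKer ht ε).tame hk)
  have := h1.sub h2
  simpa only [ev_act_jacAdjKer, add_sub_cancel_left] using this

theorem matAct_apply [Fintype E] (Q : G.Mat) (f : G.Tuple) (ω : G.Dart) (γ : G.Walk) :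
    matAct Q f ω γ = ∑ φ, act (Q ω φ) (f φ) γ := by
  simp [matAct, Finset.sum_apply]

theorem pair_matAct_jacAdj [Fintype E] (ht : Tame R (tw (G := G))) {Q Q' : G.Mat}
    (h : AdmMat R Q) (h' : AdmMat R Q') (ω : G.Dart) {k : G.Walk → ℂ} (hk : Tame R k) :
    pair (matAct Q (jacAdj Q') ω) k = pair (jacAdj (matMul Q Q') ω) k +
      ∑ φ, ∑ ε, pair (Q ω φ) fun p => pair (Q' φ ε) fun q =>
        defectKer (ext0 k) ε (up q.1) (up q.2) (up p.1) (up p.2) := by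
  have hJ : ∀ φ, Adm R (jacAdj Q' φ) := adm_jacAdj ht h'
  have e1 : matAct Q (jacAdj Q') ω = fun γ => ∑ φ, act (Q ω φ) (jacAdj Q' φ) γ :=
    funext fun γ => matAct_apply _ _ _ _
  rw [e1, pair_sum_left _ (fun φ => adm_act (h _ _) (hJ φ)) hk, pair_jacAdj ht (h.matMul h') ω hk]
  have e2 : ∀ ε, pair (matMul Q Q' ω ε) (fun p => ev k (jacAdjKer ε p)) =
      ∑ φ, pair (Q ω φ) fun p => pair (Q' φ ε) fun q =>
        mulTest (fun r => ev k (jacAdjKer ε r)) (p, q) := by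
    intro ε
    have htm := (bdd_jacAdjKer ht ε).tame hk
    rw [matMul_eq, pair_sum_left _ (fun φ => adm_mul₂ (h _ _) (h' _ _)) htm]
    exact Finset.sum_congr rfl fun φ _ => pair_mul₂_iter (h _ _) (h' _ _) htm
  simp only [e2]
  rw [Finset.sum_comm, ← Finset.sum_add_distrib]
  refine Finset.sum_congr rfl fun φ _ => ?_
  rw [← Finset.sum_add_distrib, pair_act (h _ _) (hJ φ) hk]
  have e3 : ∀ p : G.Walk × G.Walk, (pair (jacAdj Q' φ) fun η => ext0 k (up p.1 * up η * up p.2)) =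
      ∑ ε, pair (Q' φ ε) fun q => ev (fun η => ext0 k (up p.1 * up η * up p.2)) (jacAdjKer ε q) :=
    fun p => pair_jacAdj ht h' φ ((tame_act hk).slice p)
  simp only [e3]
  rw [pair_sum_right _ (h _ _)]
  · refine Finset.sum_congr rfl fun ε _ => ?_
    rw [← pair_pair_add (h _ _) (h' _ _)
      (tame_mulTest ((bdd_jacAdjKer ht ε).tame hk)) (tame_defectKer ht hk ε)]
    simp only [ev_act_jacAdjKer]
  · intro ε
    exact (Tame.ev_right (bdd_jacAdjKer ht ε) (tame_act hk)).pair_right (h' _ _)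

/-! ### The cyclic derivative of the trace of a product -/

/-- The cyclic derivative of a monomial, with `u` inserted at the place of the cut. -/
def cycKer (k : G.PWalk → ℂ) (ω : G.Dart) (u c : G.PWalk) : ℂ :=
  dsum ω.op (fun α β => k (β * (u * α))) c

/-- The contribution to `𝒟 (1 ⊗ τ + τ ⊗ 1)((a ⊗ b)(c ⊗ d))` of the derivatives of `c` and `d`. -/
def trKer (k : G.PWalk → ℂ) (ω : G.Dart) (a b c d : G.PWalk) : ℂ :=
  t0 (d * b) * cycKer k ω a c + t0 (a * c) * cycKer k ω b d

section trKer
variable (k : G.Walk → ℂ) (ω : G.Dart)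

@[simp] theorem cycKer_zero_left (c : G.PWalk) : cycKer (ext0 k) ω 0 c = 0 := by
  simp [cycKer, dsum_const_zero]

@[simp] theorem cycKer_zero_right (u : G.PWalk) : cycKer (ext0 k) ω u 0 = 0 := rfl

@[simp] theorem trKer_zero₁ (b c d : G.PWalk) : trKer (ext0 k) ω 0 b c d = 0 := by simp [trKer]
@[simp] theorem trKer_zero₂ (a c d : G.PWalk) : trKer (ext0 k) ω a 0 c d = 0 := by simp [trKer]
@[simp] theorem trKer_zero₃ (a b d : G.PWalk) : trKer (ext0 k) ω a b 0 d = 0 := by simp [trKer]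
@[simp] theorem trKer_zero₄ (a b c : G.PWalk) : trKer (ext0 k) ω a b c 0 = 0 := by simp [trKer]

theorem cycKer_mul (u c d : G.PWalk) :
    cycKer (ext0 k) ω u (c * d) = cycKer (ext0 k) ω (d * u) c + cycKer (ext0 k) ω (u * c) d := by
  unfold cycKer
  rw [dsum_mul _ _ (by simp) (by simp)]
  simp only [mul_assoc]

/-- The differentiated factor is a product, so the cut falls in one of its two tensors. Traciality
moves the other around the cycle, to the left or to the right of the undifferentiated tensor. -/
theorem trKer_mul (a b c d e f : G.PWalk) : trKer (ext0 k) ω a b (c * e) (f * d) =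
    trKer (ext0 k) ω (e * a) (b * f) c d + trKer (ext0 k) ω (a * c) (d * b) e f := by
  unfold trKer
  have h1 : t0 (f * d * b) = t0 (d * (b * f)) := by
    rw [mul_assoc, t0_mul_comm, mul_assoc]
  have h2 : t0 (a * (c * e)) = t0 (e * a * c) := by
    rw [← mul_assoc, t0_mul_comm, mul_assoc]
  have h3 : t0 (e * a * c) = t0 (a * c * e) := by rw [← h2, mul_assoc]
  have h4 : t0 (d * (b * f)) = t0 (f * (d * b)) := by rw [← h1, mul_assoc]
  rw [cycKer_mul, cycKer_mul, h1, h2, ← h3, ← h4]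
  ring

/-- Both legs of the product obey the Leibniz rule. Sorting the four terms by the tensor that is cut
gives the two summands, the second being the first with the tensors exchanged. -/
theorem trKer_product (a b c d : G.PWalk) :
    dsum ω.op (fun α β => ext0 k (β * α)) (a * c) * t0 (d * b) +
      t0 (a * c) * dsum ω.op (fun α β => ext0 k (β * α)) (d * b) =
    trKer (ext0 k) ω a b c d + trKer (ext0 k) ω c d a b := by
  unfold trKer cycKer
  rw [dsum_mul _ _ (by simp) (by simp), dsum_mul _ _ (by simp) (by simp), t0_mul_comm c a,
    t0_mul_comm b d]
  simp only [mul_assoc]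
  ring

variable {k}

theorem tame_cycKer (hR : 0 < R) (hk : Tame R k) :
    Tame R fun z : G.Walk × G.Walk => cycKer (ext0 k) ω (up z.1) (up z.2) := by
  let e : G.Walk × G.Walk × G.Walk ≃ (G.Walk × G.Walk) × G.Walk :=
    ⟨fun z => ((z.2.2, z.2.1), z.1), fun z => (z.2, z.1.2, z.1.1), fun _ => rfl, fun _ => rfl⟩
  have h1 := (tame_act hk).comp_equiv e fun z => by
    simp only [e, len_prod, Equiv.coe_fn_mk]; ring
  have h2 := Tame.ev_right (bdd_diffQuot hR ω.op) h1
  refine h2.congr fun z => ?_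
  rw [map_dsum]
  refine dsum_congr _ (fun α β => ?_) _
  rw [ev_sg2]
  exact (ext2_fun_up (fun α β => ext0 k (β * up z.1 * α)) (by simp) (by simp) α β).trans
    (by rw [mul_assoc])

theorem tame_t0_mul (ht : Tame R (tw (G := G))) :
    Tame R fun z : G.Walk × G.Walk => t0 (up z.1 * up z.2) := by
  have := (bdd_multiply (G := G)).tame ht
  simp only [ev_sg] at this
  exact this

theorem tame_trKer (hR : 0 < R) (ht : Tame R (tw (G := G))) (hk : Tame R k) :
    Tame R fun z : (G.Walk × G.Walk) × G.Walk × G.Walk =>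
      trKer (ext0 k) ω (up z.1.1) (up z.1.2) (up z.2.1) (up z.2.2) := by
  have h := (tame_t0_mul ht).prod (tame_cycKer ω hR hk)
  let e : (G.Walk × G.Walk) × G.Walk × G.Walk ≃ (G.Walk × G.Walk) × G.Walk × G.Walk :=
    ⟨fun z => ((z.2.2, z.1.2), (z.1.1, z.2.1)), fun z => ((z.2.1, z.1.2), (z.2.2, z.1.1)),
      fun _ => rfl, fun _ => rfl⟩
  let e' : (G.Walk × G.Walk) × G.Walk × G.Walk ≃ (G.Walk × G.Walk) × G.Walk × G.Walk :=
    ⟨fun z => ((z.1.1, z.2.1), (z.1.2, z.2.2)), fun z => ((z.1.1, z.2.1), (z.1.2, z.2.2)),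
      fun _ => rfl, fun _ => rfl⟩
  exact (h.comp_equiv e fun z => by simp only [e, len_prod, Equiv.coe_fn_mk]; ring).add
    (h.comp_equiv e' fun z => by simp only [e', len_prod, Equiv.coe_fn_mk]; ring)

theorem tame_trKer_mul_left (hR : 0 < R) (ht : Tame R (tw (G := G))) (hk : Tame R k) :
    Tame R fun z : ((G.Walk × G.Walk) × G.Walk × G.Walk) × G.Walk × G.Walk =>
      trKer (ext0 k) ω (up z.1.1.1 * up z.1.2.1) (up z.1.2.2 * up z.1.1.2) (up z.2.1) (up z.2.2) := by
  refine (Tame.ev_left bdd_mulKer (tame_trKer ω hR ht hk)).congr fun z => ?_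
  rw [mulKer, ev_sg2]
  exact ext2_fun_up (fun u w => trKer (ext0 k) ω u w (up z.2.1) (up z.2.2)) (by simp) (by simp) _ _

end trKer

/-- The pairing of two matrices against `trKer`. -/
def trPair [Fintype E] (k : G.Walk → ℂ) (ω : G.Dart) (Q Q' : G.Mat) : ℂ :=
  ∑ ε, ∑ φ, pair (Q ε φ) fun p => pair (Q' φ ε) fun q =>
    trKer (ext0 k) ω (up p.1) (up p.2) (up q.1) (up q.2)

section trPair
variable [Fintype E] {k : G.Walk → ℂ} (ω : G.Dart)

theorem trPair_matMul_left (hR : 0 < R) (ht : Tame R (tw (G := G))) (hk : Tame R k)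
    {A B C : G.Mat} (hA : AdmMat R A) (hB : AdmMat R B) (hC : AdmMat R C) :
    trPair k ω (matMul A B) C = ∑ ε, ∑ φ, ∑ χ, pair (A ε χ) fun s => pair (B χ φ) fun p =>
      pair (C φ ε) fun q =>
        trKer (ext0 k) ω (up s.1 * up p.1) (up p.2 * up s.2) (up q.1) (up q.2) := by
  unfold trPair
  refine Finset.sum_congr rfl fun ε _ => Finset.sum_congr rfl fun φ _ => ?_
  have htm := (tame_trKer ω hR ht hk).pair_right (hC φ ε)
  rw [matMul_eq]
  refine (pair_sum_left _ (fun χ => adm_mul₂ (hA _ _) (hB _ _)) htm).trans ?_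
  refine Finset.sum_congr rfl fun χ _ => ?_
  refine (pair_mul₂_iter (hA _ _) (hB _ _) htm).trans ?_
  refine pair_congr fun s => pair_congr fun p => ?_
  exact ext2_fun_up (fun u w => pair (C φ ε) fun q => trKer (ext0 k) ω u w (up q.1) (up q.2))
    (by simp [pair_zero_right]) (by simp [pair_zero_right]) _ _

/-- The matrix form of `trKer_mul`: `trPair` is a derivation in its second argument, with the
untouched factor rotated into the first. -/
theorem trPair_matMul_right (hR : 0 < R) (ht : Tame R (tw (G := G))) (hk : Tame R k)
    {A B C : G.Mat} (hA : AdmMat R A) (hB : AdmMat R B) (hC : AdmMat R C) :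
    trPair k ω A (matMul B C) = trPair k ω (matMul C A) B + trPair k ω (matMul A B) C := by
  rw [trPair_matMul_left ω hR ht hk hC hA hB, trPair_matMul_left ω hR ht hk hA hB hC]
  have e1 : trPair k ω A (matMul B C) = ∑ ε, ∑ φ, ∑ χ, pair (A ε φ) fun p => pair (B φ χ) fun q =>
      pair (C χ ε) fun s =>
        (trKer (ext0 k) ω (up s.1 * up p.1) (up p.2 * up s.2) (up q.1) (up q.2) +
        trKer (ext0 k) ω (up p.1 * up q.1) (up q.2 * up p.2) (up s.1) (up s.2)) := by
    unfold trPair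
    refine Finset.sum_congr rfl fun ε _ => Finset.sum_congr rfl fun φ _ => ?_
    have htk := tame_trKer ω hR ht hk
    have htm : ∀ χ, Tame R fun p : G.Walk × G.Walk => pair (mul₂ (B φ χ) (C χ ε)) fun r =>
        trKer (ext0 k) ω (up p.1) (up p.2) (up r.1) (up r.2) :=
      fun χ => htk.pair_right (adm_mul₂ (hB _ _) (hC _ _))
    have e2 : ∀ p : G.Walk × G.Walk, (pair (matMul B C φ ε) fun r =>
        trKer (ext0 k) ω (up p.1) (up p.2) (up r.1) (up r.2)) =
        ∑ χ, pair (mul₂ (B φ χ) (C χ ε)) fun r =>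
          trKer (ext0 k) ω (up p.1) (up p.2) (up r.1) (up r.2) := by
      intro p
      rw [matMul_eq]
      exact pair_sum_left _ (fun χ => adm_mul₂ (hB _ _) (hC _ _)) (htk.slice p)
    simp only [e2]
    rw [pair_sum_right _ (hA _ _) htm]
    refine Finset.sum_congr rfl fun χ _ => pair_congr fun p => ?_
    refine (pair_mul₂_iter (hB _ _) (hC _ _) (htk.slice p)).trans ?_
    refine pair_congr fun q => pair_congr fun s => ?_
    rw [← trKer_mul]
    exact ext2_fun_up (fun u w => trKer (ext0 k) ω (up p.1) (up p.2) u w) (by simp) (by simp) _ _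
  rw [e1]
  let i1 : (G.Walk × G.Walk) × (G.Walk × G.Walk) × G.Walk × G.Walk ≃
      ((G.Walk × G.Walk) × G.Walk × G.Walk) × G.Walk × G.Walk :=
    ⟨fun z => ((z.2.2, z.1), z.2.1), fun z => (z.1.2, z.2, z.1.1), fun _ => rfl, fun _ => rfl⟩
  have ht1 := (tame_trKer_mul_left ω hR ht hk).comp_equiv i1 fun z => by
    simp only [i1, len_prod, Equiv.coe_fn_mk]; ring
  have ht2 := (tame_trKer_mul_left ω hR ht hk).comp_equiv
    (Equiv.prodAssoc (G.Walk × G.Walk) (G.Walk × G.Walk) (G.Walk × G.Walk)).symm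
    fun z => by simp only [len_prod, Equiv.prodAssoc_symm_apply]; ring
  have e3 : ∀ ε φ χ, (pair (A ε φ) fun p => pair (B φ χ) fun q => pair (C χ ε) fun s =>
        (trKer (ext0 k) ω (up s.1 * up p.1) (up p.2 * up s.2) (up q.1) (up q.2) +
        trKer (ext0 k) ω (up p.1 * up q.1) (up q.2 * up p.2) (up s.1) (up s.2))) =
      (pair (C χ ε) fun s => pair (A ε φ) fun p => pair (B φ χ) fun q =>
        trKer (ext0 k) ω (up s.1 * up p.1) (up p.2 * up s.2) (up q.1) (up q.2)) +
      pair (A ε φ) fun p => pair (B φ χ) fun q => pair (C χ ε) fun s =>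
        trKer (ext0 k) ω (up p.1 * up q.1) (up q.2 * up p.2) (up s.1) (up s.2) := by
    intro ε φ χ
    refine (pair_pair_pair_add (hA _ _) (hB _ _) (hC _ _) ht1 ht2).trans ?_
    refine congrArg₂ _ ?_ rfl
    exact (pair_pair_pair_rotate (hA _ _) (hB _ _) (hC _ _) ht1).symm
  simp only [e3, Finset.sum_add_distrib]
  refine congrArg₂ _ ?_ ?_
  -- The three indices form a cycle, and rotating `C` to the front only renames them.
  · rw [Finset.sum_comm]
    refine (Finset.sum_congr rfl fun φ _ => Finset.sum_comm).trans ?_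
    rw [Finset.sum_comm]
  · exact Finset.sum_congr rfl fun ε _ => Finset.sum_comm

/-- The entries of the unit are paths of length zero, which have no edge to cut. -/
theorem trPair_P (A : G.Mat) : trPair k ω A (P G) = 0 := by
  unfold trPair
  refine Finset.sum_eq_zero fun ε _ => Finset.sum_eq_zero fun φ _ => ?_
  have hz : ∀ p : G.Walk × G.Walk, (pair (P G φ ε) fun q =>
      trKer (ext0 k) ω (up p.1) (up p.2) (up q.1) (up q.2)) = 0 := by
    intro p
    refine (tsum_congr fun q => ?_).trans tsum_zero
    by_cases hq : P G φ ε q = 0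
    · rw [hq, zero_mul]
    · rw [(P_ne_zero hq).2]
      have hn : ∀ (u : G.PWalk) (v : V), cycKer (ext0 k) ω u (up (Walk.nil G v)) = 0 := by
        intro u v
        unfold cycKer
        rw [dsum_up]
        rfl
      simp only [trKer, hn, mul_zero, add_zero]
  simp only [hz, pair_zero_right]

/-- By the derivation property, each of the `n` factors contributes the same term, namely the one
where that factor alone is differentiated and all others are collected in order. -/
theorem trPair_matPow (hR : 0 < R) (ht : Tame R (tw (G := G))) (hk : Tame R k) {A : G.Mat}
    (hA : AdmMat R A) (hc : IsCompressedMat A) (n : ℕ) : ∀ i : ℕ,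
    trPair k ω (matPow A (i + 1)) (matPow A n) = n * trPair k ω (matPow A (i + n)) A := by
  induction n with
  | zero => intro i; rw [Nat.cast_zero, zero_mul]; exact trPair_P ω _
  | succ n ih =>
    intro i
    have h := admMat_matPow hA
    -- Splitting off the last factor `A`: either the first `n` factors are differentiated and `A`
    -- joins the left power, or `A` itself is differentiated.
    have e := trPair_matMul_right ω hR ht hk (h (i + 1)) (h n) hA
    rw [matMul_matPow hR hA hc, matPow_add hR hA hc, ih (i + 1)] at e
    change trPair k ω (matPow A (i + 1)) (matMul (matPow A n) A) = _
    rw [e, show i + 1 + n = i + (n + 1) by ring]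
    push_cast
    ring

theorem matTr_matMul (A B : G.Mat) :
    matTr (matMul A B) = fun p => ∑ ε, ∑ φ, mul₂ (A ε φ) (B φ ε) p := by
  ext p
  simp only [matTr, Finset.sum_apply, matMul_apply]

theorem adm_matTr {A : G.Mat} (h : AdmMat R A) : Adm R (matTr A) := by
  have : matTr A = fun p => ∑ ε, A ε ε p := by ext p; simp [matTr, Finset.sum_apply]
  rw [this]
  exact Adm.sum _ fun ε => h ε ε

theorem pair_cyclicDeriv_trace {M : ℝ} (hM0 : 0 < M) (hMR : M < R) (hx : ∀ ε : G.Dart, ‖x ε‖ ≤ M)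
    {A B : G.Mat} (hA : AdmMat R A) (hB : AdmMat R B) (hk : Tame R k) :
    pair (cyclicDeriv ω (oneTau (matTr (matMul A B)) + tauOne (matTr (matMul A B)))) k =
      trPair k ω A B + trPair k ω B A := by
  have hR := hM0.trans hMR
  have ht := tame_tw hM0 hMR hx
  have hT := adm_matTr (hA.matMul hB)
  have h1 := adm_oneTau hM0 hMR hx hT
  have h2 := adm_tauOne hM0 hMR hx hT
  have hcyc := tame_cyc hR ω hk
  have htk := tame_trKer ω hR ht hk
  have htk' := htk.comp_equiv (Equiv.prodComm (G.Walk × G.Walk) (G.Walk × G.Walk))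
    fun z => by simp [len_prod, add_comm, add_left_comm]
  have hsum : Tame R fun p : G.Walk × G.Walk =>
      dsum ω.op (fun α β => ext0 k (β * α)) (up p.1) * tw p.2 +
        tw p.1 * dsum ω.op (fun α β => ext0 k (β * α)) (up p.2) :=
    (hcyc.prod ht).add (ht.prod hcyc)
  refine (pair_cyclicDeriv hR ω (h1.add h2) hk).trans ?_
  refine (pair_add_left h1 h2 hcyc).trans ?_
  rw [pair_oneTau hM0 hMR hx hT hcyc, pair_tauOne hM0 hMR hx hT hcyc,
    ← pair_add_right hT (hcyc.prod ht) (ht.prod hcyc), matTr_matMul]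
  rw [pair_sum_left _ (fun ε => Adm.sum _ fun φ => adm_mul₂ (hA _ _) (hB _ _)) hsum]
  have e1 : ∀ ε φ, pair (mul₂ (A ε φ) (B φ ε)) (fun p : G.Walk × G.Walk =>
      dsum ω.op (fun α β => ext0 k (β * α)) (up p.1) * tw p.2 +
        tw p.1 * dsum ω.op (fun α β => ext0 k (β * α)) (up p.2)) =
      (pair (A ε φ) fun p => pair (B φ ε) fun q =>
        trKer (ext0 k) ω (up p.1) (up p.2) (up q.1) (up q.2)) +
      (pair (B φ ε) fun q => pair (A ε φ) fun p =>
        trKer (ext0 k) ω (up q.1) (up q.2) (up p.1) (up p.2)) := by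
    intro ε φ
    refine (pair_mul₂_iter (hA _ _) (hB _ _) hsum).trans ?_
    rw [pair_comm (hB φ ε) (hA ε φ) htk]
    refine Eq.trans ?_ (pair_pair_add (hA ε φ) (hB φ ε) htk htk')
    refine pair_congr fun p => pair_congr fun q => ?_
    refine (ext2_fun_up (fun u w => dsum ω.op (fun α β => ext0 k (β * α)) u * t0 w +
        t0 u * dsum ω.op (fun α β => ext0 k (β * α)) w) (by simp) (by simp) _ _).trans ?_
    exact trKer_product k ω _ _ _ _
  have e2 : ∀ ε, pair (fun p => ∑ φ, mul₂ (A ε φ) (B φ ε) p) (fun p : G.Walk × G.Walk =>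
      dsum ω.op (fun α β => ext0 k (β * α)) (up p.1) * tw p.2 +
        tw p.1 * dsum ω.op (fun α β => ext0 k (β * α)) (up p.2)) = _ :=
    fun ε => (pair_sum_left _ (fun φ => adm_mul₂ (hA _ _) (hB _ _)) hsum).trans
      (Finset.sum_congr rfl fun φ _ => e1 ε φ)
  simp only [e2, Finset.sum_add_distrib]
  unfold trPair
  refine congrArg₂ _ rfl ?_
  exact Finset.sum_comm

end trPair

end WeightedGraph
end FreeGraph
end

/-! ### Cyclic symmetry of second derivatives, the adjoint relation, and supports. -/

noncomputable section
namespace FreeGraph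
namespace WeightedGraph
open HasLen (len)

variable {V E : Type*} [Fintype V] {G : WeightedGraph V E} {R : ℝ}

/-! ### The Jacobian of a cyclic gradient -/

/-- The coefficient at `w` collects all rotations of `w` in which the removed edge is put back at
the junction. -/
theorem ext0_cyclicDeriv (ε : G.Dart) (g : G.Series) (w : G.PWalk) :
    ext0 (cyclicDeriv ε g) w = ssum (fun u v => ext0 g (v * edge ε.op * u)) w := by
  rcases PWalk.cases w with rfl | ⟨γ, rfl⟩
  · exact (ssum_zero (A := ℂ) _).symm
  · rw [ext0_up, ssum_up]
    change ∑ i ∈ Finset.range (γ.length + 1), diffQuot ε.op g (γ.drop i, γ.take i) = _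
    refine Finset.sum_congr rfl fun i _ => ?_
    exact diffQuot_eq _ _ _

/-- The cyclic symmetry of the second order cyclic derivatives. -/
theorem ext0_cyclicDeriv_cyclic (φ ω : G.Dart) (g : G.Series) (a w : G.PWalk) :
    ext0 (cyclicDeriv φ g) (a * edge ω.op * w) = ext0 (cyclicDeriv ω g) (w * edge φ.op * a) := by
  -- On either side the rotation point lies in `a` or in `w`. The two sums are the same, in opposite
  -- order.
  rw [ext0_cyclicDeriv, ext0_cyclicDeriv, ssum_mul_edge_mul _ _ (by simp) (by simp),
    ssum_mul_edge_mul _ _ (by simp) (by simp), add_comm]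
  simp only [mul_assoc]

/-- Cutting one leg of a difference quotient again amounts to reading the coefficients of `f` at
paths made of three pieces and two marked edges. In this form second derivatives can be compared. -/
theorem pair_diffQuot_cut_left (hR : 0 < R) (ε ω : G.Dart) {f : G.Series} (hf : Adm R f)
    {k : (G.Walk × G.Walk) × G.Walk → ℂ} (hk : Tame R k) :
    (pair (diffQuot ε f) fun q => dsum ω (ext2 fun r => k (r, q.2)) (up q.1)) =
      pair (fun z : (G.Walk × G.Walk) × G.Walk =>
        ext0 f (up z.1.1 * edge ω * up z.1.2 * edge ε * up z.2)) k := by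
  have h := pair_tensorKer hR (bdd_diffQuot hR ω) (adm_diffQuot hR ε hf) hk
  simp only [map_dsum, ev_sg2, ← diffQuot_eq_push] at h
  refine h.trans ?_
  congr 1
  ext z
  rw [diffQuot_eq]
  simp only [diffQuot_eq]
  exact ext0_fun_up (fun u => ext0 f (u * edge ε * up z.2)) (by simp) _

theorem pair_diffQuot_cut_right (hR : 0 < R) (ε ω : G.Dart) {f : G.Series} (hf : Adm R f)
    {k : (G.Walk × G.Walk) × G.Walk → ℂ} (hk : Tame R k) :
    (pair (diffQuot ε f) fun q => dsum ω (ext2 fun r => k (r, q.1)) (up q.2)) =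
      pair (fun z : (G.Walk × G.Walk) × G.Walk =>
        ext0 f (up z.2 * edge ε * (up z.1.1 * edge ω * up z.1.2))) k := by
  have h := pair_tensorKer hR (bdd_diffQuot hR ω) (adm_flip (adm_diffQuot hR ε hf)) hk
  simp only [map_dsum, ev_sg2, ← diffQuot_eq_push] at h
  rw [← pair_comp_equiv (Equiv.prodComm G.Walk G.Walk)]
  refine h.trans ?_
  congr 1
  ext z
  rw [diffQuot_eq]
  simp only [flip, diffQuot_eq]
  exact ext0_fun_up (fun u => ext0 f (up z.2 * edge ε * u)) (by simp) _

/-- Rotation of three paths. -/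
def rotEquiv : (G.Walk × G.Walk) × G.Walk ≃ (G.Walk × G.Walk) × G.Walk :=
  ⟨fun z => ((z.2, z.1.1), z.1.2), fun z => ((z.1.2, z.2), z.1.1), fun _ => rfl, fun _ => rfl⟩

theorem tame_t0_mul_ext0 (ht : Tame R (tw (G := G))) {k : G.Walk → ℂ} (hk : Tame R k)
    (a b : G.Walk) : Tame R fun z : (G.Walk × G.Walk) × G.Walk =>
      t0 (up z.2 * up b) * ext0 k (up z.1.2 * up a * up z.1.1) := by
  have h1 := (tame_t0_mul ht).slice_left b
  have h2 : Tame R fun p : G.Walk × G.Walk => ext0 k (up p.2 * up a * up p.1) :=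
    ((tame_act hk).slice_left a).comp_equiv (Equiv.prodComm _ _) len_swap
  simpa only [mul_comm] using h2.prod h1

theorem len_rotEquiv (z : (G.Walk × G.Walk) × G.Walk) : len (rotEquiv z) = len z := by
  simp only [rotEquiv, len_prod, Equiv.coe_fn_mk]
  ring

/-- This is where the cyclic gradient is used. A cut of the left leg in row φ at ω^op and a cut of
the right leg in row ω at φ^op read the same coefficients, up to a rotation of the three pieces. -/
theorem pair_jac_first (hR : 0 < R) (ht : Tame R (tw (G := G))) {k : G.Walk → ℂ} (hk : Tame R k)
    {g : G.Series} (hg : Adm R g) (ε φ ω : G.Dart) (a b : G.Walk) :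
    (pair (jac (cyclicGrad g) φ ε) fun q => t0 (up q.2 * up b) * cycKer (ext0 k) ω (up a) (up q.1)) =
      pair (jac (cyclicGrad g) ω ε) fun q =>
        dsum φ.op (fun α β => t0 (up b * α) * ext0 k (up q.1 * (up a * β))) (up q.2) := by
  have hT := tame_t0_mul_ext0 ht hk a b
  have h1 := pair_diffQuot_cut_left hR ε ω.op (adm_cyclicDeriv hR φ hg) hT
  have h2 := pair_diffQuot_cut_right hR ε φ.op (adm_cyclicDeriv hR ω hg)
    (hT.comp_equiv rotEquiv.symm fun z => by
      rw [← len_rotEquiv, Equiv.apply_symm_apply])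
  have e1 : ∀ q : G.Walk × G.Walk, t0 (up q.2 * up b) * cycKer (ext0 k) ω (up a) (up q.1) =
      dsum ω.op (ext2 fun r => t0 (up q.2 * up b) * ext0 k (up r.2 * up a * up r.1)) (up q.1) := by
    intro q
    unfold cycKer
    rw [mul_dsum]
    refine dsum_congr _ (fun α β => ?_) _
    refine Eq.trans ?_ (ext2_fun_up
      (fun α β => t0 (up q.2 * up b) * ext0 k (β * up a * α)) (by simp) (by simp) α β).symm
    rw [mul_assoc β]
  have e2 : ∀ q : G.Walk × G.Walk,
      dsum φ.op (fun α β => t0 (up b * α) * ext0 k (up q.1 * (up a * β))) (up q.2) =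
      dsum φ.op (ext2 fun r => t0 (up r.1 * up b) * ext0 k (up q.1 * up a * up r.2)) (up q.2) := by
    intro q
    refine dsum_congr _ (fun α β => ?_) _
    refine Eq.trans ?_ (ext2_fun_up
      (fun α β => t0 (α * up b) * ext0 k (up q.1 * up a * β)) (by simp) (by simp) α β).symm
    rw [mul_assoc (up q.1), t0_mul_comm α]
  simp only [e1, e2]
  refine h1.trans (Eq.trans ?_ h2.symm)
  rw [← pair_comp_equiv rotEquiv.symm]
  congr 1
  ext z
  change ext0 _ (up z.1.2 * edge ω.op * up z.2 * edge ε * up z.1.1) = _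
  -- The marked edge ε belongs to the second of the two arcs of the cyclic word.
  have := ext0_cyclicDeriv_cyclic φ ω g (up z.1.2) (up z.2 * edge ε * up z.1.1)
  simp only [mul_assoc] at this ⊢
  exact this

/-- The mirror image of `pair_jac_first`, with the legs exchanged. -/
theorem pair_jac_second (hR : 0 < R) (ht : Tame R (tw (G := G))) {k : G.Walk → ℂ} (hk : Tame R k)
    {g : G.Series} (hg : Adm R g) (ε φ ω : G.Dart) (a b : G.Walk) :
    (pair (jac (cyclicGrad g) φ ε) fun q => t0 (up a * up q.1) * cycKer (ext0 k) ω (up b) (up q.2)) =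
      pair (jac (cyclicGrad g) ω ε) fun q =>
        dsum φ.op (fun α β => t0 (β * up a) * ext0 k (α * (up b * up q.2))) (up q.1) := by
  have hT := tame_t0_mul_ext0 ht hk b a
  have h1 := pair_diffQuot_cut_right hR ε ω.op (adm_cyclicDeriv hR φ hg) hT
  have h2 := pair_diffQuot_cut_left hR ε φ.op (adm_cyclicDeriv hR ω hg)
    (hT.comp_equiv rotEquiv len_rotEquiv)
  have e1 : ∀ q : G.Walk × G.Walk, t0 (up a * up q.1) * cycKer (ext0 k) ω (up b) (up q.2) =
      dsum ω.op (ext2 fun r => t0 (up q.1 * up a) * ext0 k (up r.2 * up b * up r.1)) (up q.2) := by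
    intro q
    unfold cycKer
    rw [mul_dsum]
    refine dsum_congr _ (fun α β => ?_) _
    refine Eq.trans ?_ (ext2_fun_up
      (fun α β => t0 (up q.1 * up a) * ext0 k (β * up b * α)) (by simp) (by simp) α β).symm
    rw [mul_assoc β, t0_mul_comm]
  have e2 : ∀ q : G.Walk × G.Walk,
      dsum φ.op (fun α β => t0 (β * up a) * ext0 k (α * (up b * up q.2))) (up q.1) =
      dsum φ.op (ext2 fun r => t0 (up r.2 * up a) * ext0 k (up r.1 * up b * up q.2)) (up q.1) := by
    intro q
    refine dsum_congr _ (fun α β => ?_) _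
    refine Eq.trans ?_ (ext2_fun_up
      (fun α β => t0 (β * up a) * ext0 k (α * up b * up q.2)) (by simp) (by simp) α β).symm
    rw [mul_assoc α]
  simp only [e1, e2]
  refine h1.trans (Eq.trans ?_ h2.symm)
  rw [← pair_comp_equiv rotEquiv]
  congr 1
  ext z
  change ext0 _ (up z.1.2 * edge ε * (up z.2 * edge ω.op * up z.1.1)) = _
  have := ext0_cyclicDeriv_cyclic φ ω g (up z.1.2 * edge ε * up z.2) (up z.1.1)
  simp only [mul_assoc] at this ⊢
  exact this

theorem admMat_jac (hR : 0 < R) {f : G.Tuple} (h : ∀ ε, Adm R (f ε)) : AdmMat R (jac f) :=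
  fun ε φ => adm_diffQuot hR φ (h ε)

theorem adm_cyclicGrad (hR : 0 < R) {g : G.Series} (h : Adm R g) (ε : G.Dart) :
    Adm R (cyclicGrad g ε) := adm_cyclicDeriv hR ε h

/-- The two summands of `trKer` become, by `pair_jac_first` and `pair_jac_second`, the two summands
of `defectKer`, in the other order. -/
theorem trPair_jac_cyclicGrad [Fintype E] (hR : 0 < R) (ht : Tame R (tw (G := G)))
    {k : G.Walk → ℂ} (hk : Tame R k) {g : G.Series} (hg : Adm R g) {N : G.Mat} (hN : AdmMat R N)
    (ω : G.Dart) : trPair k ω N (jac (cyclicGrad g)) =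
      ∑ φ, ∑ ε, pair (jac (cyclicGrad g) ω φ) fun p => pair (N φ ε) fun q =>
        defectKer (ext0 k) ε (up q.1) (up q.2) (up p.1) (up p.2) := by
  have hJ := admMat_jac hR (adm_cyclicGrad hR hg)
  have hd := fun ε => tame_defectKer ht hk ε
  unfold trPair
  refine Finset.sum_congr rfl fun ε _ => Finset.sum_congr rfl fun φ _ => ?_
  rw [pair_comm (hJ ω ε) (hN ε φ) (hd φ)]
  refine pair_congr fun p => ?_
  have c1 : Tame R fun q : G.Walk × G.Walk =>
      t0 (up q.2 * up p.2) * cycKer (ext0 k) ω (up p.1) (up q.1) := by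
    have := ((tame_cycKer ω hR hk).slice p.1).prod ((tame_t0_mul ht).slice_left p.2)
    simpa only [mul_comm] using this
  have c2 : Tame R fun q : G.Walk × G.Walk =>
      t0 (up p.1 * up q.1) * cycKer (ext0 k) ω (up p.2) (up q.2) :=
    ((tame_t0_mul ht).slice p.1).prod ((tame_cycKer ω hR hk).slice p.2)
  have d1 : Tame R fun q : G.Walk × G.Walk =>
      dsum φ.op (fun α β => t0 (β * up p.1) * ext0 k (α * (up p.2 * up q.2))) (up q.1) := by
    refine (Tame.ev_left (bdd_diffQuot hR φ.op)
      ((tame_t0_mul_ext0 ht hk p.2 p.1).comp_equiv rotEquiv len_rotEquiv)).congr fun q => ?_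
    rw [map_dsum]
    refine dsum_congr _ (fun α β => ?_) _
    rw [ev_sg2]
    refine (ext2_fun_up (fun α β => t0 (β * up p.1) * ext0 k (α * up p.2 * up q.2))
      (by simp) (by simp) α β).trans ?_
    rw [mul_assoc α]
  have d2 : Tame R fun q : G.Walk × G.Walk =>
      dsum φ.op (fun α β => t0 (up p.2 * α) * ext0 k (up q.1 * (up p.1 * β))) (up q.2) := by
    -- This summand is the defect minus the summand already treated.
    have := (hd φ).slice_left p
    have := this.sub d1
    refine this.congr fun q => ?_
    simp only [defectKer, add_sub_cancel_left]
  rw [show (fun q : G.Walk × G.Walk => trKer (ext0 k) ω (up p.1) (up p.2) (up q.1) (up q.2)) =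
    fun q => t0 (up q.2 * up p.2) * cycKer (ext0 k) ω (up p.1) (up q.1) +
      t0 (up p.1 * up q.1) * cycKer (ext0 k) ω (up p.2) (up q.2) from rfl,
    pair_add_right (hJ _ _) c1 c2, pair_jac_first hR ht hk hg, pair_jac_second hR ht hk hg, add_comm,
    ← pair_add_right (hJ _ _) d1 d2]
  rfl

/-! ### The adjoint relation -/

theorem adm_of_isPolyTuple {q : G.Tuple} (h : IsPolyTuple q) (ω : G.Dart) : Adm R (q ω) :=
  adm_of_finite (h.2 ω)

/-- Reversal of paths as an equivalence. -/
def revEquiv : G.Walk ≃ G.Walk := ⟨Walk.rev, Walk.rev, rev_rev, rev_rev⟩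

theorem len_revEquiv (a : G.Walk) : len (revEquiv a) = len a := rev_length a

theorem adm_adj {c : G.Series} (h : Adm R c) : Adm R (adj c) :=
  (h.comp_equiv revEquiv len_revEquiv).star

theorem pair_adj (c : G.Series) (k : G.Walk → ℂ) :
    pair (adj c) k = star (pair c fun a => star (k a.rev)) := by
  rw [← pair_comp_equiv revEquiv c]
  refine (pair_star (fun a => c (revEquiv a)) k).trans ?_
  congr 2
  ext a
  simp [revEquiv]

/-- Reversal of pairs of paths. -/
def revEquiv₂ : G.Walk × G.Walk ≃ G.Walk × G.Walk := revEquiv.prodCongr revEquiv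

theorem len_revEquiv₂ (p : G.Walk × G.Walk) : len (revEquiv₂ p) = len p :=
  congrArg₂ (· + ·) (len_revEquiv p.1) (len_revEquiv p.2)

theorem adm_adj₂ {Q : G.Series₂} (h : Adm R Q) : Adm R (adj₂ Q) :=
  (h.comp_equiv revEquiv₂ len_revEquiv₂).star

theorem pair_adj₂ (Q : G.Series₂) (k : G.Walk × G.Walk → ℂ) :
    pair (adj₂ Q) k = star (pair Q fun p => star (k (p.1.rev, p.2.rev))) := by
  rw [← pair_comp_equiv revEquiv₂ Q]
  refine (pair_star (fun a => Q (revEquiv₂ a)) k).trans ?_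
  congr 2
  ext a
  simp [revEquiv₂, revEquiv]

theorem star_dsum (ε : G.Dart) (k : G.PWalk → G.PWalk → ℂ) (w : G.PWalk) :
    star (dsum ε k w) = dsum ε (fun α β => star (k α β)) w :=
  map_dsum (starAddEquiv : ℂ ≃+ ℂ) ε k w

/-- The Schwinger-Dyson equation as an adjoint relation on monomials. -/
theorem ev_jacAdjKer_star_t0 (ε : G.Dart) (a b : G.Walk) (c : G.PWalk) :
    ev (fun γ => star (t0 (up γ.rev * c))) (jacAdjKer ε (a, b)) =
      star (dsum ε (fun α β => t0 (up a.rev * α) * t0 (β * up b.rev)) c) := by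
  have h0 : ∀ w, ext0 (fun γ => star (t0 (up γ.rev * c))) w = star (t0 (prev w * c)) :=
    ext0_fun_up (fun w => star (t0 (prev w * c))) (by simp)
  -- The equation is applied to a^* c b^*. Cuts inside a^* and b^* give the two correction terms of
  -- the adjoint formula, and cuts inside `c` give the derivative of `c`.
  have hsd := schwinger_dyson ε (prev (up a) * c * prev (up b))
  rw [dsum_mul _ _ (by simp) (by simp), dsum_mul _ _ (by simp) (by simp), dsum_prev, dsum_prev]
    at hsd
  rw [ev_jacAdjKer]
  simp only [h0, prev_mul, prev_edge]
  apply star_injective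
  rw [star_star, star_sub, star_sub, star_dsum, star_dsum, star_mul', star_star]
  have hk : star (kap ε : ℂ) = kap ε := Complex.conj_ofReal _
  have e1 : t0 (prev (up b) * (edge ε.op * prev (up a)) * c) =
      t0 (edge ε.op * (prev (up a) * c * prev (up b))) := by
    rw [mul_assoc, t0_mul_comm]
    simp only [mul_assoc]
  have e2 : dsum ε.op (fun α β => star (t0 β * star (t0 (prev (up b) * prev α * c)))) (up a) =
      dsum ε.op (fun α β => t0 (prev β) * t0 (prev α * c * prev (up b))) (up a) := by
    refine dsum_congr _ (fun α β => ?_) _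
    rw [star_mul', star_star, t0_prev]
    congr 1
    rw [mul_assoc, t0_mul_comm]
  have e3 : dsum ε.op (fun α β => star (t0 α * star (t0 (prev β * prev (up a) * c)))) (up b) =
      dsum ε.op (fun α β => t0 (prev (up a) * c * prev β) * t0 (prev α)) (up b) := by
    refine dsum_congr _ (fun α β => ?_) _
    rw [star_mul', star_star, t0_prev, mul_comm]
    congr 1
    rw [mul_assoc, t0_mul_comm]
  rw [hk, e1, e2, e3, hsd, ← prev_up, ← prev_up]
  simp only [mul_assoc]
  ring

theorem opEquiv_sum [Fintype E] (F : G.Dart → ℂ) : ∑ ε : G.Dart, F ε.op = ∑ ε, F ε :=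
  Equiv.sum_comp (⟨Dart.op, Dart.op, fun _ => rfl, fun _ => rfl⟩ : G.Dart ≃ G.Dart) F

/-- The kernel of `⟨∂_ε^*(a ⊗ b), c⟩` on monomials. -/
def sdKer (ε : G.Dart) (p : G.Walk × G.Walk) (c : G.Walk) : ℂ :=
  dsum ε (fun α β => t0 (up p.1 * α) * t0 (β * up p.2)) (up c)

theorem tame_sdKer (hR : 0 < R) (ht : Tame R (tw (G := G))) (ε : G.Dart) :
    Tame R fun z : (G.Walk × G.Walk) × G.Walk => sdKer ε z.1 z.2 := by
  refine (Tame.ev_right (bdd_diffQuot hR ε) (tame_mulTest (ht.prod ht))).congr fun z => ?_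
  rw [map_dsum]
  refine dsum_congr _ (fun α β => ?_) _
  rw [ev_sg2]
  refine (ext2_fun_up (fun α β => ext2 (fun p => tw p.1 * tw p.2) (up z.1.1 * α)
    (β * up z.1.2)) (by simp) (by simp) α β).trans ?_
  exact ext2_fun_up (fun u w => t0 u * t0 w) (by simp) (by simp) _ _

/-- Fubini reduces the inner product with a series to monomials, where it is the Schwinger-Dyson
equation. -/
theorem pair_mul_adj_jacAdj [Fintype E] (hR : 0 < R) (ht : Tame R (tw (G := G))) {Q : G.Mat}
    (hQ : AdmMat R Q) {c : G.Series} (hc : Adm R c) (ω : G.Dart) :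
    pair (mul (adj (jacAdj Q ω)) c) tw =
      ∑ ε, pair c fun a => pair (adj₂ (Q ω ε)) fun p => sdKer ε p a := by
  have hJ := adm_adj (adm_jacAdj ht hQ ω)
  have htm := tame_t0_mul ht
  have e1 : pair (mul (adj (jacAdj Q ω)) c) tw =
      pair (adj (jacAdj Q ω)) fun a => pair c fun b => t0 (up a * up b) :=
    (pair_mul hJ hc ht).trans (pair_prod (k := fun z => t0 (up z.1 * up z.2)) hJ hc htm)
  rw [e1, pair_comm (k := fun z => t0 (up z.1 * up z.2)) hJ hc htm, ← pair_sum_right _ hc]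
  · refine pair_congr fun a => ?_
    have htc : Tame R fun b : G.Walk => star (t0 (up b.rev * up a)) :=
      ((htm.slice_left a).comp_equiv revEquiv len_revEquiv).star
    rw [pair_adj, pair_jacAdj ht hQ ω htc, star_sum]
    refine Finset.sum_congr rfl fun ε _ => ?_
    rw [pair_adj₂]
    congr 1
    exact pair_congr fun p => ev_jacAdjKer_star_t0 ε p.1 p.2 (up a)
  · intro ε
    exact Tame.pair_right (k := fun z => sdKer ε z.2 z.1) (adm_adj₂ (hQ ω ε)) ((tame_sdKer hR ht ε).comp_equiv (Equiv.prodComm _ _)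
      fun z => by simp [len_prod, add_comm])

theorem tupleInner_jacAdj [Fintype E] {M : ℝ} (hM0 : 0 < M) (hMR : M < R)
    (hx : ∀ ε : G.Dart, ‖x ε‖ ≤ M) {Q : G.Mat} (hQ : AdmMat R Q) {q : G.Tuple}
    (hq : ∀ ω, Adm R (q ω)) : tupleInner (jacAdj Q) q =
      ∑ ω, ∑ ε, pair (q ω) fun c => pair (adj₂ (Q ω ε)) fun p => sdKer ε p c := by
  have ht := tame_tw hM0 hMR hx
  have hmul : ∀ ω, Adm R (mul (adj (jacAdj Q ω)) (q ω)) :=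
    fun ω => adm_mul (adm_adj (adm_jacAdj ht hQ ω)) (hq ω)
  have e1 : dot (tupleAdj (jacAdj Q)) q =
      fun γ => ∑ ε : G.Dart, mul (adj (jacAdj Q ε.op)) (q ε.op) γ := by
    ext γ
    simp [dot, tupleAdj, Finset.sum_apply]
  have e2 : Adm R fun γ => ∑ ε : G.Dart, mul (adj (jacAdj Q ε.op)) (q ε.op) γ :=
    Adm.sum _ fun ε => hmul ε.op
  have e3 : pair (fun γ => ∑ ε : G.Dart, mul (adj (jacAdj Q ε.op)) (q ε.op) γ) tw =
      ∑ ε : G.Dart, pair (mul (adj (jacAdj Q ε.op)) (q ε.op)) tw :=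
    pair_sum_left (F := fun ε : G.Dart => mul (adj (jacAdj Q ε.op)) (q ε.op)) _
      (fun ε => hmul ε.op) ht
  unfold tupleInner
  rw [e1]
  refine (tau_eq_pair hM0 hMR hx e2).trans (e3.trans ?_)
  refine (opEquiv_sum fun ω => pair (mul (adj (jacAdj Q ω)) (q ω)) tw).trans ?_
  exact Finset.sum_congr rfl fun ω _ => pair_mul_adj_jacAdj (hM0.trans hMR) ht hQ (hq ω) ω

theorem pair_mul₂_diffQuot (hR : 0 < R) (ht : Tame R (tw (G := G))) {F : G.Series₂}
    (hF : Adm R F) {c : G.Series} (hc : Adm R c) (ε : G.Dart) :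
    pair (mul₂ F (diffQuot ε c)) (fun p => tw p.1 * tw p.2) =
      pair c fun a => pair F fun p => sdKer ε p a := by
  have htt : Tame R fun p : G.Walk × G.Walk => tw p.1 * tw p.2 := ht.prod ht
  refine Eq.trans ?_ (pair_comm (k := fun z => sdKer ε z.1 z.2) hF hc (tame_sdKer hR ht ε))
  refine (pair_mul₂_iter hF (adm_diffQuot hR ε hc) htt).trans ?_
  refine pair_congr fun p => ?_
  refine (pair_diffQuot hR ε hc ((tame_mulTest htt).slice p)).trans ?_
  refine pair_congr fun a => dsum_congr _ (fun α β => ?_) _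
  refine (ext2_fun_up (fun α β => ext2 (fun p => tw p.1 * tw p.2) (up p.1 * α)
      (β * up p.2)) (by simp) (by simp) α β).trans ?_
  exact ext2_fun_up (fun u w => t0 u * t0 w) (by simp) (by simp) _ _

/-- Both inner products become the pairing of the polynomial tuple and the adjoint of `Q` against
`sdKer`: one by the Schwinger-Dyson equation, the other by the definition of the Jacobian. -/
theorem isJacAdjoint_jacAdj [Fintype E] {M : ℝ} (hM0 : 0 < M) (hMR : M < R)
    (hx : ∀ ε : G.Dart, ‖x ε‖ ≤ M) {Q : G.Mat} (hQ : AdmMat R Q) :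
    IsJacAdjoint Q (jacAdj Q) := by
  intro q hq
  have hR := hM0.trans hMR
  have ht := tame_tw hM0 hMR hx
  have hqa : ∀ ω, Adm R (q ω) := adm_of_isPolyTuple hq
  have hadj : AdmMat R (matAdj Q) := fun ε φ => adm_adj₂ (hQ φ ε)
  have htt : Tame R fun p : G.Walk × G.Walk => tw p.1 * tw p.2 := ht.prod ht
  have hjq : AdmMat R (jac q) := admMat_jac hR hqa
  have hmul : ∀ ε ω, Adm R (mul₂ (matAdj Q ε ω) (jac q ω ε)) :=
    fun ε ω => adm_mul₂ (hadj ε ω) (hjq ω ε)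
  unfold matInner
  rw [tupleInner_jacAdj hM0 hMR hx hQ hqa, tauTau_eq hM0 hMR hx (adm_matTr (hadj.matMul hjq)),
    matTr_matMul, pair_sum_left _ (fun ε => Adm.sum _ fun ω => hmul ε ω) htt, Finset.sum_comm]
  refine Finset.sum_congr rfl fun ε _ => ?_
  refine Eq.trans ?_ (pair_sum_left _ (fun ω => hmul ε ω) htt).symm
  exact Finset.sum_congr rfl fun ω _ => (pair_mul₂_diffQuot hR ht (hadj ε ω) (hqa ω) ε).symm

/-! ### Supports -/

theorem isCompressed_cyclicGrad (g : G.Series) : IsCompressed (cyclicGrad g) := by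
  intro ε γ h
  change (∑ i ∈ Finset.range (γ.length + 1), diffQuot ε.op g (γ.drop i, γ.take i)) ≠ 0 at h
  obtain ⟨i, -, hi⟩ := Finset.exists_ne_zero_of_sum_ne_zero h
  by_contra hc
  refine hi (dif_neg fun h' => hc ⟨h'.2.symm, ?_⟩)
  rw [← drop_tgt γ i]
  exact h'.1

theorem isCompressedMat_jac {f : G.Tuple} (h : IsCompressed f) : IsCompressedMat (jac f) := by
  intro ε φ p hp
  rw [jac, diffQuot_eq] at hp
  rcases PWalk.cases (up p.1 * edge φ * up p.2) with h0 | ⟨γ, hγ⟩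
  · rw [h0] at hp; exact absurd rfl hp
  · rw [hγ] at hp
    obtain ⟨h1, h2⟩ := h ε γ hp
    obtain ⟨h3, h4, -, h5, h6⟩ := src_tgt_length_of_cut hγ
    exact ⟨h3.symm.trans h1, h5, h6.symm, h4.symm.trans h2⟩

theorem dsum_apply_eq_zero (ε : G.Dart) (k : G.PWalk → G.PWalk → G.Walk →₀ ℂ) (a γ : G.Walk)
    (h : ∀ α β : G.Walk, up α * edge ε * up β = up a → k (up α) (up β) γ = 0) :
    dsum ε k (up a) γ = 0 := by
  rw [dsum_eq_sum_cuts, Finsupp.finsetSum_apply]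
  exact Finset.sum_eq_zero fun p hp => h _ _ (mem_cuts.1 hp)

/-- Each term of the kernel alters only the inner part of the two paths, so the outer endpoints
persist. -/
theorem jacAdjKer_ne_zero {ε : G.Dart} {p : G.Walk × G.Walk} {γ : G.Walk}
    (h : jacAdjKer ε p γ ≠ 0) : γ.src = p.1.src ∧ γ.tgt = p.2.tgt := by
  classical
  by_contra hc
  apply h
  rw [jacAdjKer, Finsupp.sub_apply, Finsupp.sub_apply, Finsupp.smul_apply, sg_apply, if_neg,
    dsum_apply_eq_zero, dsum_apply_eq_zero]
  · simp
  · intro α β hβ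
    rw [Finsupp.smul_apply, sg_apply, if_neg, smul_zero]
    intro hγ
    obtain ⟨h1, h2, -⟩ := src_tgt_length_of_mul hγ
    exact hc ⟨h1, h2.trans (src_tgt_length_of_cut hβ).2.1.symm⟩
  · intro α β hβ
    rw [Finsupp.smul_apply, sg_apply, if_neg, smul_zero]
    intro hγ
    obtain ⟨h1, h2, -⟩ := src_tgt_length_of_mul hγ
    exact hc ⟨h1.trans (src_tgt_length_of_cut hβ).1.symm, h2⟩
  · intro hγ
    obtain ⟨h1, h2, -⟩ := src_tgt_length_of_cut hγ
    exact hc ⟨h1, h2⟩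

theorem isCompressed_jacAdj [Fintype E] {Q : G.Mat} (h : IsCompressedMat Q) :
    IsCompressed (jacAdj Q) := by
  intro ω γ hγ
  obtain ⟨ε, -, hε⟩ := Finset.exists_ne_zero_of_sum_ne_zero hγ
  by_contra hc
  refine hε ((tsum_congr fun p => ?_).trans tsum_zero)
  by_contra hp
  obtain ⟨h1, -, -, h4⟩ := h _ _ _ (left_ne_zero_of_mul hp)
  obtain ⟨h5, h6⟩ := jacAdjKer_ne_zero (right_ne_zero_of_mul hp)
  exact hc ⟨h5.trans h1, h6.trans h4⟩

end WeightedGraph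
end FreeGraph
end

/-! ### Assembly of the identity. -/

open FreeGraph WeightedGraph in
theorem theorem2p3 {V E : Type*} [Fintype V] [Fintype E] (G : WeightedGraph V E)
    (R : ℝ) (hR0 : 0 < R) (hR : ∀ ε : G.Dart, ‖x ε‖ < R)
    (g : G.Series) (hg : MemB R g) (hsa : adj g = g) (m : ℕ) (hm : 1 ≤ m) :
    let f : G.Tuple := cyclicGrad g
    let T : G.Series :=
      oneTau (matTr (matPow (jac f) m)) + tauOne (matTr (matPow (jac f) m))
    (∀ S, 0 < S → S < R → MemTuple S f ∧ MemMat S (matPow (jac f) m) ∧ MemB S T) ∧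
    ∃ h h' : G.Tuple,
      (∀ S, 0 < S → S < R → MemTuple S h ∧ MemTuple S h') ∧
      IsJacAdjoint (matPow (jac f) (m - 1)) h ∧
      IsJacAdjoint (matPow (jac f) m) h' ∧
      (1 / m : ℂ) • cyclicGrad T = matAct (jac f) h - h' := by
  intro f T
  classical
  -- There are finitely many edges, so some positive bound on the generators lies strictly below
  -- `R`. The gap makes the moments a tame test function.
  obtain ⟨M, hM0, hMR, hx⟩ : ∃ M, 0 < M ∧ M < R ∧ ∀ ε : G.Dart, ‖x ε‖ ≤ M := by
    have h1 : ∀ᶠ M in nhdsWithin R (Set.Iio R), ∀ ε : G.Dart, ‖x ε‖ ≤ M := by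
      rw [Filter.eventually_all]
      intro ε
      filter_upwards [Ioo_mem_nhdsLT (hR ε)] with M hM using hM.1.le
    obtain ⟨M, h2, h3⟩ := (h1.and (Ioo_mem_nhdsLT hR0)).exists
    exact ⟨M, h3.1, h3.2, h2⟩
  obtain ⟨n, rfl⟩ : ∃ n, m = n + 1 := ⟨m - 1, by omega⟩
  have ht := tame_tw hM0 hMR hx
  have hga : Adm R g := by
    intro S h0 h1
    refine Summable.of_nonneg_of_le (fun γ => by positivity) (fun γ => ?_) hg
    exact mul_le_mul_of_nonneg_left (pow_le_pow_left₀ h0.le h1.le _) (norm_nonneg _)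
  have hfa : ∀ ε, Adm R (f ε) := adm_cyclicGrad hR0 hga
  have hJ : AdmMat R (jac f) := admMat_jac hR0 hfa
  have hfc : IsCompressed f := isCompressed_cyclicGrad g
  have hJc : IsCompressedMat (jac f) := isCompressedMat_jac hfc
  have hpow := admMat_matPow hJ
  have hpowc := isCompressedMat_matPow hJc
  have hTa : Adm R T := (adm_oneTau hM0 hMR hx (adm_matTr (hpow _))).add
    (adm_tauOne hM0 hMR hx (adm_matTr (hpow _)))
  have hadj : ∀ i ω, Adm R (jacAdj (matPow (jac f) i) ω) := fun i => adm_jacAdj ht (hpow i)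
  refine ⟨fun S h0 h1 => ⟨⟨hfc, fun ε => hfa ε S h0 h1⟩,
      ⟨hpowc _, fun ε φ => hpow _ ε φ S h0 h1⟩, hTa S h0 h1⟩,
    jacAdj (matPow (jac f) n), jacAdj (matPow (jac f) (n + 1)),
    fun S h0 h1 => ⟨⟨isCompressed_jacAdj (hpowc _), fun ε => hadj _ ε S h0 h1⟩,
      ⟨isCompressed_jacAdj (hpowc _), fun ε => hadj _ ε S h0 h1⟩⟩,
    isJacAdjoint_jacAdj hM0 hMR hx (hpow _), isJacAdjoint_jacAdj hM0 hMR hx (hpow _), ?_⟩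
  ext ω γ
  -- Coefficients at `γ` are compared by testing against the point mass there.
  have hk := tame_pi_single hR0 γ
  have e1 := pair_cyclicDeriv_trace ω hM0 hMR hx (hpow n) hJ hk
  have e2 := trPair_matPow ω hR0 ht hk hJ hJc n 0
  have e3 := pair_matAct_jacAdj ht hJ (hpow n) ω hk
  rw [matPow_one hJc, zero_add] at e2
  rw [← trPair_jac_cyclicGrad hR0 ht hk hga (hpow n) ω, matMul_matPow hR0 hJ hJc,
    pair_pi_single, pair_pi_single] at e3
  rw [e2, pair_pi_single] at e1
  change (1 / ((n + 1 : ℕ) : ℂ)) * cyclicDeriv ω T γ =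
    matAct (jac f) (jacAdj (matPow (jac f) n)) ω γ - jacAdj (matPow (jac f) (n + 1)) ω γ
  -- One term comes from differentiating the last factor, and `n` from the other power.
  have e4 : cyclicDeriv ω T γ = ((n + 1 : ℕ) : ℂ) *
      trPair (Pi.single γ 1) ω (matPow (jac f) n) (jac f) := by
    refine e1.trans ?_
    push_cast
    ring
  have hn : ((n + 1 : ℕ) : ℂ) ≠ 0 := by exact_mod_cast Nat.succ_ne_zero n
  rw [e3, e4, add_sub_cancel_left, ← mul_assoc, one_div_mul_cancel hn, one_mul]
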